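/- **Exact elfs.** Let $G=(V,E,w)$ be a finite undirected graph with positive weights $w_{xy}=w_{yx}$ on the edges ($E\subseteq V\times V$ symmetric, $w_{xy}=0$ for $(x,y)\notin E$) and degrees $d_x=\sum_y w_{xy}$. Let $s\in V$, $M\subseteq V$ with $s\notin M$, and suppose that $M$ can be reached from $s$. Let $f$ be the unit electric flow from $s$ to $M$, i.e. the unit flow minimizing $\mathcal E(f)=\frac12\sum_{(x,y)\in E}f_{xy}^2/w_{xy}$; let $R_s$ be its energy. For the random walk $(X_t)$ from $s$ with transition probabilities $w_{xy}/d_x$ and hitting time $\tau_M$ of $M$, let $\mathrm{ET}_s=\mathbb E[1+\max\{t<\tau_M: X_t=s\}]$ be the escape time. On $\ell(E)=\mathrm{span}\{|xy\rangle:(x,y)\in E\}$ let $|\phi_x\rangle=d_x^{-1/2}\sum_y\sqrt{w_{xy}}\,|xy\rangle$ and $\mathrm{SWAP}|xy\rangle=|yx\rangle$, and let $U=(2\Pi_*-I)\,\mathrm{SWAP}$ be the quantum walk operator for source $s$ and sink $M$, where $\Pi_*$ is the projector onto $\mathrm{span}\{|\phi_x\rangle: x\notin\{s\}\cup M\}$.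 For $\eta>0$ the modified graph $\hat G$ is $G$ with a new vertex $\sigma$ joined to $s$ by an edge of weight $\eta d_s$; $\hat R_\sigma$, $\hat f$, $|\hat\phi_\sigma\rangle=|\sigma s\rangle$ and $\hat U$ are the effective resistance, the unit electric flow, the source star state and the quantum walk operator of $\hat G$ for source $\sigma$ and sink $M$, and $|\hat f\rangle=\frac{1}{\sqrt{2\hat R_\sigma}}\sum_{(x,y)}\frac{\hat f_{xy}}{\sqrt{\hat w_{xy}}}|xy\rangle$, the sum being over the edges of $\hat G$. We view $\ell(E)\subseteq\ell(\hat E)$. A unitary $S$ on $\mathcal H\oplus\mathcal L$ ($\mathcal H$ public, $\mathcal L$ private) *transduces* $\xi\in\mathcal H$ into $\tau\in\mathcal H$, with catalyst $w\in\mathcal L$ and transduction complexity $\|w\|^2$, if $S(\xi\oplus w)=\tau\oplus w$. We consider circuits on the edge register $\ell(\hat E)$ and a memory of finitely many qubits and finitely many infinite ($\mathbb Z$-valued) counters; one designated qubit is $|0\rangle$ on the public and $|1\rangle$ on the private space. The elementary operations are: an arbitrary one-qubit unitary; a Toffoli or controlled-NOT gate; increasing or decreasing a counter by one, controlled on a qubit;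 flipping a qubit if a counter is zero; and $\mathrm{SWAP}$ or the reflection $2|\hat\phi_\sigma\rangle\langle\hat\phi_\sigma|-I$ on the edge register, controlled on a qubit. In addition a circuit may use the walk operator $\hat U$, controlled on a qubit. **Theorem.** For every $\kappa\ge 1$ there are constants $C$ and $k$ such that for all reals $\overline{\mathrm{ET}}_s>0$ and $r>0$ there is a circuit, depending only on $\kappa$, $\overline{\mathrm{ET}}_s$ and $r$ (and not on the graph), which consists of exactly one controlled call to the walk operator and at most $C\,(1+\log(1+\overline{\mathrm{ET}}_s))^k=\widetilde O(1)$ elementary operations, such that the following holds for all $G,s,M$ as above with $$\mathrm{ET}_s\le\overline{\mathrm{ET}}_s\qquad\text{and}\qquad \tfrac1\kappa R_sd_s\le r\le\kappa R_sd_s .$$ Let $\hat G$ be the modified graph with $\eta=\overline{\mathrm{ET}}_s/r$. The unitary $S$ that the circuit performs with the walk operator $\hat U$ of $\hat G$ transduces $$|\phi_s\rangle|0\rangle\rightsquigarrow|\hat f\rangle|\Gamma_s\rangle$$ for some unit garbage state $|\Gamma_s\rangle$ of the memory, with a catalyst of transduction complexity at most $C\sqrt{\overline{\mathrm{ET}}_s}$.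 Here $|0\rangle$ is the state in which all qubits and counters are zero. The same circuit also transduces the source star state of $\hat G$, $|\hat\phi_\sigma\rangle|0\rangle\rightsquigarrow|\hat f\rangle|\Gamma'_s\rangle$ with some unit garbage state $|\Gamma'_s\rangle$, again with complexity at most $C\sqrt{\overline{\mathrm{ET}}_s}$. -/

import Mathlib

open scoped ENNReal

universe u v

noncomputable section

/-! ## Weighted graphs, flows and random walks -/

/-- An undirected weighted graph on `V`; the edge set is the support of the weights. -/
structure Network (V : Type u) where
  w : V → V → ℝ
  symm : ∀ x y, w x y = w y x
  nonneg : ∀ x y, 0 ≤ w x y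

namespace Network

variable {V : Type u}

/-- The (directed) edges `(x, y)` of the graph; `(x, y)` is an edge iff `(y, x)` is one. -/
abbrev Edge (N : Network V) : Type u := {e : V × V // 0 < N.w e.1 e.2}

/-- The weighted degree `d_x`. -/
def deg [Fintype V] (N : Network V) (x : V) : ℝ := ∑ y, N.w x y

/-- `M` can be reached from `s` along edges. -/
def Reaches (N : Network V) (s : V) (M : Finset V) : Prop :=
  ∃ m ∈ M, Relation.ReflTransGen (fun x y => 0 < N.w x y) s m

/-- Unit `s`-`M` flows: functions on the edges (extended by zero to all pairs). -/
structure IsUnitFlow [Fintype V] (N : Network V) (s : V) (M : Finset V) (g : V → V → ℝ) :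
    Prop where
  support : ∀ x y, N.w x y = 0 → g x y = 0
  antisymm : ∀ x y, g x y = -g y x
  source : ∑ y, g s y = 1
  sink : ∑ m ∈ M, ∑ y, g y m = 1
  conserve : ∀ x, x ≠ s → x ∉ M → ∑ z, g x z = 0

/-- The dissipated energy (pairs that are not edges contribute zero for a flow). -/
def energy [Fintype V] (N : Network V) (g : V → V → ℝ) : ℝ :=
  1 / 2 * ∑ x, ∑ y, g x y ^ 2 / N.w x y

/-- `f` is a unit electric flow from `s` to `M`: a unit flow of least energy. -/
def IsElectricFlow [Fintype V] (N : Network V) (s : V) (M : Finset V) (f : V → V → ℝ) : Prop :=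
  N.IsUnitFlow s M f ∧ ∀ g, N.IsUnitFlow s M g → N.energy f ≤ N.energy g

/-- The effective resistance `R_s`: the least energy of a unit flow. -/
def effRes [Fintype V] (N : Network V) (s : V) (M : Finset V) : ℝ :=
  sInf (N.energy '' {g | N.IsUnitFlow s M g})

/-- `X` is the random walk on the graph that starts from `s`, with steps `w_xy / d_x`. -/
structure IsRandomWalk [Fintype V] [DecidableEq V] (N : Network V) (s : V) {Ω : Type v}
    [MeasurableSpace Ω] (P : MeasureTheory.Measure Ω) (X : ℕ → Ω → V) : Prop where
  measurable : ∀ n x, MeasurableSet {ω | X n ω = x}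
  law : ∀ (n : ℕ) (p : ℕ → V), P {ω | ∀ i ≤ n, X i ω = p i} =
    if p 0 = s then
      ENNReal.ofReal (∏ i ∈ Finset.range n, N.w (p i) (p (i + 1)) / N.deg (p i))
    else 0

/-- The graph with a new vertex `none` attached to `s` by an edge of weight `η d_s`. -/
def modified [Fintype V] [DecidableEq V] (N : Network V) (s : V) (η : ℝ) (hη : 0 ≤ η) :
    Network (Option V) where
  w
    | some x, some y => N.w x y
    | some x, none => if x = s then η * N.deg s else 0
    | none, some y => if y = s then η * N.deg s else 0
    | none, none => 0
  symm := by
    rintro (_ | x) (_ | y) <;> simp [N.symm]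
  nonneg := by
    have h : 0 ≤ η * N.deg s := mul_nonneg hη (Finset.sum_nonneg fun y _ => N.nonneg s y)
    rintro (_ | x) (_ | y)
    · exact le_rfl
    · dsimp only; split_ifs <;> first | exact h | exact le_rfl
    · dsimp only; split_ifs <;> first | exact h | exact le_rfl
    · exact N.nonneg x y

end Network

/-- `1 + max {t < τ_M : X_t = s}` on one trajectory `x`, where `τ_M` is the hitting time
of `M` (and `0` if there is no such `t`, `∞` if they are unbounded). -/
def lastExit {V : Type u} (s : V) (M : Finset V) (x : ℕ → V) : ℝ≥0∞ :=
  ⨆ t : ℕ, ⨆ _ : x t = s ∧ ∀ i ≤ t, x i ∉ M, ((t : ℝ≥0∞) + 1)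

/-- The escape time: the expected time at which `X` leaves `s` for the last time before
it hits `M`. -/
def escapeTime {V : Type u} (s : V) (M : Finset V) {Ω : Type v} [MeasurableSpace Ω]
    (P : MeasureTheory.Measure Ω) (X : ℕ → Ω → V) : ℝ≥0∞ :=
  ∫⁻ ω, lastExit s M (fun t => X t ω) ∂P

/-! ## The edge space and the quantum walk -/

namespace Network

variable {V : Type u} [Fintype V] [DecidableEq V]

/-- The edge space, with orthonormal basis `|xy⟩` over the edges. -/
abbrev EdgeSpace (N : Network V) : Type u := EuclideanSpace ℂ N.Edge

/-- The star state at `x`. -/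
def starState (N : Network V) (x : V) : N.EdgeSpace :=
  WithLp.toLp 2 fun e =>
    if e.1.1 = x then ((Real.sqrt (N.w e.1.1 e.1.2) / Real.sqrt (N.deg x) : ℝ) : ℂ) else 0

/-- The star subspace: the span of the star states at `x ∉ {s} ∪ M`. -/
def starSpace (N : Network V) (s : V) (M : Finset V) : Submodule ℂ N.EdgeSpace :=
  Submodule.span ℂ (N.starState '' {x | x ≠ s ∧ x ∉ M})

/-- Reversal of edges. -/
def edgeRev (N : Network V) : N.Edge ≃ N.Edge where
  toFun e := ⟨(e.1.2, e.1.1), by have h := e.2; rwa [N.symm] at h⟩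
  invFun e := ⟨(e.1.2, e.1.1), by have h := e.2; rwa [N.symm] at h⟩
  left_inv _ := rfl
  right_inv _ := rfl

/-- The operator `|xy⟩ ↦ |yx⟩`. -/
def swapOp (N : Network V) : N.EdgeSpace ≃ₗᵢ[ℂ] N.EdgeSpace :=
  LinearIsometryEquiv.piLpCongrLeft 2 ℂ ℂ N.edgeRev

/-- The quantum walk operator `(2 Π_* - I) SWAP`. -/
def walkOp (N : Network V) (s : V) (M : Finset V) : N.EdgeSpace ≃ₗᵢ[ℂ] N.EdgeSpace :=
  N.swapOp.trans (N.starSpace s M).reflection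

/-- The reflection `2 |φ_s⟩⟨φ_s| - I` about the star state of the source. -/
def sourceRefl (N : Network V) (s : V) : N.EdgeSpace ≃ₗᵢ[ℂ] N.EdgeSpace :=
  (Submodule.span ℂ {N.starState s}).reflection

/-- The normalized state `(2 R_s)^{-1/2} ∑ f_xy / √w_xy |xy⟩` of a flow `f`. -/
def flowState (N : Network V) (s : V) (M : Finset V) (f : V → V → ℝ) : N.EdgeSpace :=
  WithLp.toLp 2 fun e =>
    ((1 / Real.sqrt (2 * N.effRes s M) * (f e.1.1 e.1.2 / Real.sqrt (N.w e.1.1 e.1.2)) : ℝ) : ℂ)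

/-- The inclusion of the edge space of a graph into that of the modified graph. -/
def liftState (N : Network V) (s : V) (η : ℝ) (hη : 0 ≤ η) (ψ : N.EdgeSpace) :
    (N.modified s η hη).EdgeSpace :=
  WithLp.toLp 2 fun e =>
    match e with
    | ⟨(some x, some y), h⟩ => ψ ⟨(x, y), h⟩
    | ⟨(some _, none), _⟩ => 0
    | ⟨(none, _), _⟩ => 0

end Network

/-! ## Transducers -/

/-- The unitary `S` on `H ⊕ Hᗮ` transduces `ξ` into `τ` with catalyst `w`, where `H` is the
public space; the transduction complexity is `‖w‖ ^ 2`. -/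
def Transduces {E : Type*} [NormedAddCommGroup E] [InnerProductSpace ℂ E] (S : E ≃ₗᵢ[ℂ] E)
    (H : Submodule ℂ E) (ξ τ w : E) : Prop :=
  ξ ∈ H ∧ τ ∈ H ∧ w ∈ Hᗮ ∧ S (ξ + w) = τ + w

/-! ## Circuits with infinite counters -/

/-- The basis states of the work memory: `q + 1` qubits and `c` integer counters. -/
abbrev Mem (q c : ℕ) : Type := (Fin (q + 1) → Bool) × (Fin c → ℤ)

/-- The Hilbert space `F ⊗ ℓ²(Mem q c)`, as the square-summable families of vectors of `F`
indexed by the basis states of the memory. -/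
abbrev Joint (F : Type*) [NormedAddCommGroup F] (q c : ℕ) : Type _ :=
  lp (fun _ : Mem q c => F) 2

/-- The elementary operations, and controlled calls to the walk operator. -/
inductive Gate (q c : ℕ) : Type
  /-- an arbitrary unitary on qubit `i` -/
  | qubit (i : Fin (q + 1)) (U : Matrix.unitaryGroup Bool ℂ)
  /-- flip qubit `k` if qubits `i` and `j` are set (a controlled NOT if `i = j`) -/
  | toffoli (i j k : Fin (q + 1)) (hi : i ≠ k) (hj : j ≠ k)
  /-- increase counter `j` by one if qubit `i` is set -/
  | inc (i : Fin (q + 1)) (j : Fin c)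
  /-- decrease counter `j` by one if qubit `i` is set -/
  | dec (i : Fin (q + 1)) (j : Fin c)
  /-- flip qubit `i` if counter `j` is zero -/
  | zeroTest (i : Fin (q + 1)) (j : Fin c)
  /-- reverse the edge in the edge register if qubit `i` is set -/
  | swap (i : Fin (q + 1))
  /-- reflect the edge register about the star state of the source if qubit `i` is set -/
  | refl (i : Fin (q + 1))
  /-- apply the quantum walk operator to the edge register if qubit `i` is set -/
  | walk (i : Fin (q + 1))

/-- Is the gate a controlled call to the walk operator? -/
def Gate.isWalk {q c : ℕ} : Gate q c → Bool
  | .walk _ => true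
  | _ => false

section Semantics

variable {F : Type*} [NormedAddCommGroup F] [InnerProductSpace ℂ F] {q c : ℕ}

theorem Joint.hasSum_norm_sq {F : Type*} [NormedAddCommGroup F] {q c : ℕ} (ψ : Joint F q c) :
    HasSum (fun m => ‖ψ m‖ ^ 2) (‖ψ‖ ^ 2) := by
  have h := lp.hasSum_norm (p := 2) (by norm_num) ψ
  simpa using h

theorem memJoint_iff {F : Type*} [NormedAddCommGroup F] {q c : ℕ} (f : Mem q c → F) :
    Memℓp f 2 ↔ Summable (fun m => ‖f m‖ ^ 2) := by
  rw [memℓp_gen_iff (by norm_num)]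
  simp

/-- A linear equivalence that preserves the sums of squares, as a unitary. -/
def jointIso (T : (Mem q c → F) ≃ₗ[ℂ] (Mem q c → F))
    (h : ∀ f a, HasSum (fun m => ‖f m‖ ^ 2) a → HasSum (fun m => ‖T f m‖ ^ 2) a)
    (h' : ∀ f a, HasSum (fun m => ‖f m‖ ^ 2) a → HasSum (fun m => ‖T.symm f m‖ ^ 2) a) :
    Joint F q c ≃ₗᵢ[ℂ] Joint F q c where
  toFun ψ := ⟨T ψ, (memJoint_iff _).2 (h _ _ (Joint.hasSum_norm_sq ψ)).summable⟩
  invFun ψ := ⟨T.symm ψ, (memJoint_iff _).2 (h' _ _ (Joint.hasSum_norm_sq ψ)).summable⟩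
  left_inv ψ := by ext m; simp
  right_inv ψ := by ext m; simp
  map_add' ψ χ := Subtype.ext (map_add T (ψ : Mem q c → F) χ)
  map_smul' a ψ := Subtype.ext (map_smul T a (ψ : Mem q c → F))
  norm_map' ψ := by
    have h1 := Joint.hasSum_norm_sq (F := F) (q := q) (c := c)
      ⟨T ψ, (memJoint_iff _).2 (h _ _ (Joint.hasSum_norm_sq ψ)).summable⟩
    have h3 := h1.unique (h _ _ (Joint.hasSum_norm_sq ψ))
    exact (pow_left_inj₀ (norm_nonneg _) (norm_nonneg _) two_ne_zero).1 h3

/-- The unitary `|m⟩ ↦ |π m⟩` on the memory. -/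
def permGate (π : Equiv.Perm (Mem q c)) : Joint F q c ≃ₗᵢ[ℂ] Joint F q c :=
  jointIso (LinearEquiv.funCongrLeft ℂ F π.symm)
    (fun f _ hf => (π.symm.hasSum_iff (f := fun m => ‖f m‖ ^ 2)).2 hf)
    (fun f _ hf => (π.hasSum_iff (f := fun m => ‖f m‖ ^ 2)).2 hf)

/-- The operator `A` on `F`, controlled on qubit `i`. -/
def ctrlGate (i : Fin (q + 1)) (A : F ≃ₗᵢ[ℂ] F) : Joint F q c ≃ₗᵢ[ℂ] Joint F q c :=
  jointIso
    (LinearEquiv.piCongrRight fun m : Mem q c =>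
      if m.1 i = true then A.toLinearEquiv else LinearEquiv.refl ℂ F)
    (fun f a hf => by
      convert hf using 3 with m
      by_cases hm : m.1 i = true <;> simp [hm])
    (fun f a hf => by
      convert hf using 3 with m
      by_cases hm : m.1 i = true <;> simp [hm])

/-- Set qubit `i` of a basis state to `b`. -/
def setQubit (i : Fin (q + 1)) (b : Bool) (m : Mem q c) : Mem q c :=
  (Function.update m.1 i b, m.2)

/-- Set counter `j` of a basis state to `z`. -/
def setCounter (j : Fin c) (z : ℤ) (m : Mem q c) : Mem q c :=
  (m.1, Function.update m.2 j z)

/-- The matrix `U` applied to qubit `i`: `|b⟩ ↦ ∑ b', U b' b |b'⟩`. -/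
def qubitMap (i : Fin (q + 1)) (U : Matrix Bool Bool ℂ) :
    (Mem q c → F) →ₗ[ℂ] (Mem q c → F) where
  toFun f m := ∑ b, U (m.1 i) b • f (setQubit i b m)
  map_add' f g := by
    ext m
    simp only [Pi.add_apply, smul_add, Finset.sum_add_distrib]
  map_smul' a f := by
    ext m
    simp only [Pi.smul_apply, RingHom.id_apply, Finset.smul_sum, smul_comm a]

theorem qubitMap_mul (i : Fin (q + 1)) (U W : Matrix Bool Bool ℂ) (f : Mem q c → F) :
    qubitMap i U (qubitMap i W f) = qubitMap i (U * W) f := by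
  ext m
  simp only [qubitMap, LinearMap.coe_mk, AddHom.coe_mk, setQubit, Function.update_self,
    Function.update_idem, Matrix.mul_apply, Finset.sum_smul, Finset.smul_sum, smul_smul]
  rw [Finset.sum_comm]

theorem qubitMap_one (i : Fin (q + 1)) (f : Mem q c → F) : qubitMap i 1 f = f := by
  ext m
  simp only [qubitMap, LinearMap.coe_mk, AddHom.coe_mk, Matrix.one_apply, ite_smul, one_smul,
    zero_smul, Finset.sum_ite_eq, Finset.mem_univ, if_true, setQubit, Function.update_eq_self]

theorem sum_norm_sq_unitary (U : Matrix.unitaryGroup Bool ℂ) (v : Bool → F) :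
    ∑ b, ‖∑ b', (U : Matrix Bool Bool ℂ) b b' • v b'‖ ^ 2 = ∑ b, ‖v b‖ ^ 2 := by
  have hU : star (U : Matrix Bool Bool ℂ) * (U : Matrix Bool Bool ℂ) = 1 :=
    (Matrix.mem_unitaryGroup_iff').1 U.2
  have e : ∀ b b', ∑ x, (starRingEnd ℂ) ((U : Matrix Bool Bool ℂ) x b) *
      (U : Matrix Bool Bool ℂ) x b' = if b = b' then 1 else 0 := by
    intro b b'
    have := congrFun (congrFun hU b) b'
    simpa [Matrix.mul_apply, Matrix.one_apply] using this
  have key : ∑ b, inner ℂ (∑ b', (U : Matrix Bool Bool ℂ) b b' • v b')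
      (∑ b', (U : Matrix Bool Bool ℂ) b b' • v b') = ∑ b, inner ℂ (v b) (v b) := by
    have e1 := e true true
    have e2 := e true false
    have e3 := e false true
    have e4 := e false false
    simp only [Fintype.sum_bool, inner_add_left, inner_add_right, inner_smul_left,
      inner_smul_right] at e1 e2 e3 e4 ⊢
    simp only [if_true, reduceCtorEq, if_false] at e1 e2 e3 e4
    linear_combination (inner ℂ (v true) (v true)) * e1 + (inner ℂ (v true) (v false)) * e2
      + (inner ℂ (v false) (v true)) * e3 + (inner ℂ (v false) (v false)) * e4
  simp only [inner_self_eq_norm_sq_to_K] at key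
  exact_mod_cast key

/-- The permutation that flips qubit `i` if `P` holds, for a condition `P` that does not
depend on qubit `i`. -/
def flipIf (i : Fin (q + 1)) (P : Mem q c → Bool) (hP : ∀ b m, P (setQubit i b m) = P m) :
    Equiv.Perm (Mem q c) :=
  Function.Involutive.toPerm (fun m => setQubit i (xor (m.1 i) (P m)) m) (by
    intro m
    simp only [hP]
    simp [setQubit])

theorem qubitMap_hasSum (i : Fin (q + 1)) (U : Matrix.unitaryGroup Bool ℂ) (f : Mem q c → F)
    (a : ℝ) (hf : HasSum (fun m => ‖f m‖ ^ 2) a) :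
    HasSum (fun m => ‖qubitMap i (U : Matrix Bool Bool ℂ) f m‖ ^ 2) a := by
  set π : Equiv.Perm (Mem q c) := flipIf i (fun _ => true) (fun _ _ => rfl)
  set g := fun m => ‖qubitMap i (U : Matrix Bool Bool ℂ) f m‖ ^ 2
  have pair : ∀ m, g m + g (π m) = ‖f m‖ ^ 2 + ‖f (π m)‖ ^ 2 := by
    intro m
    have h := sum_norm_sq_unitary U (fun b => f (setQubit i b m))
    have hs : setQubit i (m.1 i) m = m := by simp [setQubit]
    have hπ : π m = setQubit i (!(m.1 i)) m := by simp [π, flipIf]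
    have hg : ∀ b, g (setQubit i b m) =
        ‖∑ b', (U : Matrix Bool Bool ℂ) b b' • f (setQubit i b' m)‖ ^ 2 := by
      intro b
      simp [g, qubitMap, setQubit]
    have h : g (setQubit i true m) + g (setQubit i false m) =
        ‖f (setQubit i true m)‖ ^ 2 + ‖f (setQubit i false m)‖ ^ 2 := by
      rw [hg, hg]
      simpa only [Fintype.sum_bool] using h
    rw [hπ]
    rcases hb : m.1 i with _ | _
    · rw [hb] at hs
      rw [hs] at h
      simp only [Bool.not_false]
      linarith
    · rw [hb] at hs
      rw [hs] at h
      simp only [Bool.not_true]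
      linarith
  have hsum : HasSum (fun m => g m + g (π m)) (a + a) := by
    simp only [pair]
    exact hf.add ((π.hasSum_iff (f := fun m => ‖f m‖ ^ 2)).2 hf)
  have hg : Summable g := Summable.of_nonneg_of_le (fun m => by positivity)
    (fun m => le_add_of_nonneg_right (by positivity)) hsum.summable
  obtain ⟨b, hb⟩ := hg
  have h2 := (hb.add ((π.hasSum_iff (f := g)).2 hb)).unique hsum
  have : b = a := by linarith
  exact this ▸ hb

/-- The unitary `U` on qubit `i`. -/
def qubitGate (i : Fin (q + 1)) (U : Matrix.unitaryGroup Bool ℂ) :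
    Joint F q c ≃ₗᵢ[ℂ] Joint F q c :=
  jointIso
    (LinearEquiv.ofLinearMap (qubitMap i (U : Matrix Bool Bool ℂ))
      (qubitMap i ((U⁻¹ : Matrix.unitaryGroup Bool ℂ) : Matrix Bool Bool ℂ))
      (by
        apply LinearMap.ext
        intro f
        rw [LinearMap.comp_apply, qubitMap_mul, ← Submonoid.coe_mul, mul_inv_cancel]
        exact qubitMap_one i f)
      (by
        apply LinearMap.ext
        intro f
        rw [LinearMap.comp_apply, qubitMap_mul, ← Submonoid.coe_mul, inv_mul_cancel]
        exact qubitMap_one i f))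
    (fun f a hf => qubitMap_hasSum i U f a hf)
    (fun f a hf => qubitMap_hasSum i U⁻¹ f a hf)

/-- The permutation that adds `z` to counter `j` if qubit `i` is set. -/
def addPerm (i : Fin (q + 1)) (j : Fin c) (z : ℤ) : Equiv.Perm (Mem q c) where
  toFun m := if m.1 i = true then setCounter j (m.2 j + z) m else m
  invFun m := if m.1 i = true then setCounter j (m.2 j - z) m else m
  left_inv m := by by_cases h : m.1 i = true <;> simp [h, setCounter]
  right_inv m := by by_cases h : m.1 i = true <;> simp [h, setCounter]

/-- The unitary that a gate performs on the edge register and the memory, given the swap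
operator, the source reflection and the walk operator of the edge register. -/
def Gate.eval (swapU reflU walkU : F ≃ₗᵢ[ℂ] F) : Gate q c → (Joint F q c ≃ₗᵢ[ℂ] Joint F q c)
  | .qubit i U => qubitGate i U
  | .toffoli i j k hi hj => permGate <| flipIf k (fun m => m.1 i && m.1 j) (by
      intro b m
      simp [setQubit, Function.update_of_ne hi, Function.update_of_ne hj])
  | .inc i j => permGate (addPerm i j 1)
  | .dec i j => permGate (addPerm i j (-1))
  | .zeroTest i j => permGate <| flipIf i (fun m => decide (m.2 j = 0)) (fun _ _ => rfl)
  | .swap i => ctrlGate i swapU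
  | .refl i => ctrlGate i reflU
  | .walk i => ctrlGate i walkU

/-- The unitary that a circuit performs; the first gate of the list acts first. -/
def circuitEval (swapU reflU walkU : F ≃ₗᵢ[ℂ] F) :
    List (Gate q c) → (Joint F q c ≃ₗᵢ[ℂ] Joint F q c)
  | [] => LinearIsometryEquiv.refl ℂ _
  | g :: gs => (g.eval swapU reflU walkU).trans (circuitEval swapU reflU walkU gs)

/-- The product state `φ ⊗ Γ` of the edge register and the memory. -/
def tensor (φ : F) (Γ : lp (fun _ : Mem q c => ℂ) 2) : Joint F q c :=
  ⟨fun m => Γ m • φ, by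
    have h := (Joint.hasSum_norm_sq Γ).summable.mul_right (‖φ‖ ^ 2)
    refine (memJoint_iff _).2 ?_
    simpa only [norm_smul, mul_pow] using h⟩

/-- The basis state of the memory in which all qubits and counters are zero. -/
def memZero (q c : ℕ) : lp (fun _ : Mem q c => ℂ) 2 :=
  lp.single 2 ((fun _ => false, fun _ => 0) : Mem q c) (1 : ℂ)

/-- The public space: qubit `0` is in the state `|0⟩` (and in `|1⟩` on the private space). -/
def publicSpace (F : Type*) [NormedAddCommGroup F] [InnerProductSpace ℂ F] (q c : ℕ) :
    Submodule ℂ (Joint F q c) where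
  carrier := {ψ | ∀ m : Mem q c, m.1 0 = true → ψ m = 0}
  zero_mem' := fun _ _ => rfl
  add_mem' := by
    intro a b ha hb m hm
    rw [lp.coeFn_add, Pi.add_apply, ha m hm, hb m hm, add_zero]
  smul_mem' := by
    intro z a ha m hm
    rw [lp.coeFn_smul, Pi.smul_apply, ha m hm, smul_zero]

end Semantics

end

/-! Put e = |σs⟩ (the source star state of the modified graph), z = SWAP e, φ = φ_s, B the bound on
the escape time, and f the flow state. Two damped rotations of planes carry the input to f.

Phase one leads from φ to e. The star of s in the modified graph is √η z + φ up to norm, so on the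
plane of z and φ the operator U SWAP, the reflection about the star space, is a reflection with sine
2√η/(η+1) (`walkOp_source`). With sign changes in between it is a rotation. A coin qubit, rotated
before and after a controlled reflection about e, damps the e-component by 1/(1+ε) in every step;
what it removes enters phase two.

Phase two leads from e to f. The potential gives e = α f + β (a + b), with a invariant under SWAP
and b in the star space (`exists_decomposition`). The reflection about e, followed by f ↦ -f, a + b
↦ a + b, rotates the plane of f and a + b with sine 2αβ. This second map needs only one controlled
walk: the half sum and half difference of SWAP and U SWAP fix the pair (a + b, a - b) and negate (f,
0), so a - b serves as an inner catalyst. The coin now damps the f-component, and what it removes is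
the output.

For a rotation whose sine is at least σε, damped by 1/(1+ε) in one direction, all the norm leaves,
and the squared norms over all times sum to O(1/(σ²ε)) (`damped_rotation_hasSum`).

All times are treated in one pass. At counter values (j + k, k) the catalyst holds the state after j
steps of phase one and k of phase two; a pass moves every running slice to its successor, the input
fills the empty slice (0, 0), and whatever leaves is f times garbage with amplitudes γ_j μ_(k-1).
Nothing is truncated, so the transduction is exact and the gate count is a constant. Qubit 0 is the
private flag, qubit 1 marks phase one, qubit 2 the inner catalyst, qubit 3 is the coin; qubits 4 and
5 are scratch.

With ε = 1/√(1+B) and σ = 1/√κ both sines are large enough, since 1/κ ≤ η ≤ κB and η R_s d_s ≤ κB.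
The squared norms of a and b are O(κ) because ∑ d_x v_x² ≤ R_s B for the potential v
(`exists_isPotential_sum_le`). This is where the escape time enters: v is R_s times the probability
to hit s before M, and reversibility turns the sum into an expected last exit time. -/

noncomputable section

/-! ## Circuits acting on families of vectors -/

section Kets

variable {F : Type*} [NormedAddCommGroup F] [InnerProductSpace ℂ F] {q c : ℕ}

/-- The linear map on arbitrary families of vectors that underlies a gate. -/
def Gate.toFn (swapU reflU walkU : F ≃ₗᵢ[ℂ] F) :
    Gate q c → ((Mem q c → F) →ₗ[ℂ] (Mem q c → F))
  | .qubit i U => qubitMap i (U : Matrix Bool Bool ℂ)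
  | .toffoli i j k hi hj => LinearMap.funLeft ℂ F (flipIf k (fun m => m.1 i && m.1 j) (by
      intro b m
      simp [setQubit, Function.update_of_ne hi, Function.update_of_ne hj]))
  | .inc i j => LinearMap.funLeft ℂ F (addPerm i j 1).symm
  | .dec i j => LinearMap.funLeft ℂ F (addPerm i j (-1)).symm
  | .zeroTest i j =>
      LinearMap.funLeft ℂ F (flipIf i (fun m => decide (m.2 j = 0)) (fun _ _ => rfl))
  | .swap i => LinearMap.pi fun m =>
      (if m.1 i = true then swapU.toLinearEquiv.toLinearMap else LinearMap.id) ∘ₗ LinearMap.proj m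
  | .refl i => LinearMap.pi fun m =>
      (if m.1 i = true then reflU.toLinearEquiv.toLinearMap else LinearMap.id) ∘ₗ LinearMap.proj m
  | .walk i => LinearMap.pi fun m =>
      (if m.1 i = true then walkU.toLinearEquiv.toLinearMap else LinearMap.id) ∘ₗ LinearMap.proj m

/-- The linear map on arbitrary families of vectors that underlies a circuit. -/
def circuitFn (swapU reflU walkU : F ≃ₗᵢ[ℂ] F) :
    List (Gate q c) → ((Mem q c → F) →ₗ[ℂ] (Mem q c → F))
  | [] => LinearMap.id
  | g :: gs => circuitFn swapU reflU walkU gs ∘ₗ g.toFn swapU reflU walkU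

/-- Circuits are computed on arbitrary families of vectors, so that no summability proof has to
follow the gates; square-summability returns only for the final catalyst. -/
theorem Gate.coe_eval (swapU reflU walkU : F ≃ₗᵢ[ℂ] F) (g : Gate q c) (ψ : Joint F q c) :
    (g.eval swapU reflU walkU ψ : Mem q c → F) = g.toFn swapU reflU walkU ψ := by
  cases g with
  | qubit i U => rfl
  | toffoli i j k hi hj => rfl
  | inc i j => rfl
  | dec i j => rfl
  | zeroTest i j => rfl
  | swap i => ext m; by_cases h : m.1 i = true <;> simp [Gate.eval, Gate.toFn, ctrlGate, jointIso, h]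
  | refl i => ext m; by_cases h : m.1 i = true <;> simp [Gate.eval, Gate.toFn, ctrlGate, jointIso, h]
  | walk i => ext m; by_cases h : m.1 i = true <;> simp [Gate.eval, Gate.toFn, ctrlGate, jointIso, h]

theorem coe_circuitEval (swapU reflU walkU : F ≃ₗᵢ[ℂ] F) (l : List (Gate q c))
    (ψ : Joint F q c) :
    (circuitEval swapU reflU walkU l ψ : Mem q c → F) = circuitFn swapU reflU walkU l ψ := by
  induction l generalizing ψ with
  | nil => rfl
  | cons g l ih =>
    simp only [circuitEval, circuitFn, LinearIsometryEquiv.trans_apply, LinearMap.comp_apply, ih,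
      Gate.coe_eval]

theorem circuitFn_append (swapU reflU walkU : F ≃ₗᵢ[ℂ] F) (l l' : List (Gate q c))
    (ψ : Mem q c → F) :
    circuitFn swapU reflU walkU (l ++ l') ψ =
      circuitFn swapU reflU walkU l' (circuitFn swapU reflU walkU l ψ) := by
  induction l generalizing ψ with
  | nil => rfl
  | cons g l ih => simp only [List.cons_append, circuitFn, LinearMap.comp_apply, ih]

/-- The family `|b⟩ ⊗ φ` for a basis state `b` of the qubits and a family `φ` indexed by the
counters. -/
def ket (b : Fin (q + 1) → Bool) : ((Fin c → ℤ) → F) →ₗ[ℂ] (Mem q c → F) where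
  toFun φ m := if m.1 = b then φ m.2 else 0
  map_add' φ χ := by ext m; by_cases h : m.1 = b <;> simp [h]
  map_smul' a φ := by ext m; by_cases h : m.1 = b <;> simp [h]

theorem ket_apply (b : Fin (q + 1) → Bool) (φ : (Fin c → ℤ) → F) (m : Mem q c) :
    ket b φ m = if m.1 = b then φ m.2 else 0 := rfl

/-- Shift a family along counter `j`. -/
def shift (j : Fin c) (z : ℤ) : ((Fin c → ℤ) → F) →ₗ[ℂ] ((Fin c → ℤ) → F) :=
  LinearMap.funLeft ℂ F fun n => Function.update n j (n j - z)

/-- Apply an operator to every member of a family. -/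
def pointwise (A : F ≃ₗᵢ[ℂ] F) : ((Fin c → ℤ) → F) →ₗ[ℂ] ((Fin c → ℤ) → F) :=
  A.toLinearEquiv.toLinearMap.compLeft _

theorem update_eq_iff_of_flip (b b' : Fin (q + 1) → Bool) (i : Fin (q + 1)) (x : Bool) :
    Function.update b i x = b' ↔ x = b' i ∧ b = Function.update b' i (b i) := by
  constructor
  · rintro rfl
    simp
  · rintro ⟨rfl, h⟩
    rw [h]
    simp

theorem toFn_qubit_ket (swapU reflU walkU : F ≃ₗᵢ[ℂ] F) (i : Fin (q + 1))
    (U : Matrix.unitaryGroup Bool ℂ) (b : Fin (q + 1) → Bool) (φ : (Fin c → ℤ) → F) :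
    (Gate.qubit i U : Gate q c).toFn swapU reflU walkU (ket b φ) =
      (U : Matrix Bool Bool ℂ) false (b i) • ket (Function.update b i false) φ +
      (U : Matrix Bool Bool ℂ) true (b i) • ket (Function.update b i true) φ := by
  ext ⟨a, n⟩
  simp only [Gate.toFn, qubitMap, setQubit, LinearMap.coe_mk, AddHom.coe_mk, ket_apply,
    Fintype.sum_bool, Pi.add_apply, Pi.smul_apply, update_eq_iff_of_flip, smul_ite, smul_zero]
  have hx : ∀ x : Bool, (a = Function.update b i x) ↔ (a i = x ∧ a = Function.update b i (a i)) := by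
    intro x
    constructor
    · intro h; have : a i = x := by rw [h]; simp
      exact ⟨this, this ▸ h⟩
    · rintro ⟨rfl, h⟩; exact h
  simp only [hx false, hx true]
  by_cases h : a = Function.update b i (a i)
  · cases h1 : a i <;> cases h2 : b i <;> rw [h1] at h <;> simp [← h]
  · simp [h]

theorem flipIf_ket (i : Fin (q + 1)) (P : Mem q c → Bool)
    (hP : ∀ b m, P (setQubit i b m) = P m) (b : Fin (q + 1) → Bool) (φ : (Fin c → ℤ) → F) :
    LinearMap.funLeft ℂ F (flipIf i P hP) (ket b φ) = fun m =>
      if P m = true then ket (Function.update b i (!(b i))) φ m else ket b φ m := by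
  ext ⟨a, n⟩
  simp only [LinearMap.funLeft_apply, flipIf, Function.Involutive.coe_toPerm, ket_apply, setQubit]
  by_cases h : P (a, n) = true
  · simp only [h, Bool.xor_true, update_eq_iff_of_flip, if_true]
    congr 1
    apply propext
    constructor
    · rintro ⟨h1, h2⟩; rw [← h1]; simpa using h2
    · rintro rfl; simp
  · simp [h]

theorem toFn_toffoli_ket (swapU reflU walkU : F ≃ₗᵢ[ℂ] F) (i j k : Fin (q + 1)) (hi : i ≠ k)
    (hj : j ≠ k) (b : Fin (q + 1) → Bool) (φ : (Fin c → ℤ) → F) :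
    (Gate.toffoli i j k hi hj : Gate q c).toFn swapU reflU walkU (ket b φ) =
      ket (Function.update b k (xor (b k) (b i && b j))) φ := by
  simp only [Gate.toFn]
  rw [flipIf_ket]
  ext ⟨a, n⟩
  simp only [ket_apply]
  by_cases h : a = Function.update b k (!(b k))
  · subst h
    cases h1 : b i <;> cases h2 : b j <;> simp [Function.update_of_ne hi, Function.update_of_ne hj, h1, h2]
  · by_cases h' : a = b
    · subst h'
      cases h1 : (a i && a j) <;> simp [h]
    · cases h1 : b i <;> cases h2 : b j <;> simp [h, h']

/-- In general a zero test entangles the qubit with the counter. The circuit applies it only to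
families supported on the value zero, where it is a plain flip, or off zero, where it is the
identity. -/
theorem toFn_zeroTest_ket (swapU reflU walkU : F ≃ₗᵢ[ℂ] F) (i : Fin (q + 1)) (j : Fin c)
    (b : Fin (q + 1) → Bool) (φ : (Fin c → ℤ) → F) (hφ : ∀ n, n j ≠ 0 → φ n = 0) :
    (Gate.zeroTest i j : Gate q c).toFn swapU reflU walkU (ket b φ) =
      ket (Function.update b i (!(b i))) φ := by
  refine (flipIf_ket i (fun m : Mem q c => decide (m.2 j = 0)) (fun _ _ => rfl) b φ).trans ?_
  ext ⟨a, n⟩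
  by_cases h : n j = 0 <;> simp [ket_apply, h, hφ n]

theorem toFn_zeroTest_ket_of_ne (swapU reflU walkU : F ≃ₗᵢ[ℂ] F) (i : Fin (q + 1)) (j : Fin c)
    (b : Fin (q + 1) → Bool) (φ : (Fin c → ℤ) → F) (hφ : ∀ n, n j = 0 → φ n = 0) :
    (Gate.zeroTest i j : Gate q c).toFn swapU reflU walkU (ket b φ) = ket b φ := by
  refine (flipIf_ket i (fun m : Mem q c => decide (m.2 j = 0)) (fun _ _ => rfl) b φ).trans ?_
  ext ⟨a, n⟩
  by_cases h : n j = 0 <;> simp [ket_apply, h, hφ n]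

theorem addPerm_ket (i : Fin (q + 1)) (j : Fin c) (z : ℤ) (b : Fin (q + 1) → Bool)
    (φ : (Fin c → ℤ) → F) :
    LinearMap.funLeft ℂ F (addPerm i j z).symm (ket b φ) =
      ket b (if b i = true then shift j z φ else φ) := by
  ext ⟨a, n⟩
  change ket b φ (if a i = true then setCounter j (n j - z) (a, n) else (a, n)) = _
  by_cases h : a = b
  · subst h
    by_cases h' : a i = true <;> simp [ket_apply, h', setCounter, shift]
  · by_cases h' : a i = true <;> simp [ket_apply, h', setCounter, h]

theorem toFn_inc_ket (swapU reflU walkU : F ≃ₗᵢ[ℂ] F) (i : Fin (q + 1)) (j : Fin c)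
    (b : Fin (q + 1) → Bool) (φ : (Fin c → ℤ) → F) :
    (Gate.inc i j : Gate q c).toFn swapU reflU walkU (ket b φ) =
      ket b (if b i = true then shift j 1 φ else φ) := addPerm_ket i j 1 b φ

theorem toFn_dec_ket (swapU reflU walkU : F ≃ₗᵢ[ℂ] F) (i : Fin (q + 1)) (j : Fin c)
    (b : Fin (q + 1) → Bool) (φ : (Fin c → ℤ) → F) :
    (Gate.dec i j : Gate q c).toFn swapU reflU walkU (ket b φ) =
      ket b (if b i = true then shift j (-1) φ else φ) := addPerm_ket i j (-1) b φ

theorem ctrl_ket (i : Fin (q + 1)) (A : F ≃ₗᵢ[ℂ] F) (b : Fin (q + 1) → Bool)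
    (φ : (Fin c → ℤ) → F) :
    (LinearMap.pi fun m : Mem q c => (if m.1 i = true then A.toLinearEquiv.toLinearMap else
      LinearMap.id) ∘ₗ LinearMap.proj m) (ket b φ) =
      ket b (if b i = true then pointwise A φ else φ) := by
  ext ⟨a, n⟩
  by_cases h : a = b
  · subst h
    by_cases h' : a i = true <;> simp [ket_apply, h', pointwise]
  · by_cases h' : a i = true <;> simp [ket_apply, h', h]

theorem toFn_swap_ket (swapU reflU walkU : F ≃ₗᵢ[ℂ] F) (i : Fin (q + 1))
    (b : Fin (q + 1) → Bool) (φ : (Fin c → ℤ) → F) :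
    (Gate.swap i : Gate q c).toFn swapU reflU walkU (ket b φ) =
      ket b (if b i = true then pointwise swapU φ else φ) := ctrl_ket i swapU b φ

theorem toFn_refl_ket (swapU reflU walkU : F ≃ₗᵢ[ℂ] F) (i : Fin (q + 1))
    (b : Fin (q + 1) → Bool) (φ : (Fin c → ℤ) → F) :
    (Gate.refl i : Gate q c).toFn swapU reflU walkU (ket b φ) =
      ket b (if b i = true then pointwise reflU φ else φ) := ctrl_ket i reflU b φ

theorem toFn_walk_ket (swapU reflU walkU : F ≃ₗᵢ[ℂ] F) (i : Fin (q + 1))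
    (b : Fin (q + 1) → Bool) (φ : (Fin c → ℤ) → F) :
    (Gate.walk i : Gate q c).toFn swapU reflU walkU (ket b φ) =
      ket b (if b i = true then pointwise walkU φ else φ) := ctrl_ket i walkU b φ

end Kets

/-! ## Single-qubit unitaries -/

/-- The bit flip. -/
def flipU : Matrix.unitaryGroup Bool ℂ :=
  ⟨Matrix.of fun a b => if a = b then 0 else 1, by
    rw [Matrix.mem_unitaryGroup_iff]
    ext a b
    cases a <;> cases b <;> simp [Matrix.mul_apply, Matrix.star_apply]⟩

/-- The phase flip. -/
def phaseU : Matrix.unitaryGroup Bool ℂ :=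
  ⟨Matrix.of fun a b => if a = b then (if a then -1 else 1) else 0, by
    rw [Matrix.mem_unitaryGroup_iff]
    ext a b
    cases a <;> cases b <;> simp [Matrix.mul_apply, Matrix.star_apply]⟩

/-- The rotation `|0⟩ ↦ x |0⟩ + y |1⟩`, `|1⟩ ↦ -y |0⟩ + x |1⟩`. -/
def rotU (x y : ℝ) (h : x ^ 2 + y ^ 2 = 1) : Matrix.unitaryGroup Bool ℂ :=
  ⟨Matrix.of fun a b => if a = b then (x : ℂ) else if a then (y : ℂ) else -(y : ℂ), by
    have hsq : (x : ℂ) ^ 2 + (y : ℂ) ^ 2 = 1 := by exact_mod_cast h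
    rw [Matrix.mem_unitaryGroup_iff]
    ext a b
    cases a <;> cases b <;> simp [Matrix.mul_apply, Matrix.star_apply] <;>
      first | linear_combination hsq | ring⟩

/-- The Hadamard gate. -/
def hadamardU : Matrix.unitaryGroup Bool ℂ :=
  ⟨Matrix.of fun a b => if a && b then -(((Real.sqrt 2)⁻¹ : ℝ) : ℂ) else (((Real.sqrt 2)⁻¹ : ℝ) : ℂ), by
    have hsq : ((((Real.sqrt 2)⁻¹ : ℝ) : ℂ)) * (((Real.sqrt 2)⁻¹ : ℝ) : ℂ) = 1 / 2 := by
      rw [← Complex.ofReal_mul, ← mul_inv, Real.mul_self_sqrt (by norm_num)]; norm_num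
    rw [Matrix.mem_unitaryGroup_iff]
    ext a b
    cases a <;> cases b <;> simp [Matrix.mul_apply, Matrix.star_apply] at hsq ⊢ <;>
      linear_combination 2 * hsq⟩

/-! ## The circuit -/

section Circuit

/-- Shorthand for patterns of six qubits. -/
def pat (b₀ b₁ b₂ b₃ b₄ b₅ : Bool) : Fin (5 + 1) → Bool := ![b₀, b₁, b₂, b₃, b₄, b₅]

variable (b₀ b₁ b₂ b₃ b₄ b₅ x : Bool)

@[simp] theorem update_pat_zero : Function.update (pat b₀ b₁ b₂ b₃ b₄ b₅) 0 x = pat x b₁ b₂ b₃ b₄ b₅ := by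
  ext i; fin_cases i <;> rfl

@[simp] theorem update_pat_one : Function.update (pat b₀ b₁ b₂ b₃ b₄ b₅) 1 x = pat b₀ x b₂ b₃ b₄ b₅ := by
  ext i; fin_cases i <;> rfl

@[simp] theorem update_pat_two : Function.update (pat b₀ b₁ b₂ b₃ b₄ b₅) 2 x = pat b₀ b₁ x b₃ b₄ b₅ := by
  ext i; fin_cases i <;> rfl

@[simp] theorem update_pat_three :
    Function.update (pat b₀ b₁ b₂ b₃ b₄ b₅) 3 x = pat b₀ b₁ b₂ x b₄ b₅ := by
  ext i; fin_cases i <;> rfl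

@[simp] theorem update_pat_four :
    Function.update (pat b₀ b₁ b₂ b₃ b₄ b₅) 4 x = pat b₀ b₁ b₂ b₃ x b₅ := by
  ext i; fin_cases i <;> rfl

@[simp] theorem update_pat_five :
    Function.update (pat b₀ b₁ b₂ b₃ b₄ b₅) 5 x = pat b₀ b₁ b₂ b₃ b₄ x := by
  ext i; fin_cases i <;> rfl

@[simp] theorem pat_zero : pat b₀ b₁ b₂ b₃ b₄ b₅ 0 = b₀ := rfl
@[simp] theorem pat_one : pat b₀ b₁ b₂ b₃ b₄ b₅ 1 = b₁ := rfl
@[simp] theorem pat_two : pat b₀ b₁ b₂ b₃ b₄ b₅ 2 = b₂ := rfl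
@[simp] theorem pat_three : pat b₀ b₁ b₂ b₃ b₄ b₅ 3 = b₃ := rfl
@[simp] theorem pat_four : pat b₀ b₁ b₂ b₃ b₄ b₅ 4 = b₄ := rfl
@[simp] theorem pat_five : pat b₀ b₁ b₂ b₃ b₄ b₅ 5 = b₅ := rfl

/-- A Toffoli gate on distinct targets, with the side conditions decided. -/
abbrev tof (i j k : Fin 6) (hi : i ≠ k := by decide) (hj : j ≠ k := by decide) : Gate 5 2 :=
  .toffoli i j k hi hj

/-- Flip a qubit. -/
abbrev bitFlip (i : Fin 6) : Gate 5 2 := .qubit i flipU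

/-- Hadamard gate on a qubit. -/
abbrev had (i : Fin 6) : Gate 5 2 := .qubit i hadamardU

/-- Separate the source star state of a public input from the rest. -/
def entryGates : List (Gate 5 2) :=
  -- Hadamards around a controlled reflection measure it coherently: the component along e goes to
  -- phase two, the orthogonal one to phase one. On private states the Hadamards cancel.
  [bitFlip 0, had 1, tof 0 1 4, .refl 4, tof 0 1 4, had 1]

/-- Advance the time counters, and reflect about the source star state. -/
def advanceGates : List (Gate 5 2) :=
  -- Qubit 2 is negated so that the inner catalyst is neither aged nor reflected. In phase one the
  -- decrement undoes the increment of counter 1, which therefore counts phase two only.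
  [bitFlip 2, .inc 2 0, .inc 2 1, .dec 1 1, .refl 2, bitFlip 2]

/-- The controlled use of the walk operator. -/
def walkGates : List (Gate 5 2) :=
  -- Qubit 4 says "phase two with coin set"; qubit 5 selects all of phase one, and of phase two the
  -- part of qubit 4 in which qubit 2 is set. Thus both phases share a single call.
  [had 2, bitFlip 1, tof 1 3 4, bitFlip 1, .swap 1, .swap 4, tof 4 2 5, tof 1 1 5, .walk 5,
    tof 1 1 5, tof 4 2 5, bitFlip 1, tof 1 3 4, bitFlip 1, had 2]

/-- The reflection that damps the first phase. -/
def dampGates : List (Gate 5 2) :=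
  -- With the coin set, phase one receives minus the reflection about e. Between the two coin
  -- rotations the coin stays clear with amplitude x² - y² along e and 1 on the complement.
  [.swap 1, tof 1 3 4, .qubit 4 phaseU, .refl 4, tof 1 3 4]

/-- Route the damped amplitudes. -/
def routeGates : List (Gate 5 2) :=
  -- A set coin ends the phase: phase one passes to phase two, phase two to the output; both are
  -- marked by qubit 4.
  [bitFlip 2, tof 2 3 4, bitFlip 2, tof 4 4 3, tof 4 4 1, tof 1 4 0]

/-- Restore the flag of private states. -/
def exitGates : List (Gate 5 2) :=
  [tof 1 1 4, bitFlip 0, .swap 1]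

/-- The whole circuit, for a rotation with cosine `x` and sine `y`. -/
def elfCircuit (x y : ℝ) (h : x ^ 2 + y ^ 2 = 1) (h' : x ^ 2 + (-y) ^ 2 = 1) : List (Gate 5 2) :=
  -- The first zero test recognises the fresh input, the only part at total time zero. The second
  -- recognises what comes from phase one, so that its leak and the running phase two can merge
  -- reversibly.
  entryGates ++ ([.zeroTest 0 0] ++ (advanceGates ++ ([.qubit 3 (rotU x y h)] ++ (walkGates ++
    (dampGates ++ ([.qubit 3 (rotU x (-y) h')] ++ (routeGates ++ ([.zeroTest 4 1] ++
      exitGates))))))))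

theorem countP_walk_elfCircuit (x y : ℝ) (h h') :
    (elfCircuit x y h h').countP (fun g => g.isWalk) = 1 := by
  rfl

theorem countP_not_walk_elfCircuit (x y : ℝ) (h h') :
    (elfCircuit x y h h').countP (fun g => !g.isWalk) = 44 := by
  rfl

variable {F : Type*} [NormedAddCommGroup F] [InnerProductSpace ℂ F] (Sw Re Wk : F ≃ₗᵢ[ℂ] F)
  (φ : (Fin 2 → ℤ) → F)

@[simp] theorem circuitFn_cons (g : Gate 5 2) (l : List (Gate 5 2)) (ψ : Mem 5 2 → F) :
    circuitFn Sw Re Wk (g :: l) ψ = circuitFn Sw Re Wk l (g.toFn Sw Re Wk ψ) := rfl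

@[simp] theorem circuitFn_nil (ψ : Mem 5 2 → F) :
    circuitFn Sw Re Wk ([] : List (Gate 5 2)) ψ = ψ := rfl

@[simp] theorem bitFlip_ket (i : Fin 6) (b : Fin 6 → Bool) :
    (bitFlip i).toFn Sw Re Wk (ket b φ) = ket (q := 5) (Function.update b i (!(b i))) φ := by
  rw [toFn_qubit_ket]
  cases h : b i <;> simp [flipU]

@[simp] theorem phase_ket (i : Fin 6) (b : Fin 6 → Bool) :
    (Gate.qubit i phaseU : Gate 5 2).toFn Sw Re Wk (ket b φ) =
      ket (q := 5) b (if b i = true then -φ else φ) := by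
  rw [toFn_qubit_ket]
  cases h : b i
  · have : Function.update b i false = b := by rw [← h]; simp
    simp [phaseU, this]
  · have : Function.update b i true = b := by rw [← h]; simp
    simp [phaseU, this]

/-- The amplitude of the Hadamard gate. -/
def invSqrtTwo : ℂ := (((Real.sqrt 2)⁻¹ : ℝ) : ℂ)

theorem invSqrtTwo_mul_self : invSqrtTwo * invSqrtTwo = 1 / 2 := by
  rw [invSqrtTwo, ← Complex.ofReal_mul, ← mul_inv, Real.mul_self_sqrt (by norm_num)]; norm_num

@[simp] theorem had_ket (i : Fin 6) (b : Fin 6 → Bool) :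
    (had i).toFn Sw Re Wk (ket b φ) = ket (q := 5) (Function.update b i false) (invSqrtTwo • φ) +
      ket (q := 5) (Function.update b i true) (if b i = true then -(invSqrtTwo • φ) else invSqrtTwo • φ) := by
  rw [toFn_qubit_ket]
  cases h : b i <;> simp [hadamardU, invSqrtTwo]

@[simp] theorem rot_ket (i : Fin 6) (b : Fin 6 → Bool) (x y : ℝ) (h : x ^ 2 + y ^ 2 = 1) :
    (Gate.qubit i (rotU x y h) : Gate 5 2).toFn Sw Re Wk (ket b φ) =
      ket (q := 5) (Function.update b i false) (if b i = true then -((y : ℂ) • φ) else (x : ℂ) • φ) +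
      ket (q := 5) (Function.update b i true) (if b i = true then (x : ℂ) • φ else (y : ℂ) • φ) := by
  rw [toFn_qubit_ket]
  cases h : b i <;> simp [rotU]

attribute [simp] toFn_toffoli_ket toFn_swap_ket toFn_refl_ket toFn_walk_ket toFn_inc_ket
  toFn_dec_ket invSqrtTwo_mul_self

theorem entryGates_input :
    circuitFn Sw Re Wk entryGates (ket (pat false false false false false false) φ) =
      ket (pat true false false false false false) ((1 / 2 : ℂ) • (φ + pointwise Re φ)) +
      ket (pat true true false false false false) ((1 / 2 : ℂ) • (φ - pointwise Re φ)) := by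
  simp [entryGates, smul_smul]
  module

theorem entryGates_private : circuitFn Sw Re Wk entryGates (ket (pat true b₁ b₂ b₃ false false) φ) =
    ket (pat false b₁ b₂ b₃ false false) φ := by
  cases b₁ <;> simp [entryGates, smul_smul] <;> module

theorem advanceGates_first :
    circuitFn Sw Re Wk advanceGates (ket (pat false true false false false false) φ) =
      ket (pat false true false false false false)
        (pointwise Re (shift 1 (-1) (shift 1 1 (shift 0 1 φ)))) := by
  simp [advanceGates]

theorem advanceGates_second :
    circuitFn Sw Re Wk advanceGates (ket (pat false false false false false false) φ) =
      ket (pat false false false false false false)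
        (pointwise Re (shift 1 1 (shift 0 1 φ))) := by
  simp [advanceGates]

theorem advanceGates_catalyst :
    circuitFn Sw Re Wk advanceGates (ket (pat false false true b₃ false false) φ) =
      ket (pat false false true b₃ false false) φ := by
  simp [advanceGates]

theorem walkGates_first :
    circuitFn Sw Re Wk walkGates (ket (pat false true false b₃ false false) φ) =
      ket (pat false true false b₃ false false) (pointwise Wk (pointwise Sw φ)) := by
  cases b₃ <;> simp [walkGates, smul_smul] <;> module

theorem walkGates_second_false :
    circuitFn Sw Re Wk walkGates (ket (pat false false false false false false) φ) =
      ket (pat false false false false false false) φ := by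
  simp [walkGates, smul_smul]
  module

/-- The Hadamards conjugate the block-diagonal operator with blocks SWAP and walk ∘ SWAP. Together
with the catalyst branch this is the transducer for the reflection that negates f and fixes a + b.
-/
theorem walkGates_second_true :
    circuitFn Sw Re Wk walkGates (ket (pat false false false true false false) φ) =
      ket (pat false false false true false false)
        ((1 / 2 : ℂ) • (pointwise Sw φ + pointwise Wk (pointwise Sw φ))) +
      ket (pat false false true true false false)
        ((1 / 2 : ℂ) • (pointwise Sw φ - pointwise Wk (pointwise Sw φ))) := by
  simp [walkGates, smul_smul]
  module

theorem walkGates_catalyst :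
    circuitFn Sw Re Wk walkGates (ket (pat false false true true false false) φ) =
      ket (pat false false false true false false)
        ((1 / 2 : ℂ) • (pointwise Sw φ - pointwise Wk (pointwise Sw φ))) +
      ket (pat false false true true false false)
        ((1 / 2 : ℂ) • (pointwise Sw φ + pointwise Wk (pointwise Sw φ))) := by
  simp [walkGates, smul_smul]
  module

theorem dampGates_first_false :
    circuitFn Sw Re Wk dampGates (ket (pat false true false false false false) φ) =
      ket (pat false true false false false false) (pointwise Sw φ) := by
  simp [dampGates]

theorem dampGates_first_true :
    circuitFn Sw Re Wk dampGates (ket (pat false true false true false false) φ) =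
      ket (pat false true false true false false) (-pointwise Re (pointwise Sw φ)) := by
  simp [dampGates]

theorem dampGates_second :
    circuitFn Sw Re Wk dampGates (ket (pat false false b₂ b₃ false false) φ) =
      ket (pat false false b₂ b₃ false false) φ := by
  simp [dampGates]

theorem routeGates_first_false :
    circuitFn Sw Re Wk routeGates (ket (pat false true false false false false) φ) =
      ket (pat false true false false false false) φ := by
  simp [routeGates]

theorem routeGates_first_true :
    circuitFn Sw Re Wk routeGates (ket (pat false true false true false false) φ) =
      ket (pat false false false false true false) φ := by
  simp [routeGates]

theorem routeGates_second_false :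
    circuitFn Sw Re Wk routeGates (ket (pat false false false false false false) φ) =
      ket (pat false false false false false false) φ := by
  simp [routeGates]

theorem routeGates_second_true :
    circuitFn Sw Re Wk routeGates (ket (pat false false false true false false) φ) =
      ket (pat true true false false true false) φ := by
  simp [routeGates]

theorem routeGates_catalyst :
    circuitFn Sw Re Wk routeGates (ket (pat false false true b₃ false false) φ) =
      ket (pat false false true b₃ false false) φ := by
  simp [routeGates]

theorem exitGates_ket :
    circuitFn Sw Re Wk exitGates (ket (pat b₀ b₁ b₂ b₃ b₄ b₅) φ) =
      ket (pat (!b₀) b₁ b₂ b₃ (xor b₄ b₁) b₅) (if b₁ = true then pointwise Sw φ else φ) := by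
  cases b₁ <;> simp [exitGates]

end Circuit

/-! ### One pass of the circuit, branch by branch -/

section CircuitAction

variable {F : Type*} [NormedAddCommGroup F] [InnerProductSpace ℂ F] (Sw Re Wk : F ≃ₗᵢ[ℂ] F)
  (φ : (Fin 2 → ℤ) → F) (x y : ℝ) (h : x ^ 2 + y ^ 2 = 1) (h' : x ^ 2 + (-y) ^ 2 = 1)

/-- The circuit without the treatment of the public input. -/
def coreGates : List (Gate 5 2) :=
  advanceGates ++ ([.qubit 3 (rotU x y h)] ++ (walkGates ++
    (dampGates ++ ([.qubit 3 (rotU x (-y) h')] ++ (routeGates ++ ([.zeroTest 4 1] ++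
      exitGates))))))

@[simp] theorem shift_neg_shift (j : Fin 2) (φ : (Fin 2 → ℤ) → F) :
    shift j (-1) (shift j 1 φ) = φ := by
  ext n
  simp [shift]

theorem pointwise_apply (A : F ≃ₗᵢ[ℂ] F) (n : Fin 2 → ℤ) : pointwise A φ n = A (φ n) := rfl

theorem shift_apply (j : Fin 2) (z : ℤ) (n : Fin 2 → ℤ) :
    shift j z φ n = φ (Function.update n j (n j - z)) := rfl

/-- Half the sum of the two walk branches. -/
def walkSum : ((Fin 2 → ℤ) → F) →ₗ[ℂ] ((Fin 2 → ℤ) → F) :=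
  (1 / 2 : ℂ) • (pointwise Sw + pointwise Wk ∘ₗ pointwise Sw)

/-- Half the difference of the two walk branches. -/
def walkDiff : ((Fin 2 → ℤ) → F) →ₗ[ℂ] ((Fin 2 → ℤ) → F) :=
  (1 / 2 : ℂ) • (pointwise Sw - pointwise Wk ∘ₗ pointwise Sw)

theorem walkSum_apply (n : Fin 2 → ℤ) :
    walkSum Sw Wk φ n = (1 / 2 : ℂ) • (Sw (φ n) + Wk (Sw (φ n))) := rfl

theorem walkDiff_apply (n : Fin 2 → ℤ) :
    walkDiff Sw Wk φ n = (1 / 2 : ℂ) • (Sw (φ n) - Wk (Sw (φ n))) := rfl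

theorem walkSum_smul_eq : (1 / 2 : ℂ) • (pointwise Sw φ + pointwise Wk (pointwise Sw φ)) =
    walkSum Sw Wk φ := rfl

theorem walkDiff_smul_eq : (1 / 2 : ℂ) • (pointwise Sw φ - pointwise Wk (pointwise Sw φ)) =
    walkDiff Sw Wk φ := rfl

attribute [simp] advanceGates_first advanceGates_second advanceGates_catalyst
  walkGates_first walkGates_second_false walkGates_second_true walkGates_catalyst
  dampGates_first_false dampGates_first_true dampGates_second routeGates_first_false
  routeGates_first_true routeGates_second_false routeGates_second_true routeGates_catalyst
  exitGates_ket circuitFn_append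

/-- Phase one lives where counter 1 is zero, so the second zero test flips qubit 4 on both outcomes:
it erases the mark of the leak, and the mark it puts on the rest is removed by the exit gates. -/
theorem coreGates_first (hφ : ∀ n, n 1 ≠ 0 → φ n = 0) :
    circuitFn Sw Re Wk (coreGates x y h h') (ket (pat false true false false false false) φ) =
      ket (pat true true false false false false) (pointwise Sw
        (((x : ℂ) ^ 2) • pointwise Sw (pointwise Wk (pointwise Sw (pointwise Re (shift 0 1 φ)))) -
        ((y : ℂ) ^ 2) •
          pointwise Re (pointwise Sw (pointwise Wk (pointwise Sw (pointwise Re (shift 0 1 φ))))))) +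
      ket (pat true false false false false false) (-((x : ℂ) * y) •
        (pointwise Sw (pointwise Wk (pointwise Sw (pointwise Re (shift 0 1 φ)))) +
          pointwise Re (pointwise Sw (pointwise Wk (pointwise Sw (pointwise Re (shift 0 1 φ))))))) := by
  have hs : ∀ n, n 1 ≠ 0 → shift 0 1 φ n = 0 := fun n hn => hφ _ (by simpa using hn)
  set χ := pointwise Sw (pointwise Wk (pointwise Sw (pointwise Re (shift 0 1 φ)))) with hχ
  have h1 : ∀ n, n 1 ≠ 0 → χ n = 0 := fun n hn => by simp [χ, pointwise_apply, hs n hn]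
  have h2 : ∀ n, n 1 ≠ 0 → pointwise Re χ n = 0 := fun n hn => by simp [pointwise_apply, h1 n hn]
  have z : ∀ (b : Fin 6 → Bool) (ξ : (Fin 2 → ℤ) → F), (∀ n, n 1 ≠ 0 → ξ n = 0) →
    (Gate.zeroTest 4 1 : Gate 5 2).toFn Sw Re Wk (ket b ξ) =
      ket (Function.update b 4 (!(b 4))) ξ := fun b ξ => toFn_zeroTest_ket Sw Re Wk 4 1 b ξ
  simp [coreGates, ← hχ, z _ χ h1, z _ (pointwise Re χ) h2]
  module

/-- Counter 1 is raised before the zero test, so the excluded value is -1: after the shift the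
family vanishes where the test would fire. -/
theorem coreGates_second (hφ : ∀ n, n 1 = -1 → φ n = 0) :
    circuitFn Sw Re Wk (coreGates x y h h') (ket (pat false false false false false false) φ) =
      ket (pat true false false false false false)
        (((x : ℂ) ^ 2) • pointwise Re (shift 1 1 (shift 0 1 φ)) +
          ((y : ℂ) ^ 2) • walkSum Sw Wk (pointwise Re (shift 1 1 (shift 0 1 φ)))) +
      ket (pat false true false false false false) (((x : ℂ) * y) • pointwise Sw
        (walkSum Sw Wk (pointwise Re (shift 1 1 (shift 0 1 φ))) -
          pointwise Re (shift 1 1 (shift 0 1 φ)))) +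
      (ket (pat true false true false false false)
        ((y : ℂ) • (y : ℂ) • walkDiff Sw Wk (pointwise Re (shift 1 1 (shift 0 1 φ)))) +
      ket (pat true false true true false false)
        ((x : ℂ) • (y : ℂ) • walkDiff Sw Wk (pointwise Re (shift 1 1 (shift 0 1 φ))))) := by
  have hs : ∀ n, n 1 = 0 → shift 1 1 (shift 0 1 φ) n = 0 := fun n hn => hφ _ (by simp [hn])
  set β := pointwise Re (shift 1 1 (shift 0 1 φ)) with hβ
  have h1 : ∀ n, n 1 = 0 → β n = 0 := fun n hn => by simp [β, pointwise_apply, hs n hn]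
  have h2 : ∀ n, n 1 = 0 → walkSum Sw Wk β n = 0 := fun n hn => by simp [walkSum_apply, h1 n hn]
  have h3 : ∀ n, n 1 = 0 → walkDiff Sw Wk β n = 0 := fun n hn => by simp [walkDiff_apply, h1 n hn]
  have z : ∀ (b : Fin 6 → Bool) (ξ : (Fin 2 → ℤ) → F), (∀ n, n 1 = 0 → ξ n = 0) →
    (Gate.zeroTest 4 1 : Gate 5 2).toFn Sw Re Wk (ket b ξ) = ket b ξ :=
      fun b ξ => toFn_zeroTest_ket_of_ne Sw Re Wk 4 1 b ξ
  simp only [coreGates, circuitFn_append, advanceGates_second, ← hβ, circuitFn_cons, circuitFn_nil,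
    rot_ket, map_add, update_pat_three, pat_three, Bool.false_eq_true, if_false, if_true, map_smul,
    map_neg, walkGates_second_false, walkGates_second_true, dampGates_second,
    walkSum_smul_eq, walkDiff_smul_eq,
    routeGates_second_false, routeGates_second_true, routeGates_catalyst, z _ β h1, z _ _ h2,
    z _ _ h3, exitGates_ket,
    Bool.not_true, Bool.not_false, Bool.xor_self, map_sub]
  push_cast
  module

theorem coreGates_catalyst (hφ : ∀ n, n 1 = 0 → φ n = 0) :
    circuitFn Sw Re Wk (coreGates x y h h')
      (ket (pat false false true false false false) ((y : ℂ) • φ) +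
        ket (pat false false true true false false) ((x : ℂ) • φ)) =
      ket (pat true false false false false false) ((y : ℂ) • walkDiff Sw Wk φ) +
      ket (pat false true false false false false)
        ((x : ℂ) • pointwise Sw (walkDiff Sw Wk φ)) +
      (ket (pat true false true false false false) ((y : ℂ) • walkSum Sw Wk φ) +
      ket (pat true false true true false false) ((x : ℂ) • walkSum Sw Wk φ)) := by
  have h2 : ∀ n, n 1 = 0 → walkSum Sw Wk φ n = 0 := fun n hn => by simp [walkSum_apply, hφ n hn]
  have h3 : ∀ n, n 1 = 0 → walkDiff Sw Wk φ n = 0 := fun n hn => by simp [walkDiff_apply, hφ n hn]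
  have z : ∀ (b : Fin 6 → Bool) (ξ : (Fin 2 → ℤ) → F), (∀ n, n 1 = 0 → ξ n = 0) →
    (Gate.zeroTest 4 1 : Gate 5 2).toFn Sw Re Wk (ket b ξ) = ket b ξ :=
      fun b ξ => toFn_zeroTest_ket_of_ne Sw Re Wk 4 1 b ξ
  have hxy : (x : ℂ) ^ 2 + (y : ℂ) ^ 2 = 1 := by exact_mod_cast h
  -- The stored coin state y|0⟩ + x|1⟩ is the preimage of |1⟩ under the rotation; the inverse
  -- rotation at the end of the pass restores it.
  have hrot : circuitFn Sw Re Wk [Gate.qubit 3 (rotU x y h)]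
      (ket (pat false false true false false false) ((y : ℂ) • φ) +
        ket (pat false false true true false false) ((x : ℂ) • φ)) =
      ket (pat false false true true false false) φ := by
    simp only [circuitFn_cons, circuitFn_nil, rot_ket, map_add, update_pat_three, pat_three,
      Bool.false_eq_true, if_false, if_true, map_smul, map_neg]
    trans ((x : ℂ) ^ 2 + (y : ℂ) ^ 2) • ket (pat false false true true false false) φ
    · module
    · rw [hxy, one_smul]
  simp only [coreGates, circuitFn_append]
  rw [map_add, advanceGates_catalyst, advanceGates_catalyst, hrot, walkGates_catalyst]
  simp only [circuitFn_cons, circuitFn_nil,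
    rot_ket, map_add, update_pat_three, pat_three, Bool.false_eq_true, if_false, if_true, map_smul,
    map_neg, dampGates_second, walkSum_smul_eq, walkDiff_smul_eq,
    routeGates_second_false, routeGates_second_true, routeGates_catalyst, z _ _ h2, z _ _ h3,
    exitGates_ket,
    Bool.not_true, Bool.not_false, Bool.xor_self]
  push_cast
  module

/-- The action of the circuit on a public input `P` and a private state with the parts `A`, `B`
and `W`. -/
theorem elfCircuit_apply (P A B W : (Fin 2 → ℤ) → F) (hP : ∀ n, n 0 ≠ 0 → P n = 0)
    (hA : ∀ n, n 0 = 0 → A n = 0) (hB : ∀ n, n 0 = 0 → B n = 0) (hW : ∀ n, n 0 = 0 → W n = 0) :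
    circuitFn Sw Re Wk (elfCircuit x y h h')
      (ket (pat false false false false false false) P +
        (ket (pat true true false false false false) A +
        ket (pat true false false false false false) B +
        (ket (pat true false true false false false) ((y : ℂ) • W) +
          ket (pat true false true true false false) ((x : ℂ) • W)))) =
    circuitFn Sw Re Wk (coreGates x y h h')
      (ket (pat false true false false false false) ((1 / 2 : ℂ) • (P - pointwise Re P) + A)) +
    circuitFn Sw Re Wk (coreGates x y h h')
      (ket (pat false false false false false false) ((1 / 2 : ℂ) • (P + pointwise Re P) + B)) +
    circuitFn Sw Re Wk (coreGates x y h h')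
      (ket (pat false false true false false false) ((y : ℂ) • W) +
        ket (pat false false true true false false) ((x : ℂ) • W)) := by
  -- After the entry gates the flag is set on the input only. The input is also the only part with
  -- counter 0 at zero, so the test clears its flag and all parts continue coherently.
  have z1 : ∀ (b : Fin 6 → Bool) (ξ : (Fin 2 → ℤ) → F), (∀ n, n 0 ≠ 0 → ξ n = 0) →
    (Gate.zeroTest 0 0 : Gate 5 2).toFn Sw Re Wk (ket b ξ) =
      ket (Function.update b 0 (!(b 0))) ξ := fun b ξ => toFn_zeroTest_ket Sw Re Wk 0 0 b ξ
  have z2 : ∀ (b : Fin 6 → Bool) (ξ : (Fin 2 → ℤ) → F), (∀ n, n 0 = 0 → ξ n = 0) →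
    (Gate.zeroTest 0 0 : Gate 5 2).toFn Sw Re Wk (ket b ξ) = ket b ξ :=
      fun b ξ => toFn_zeroTest_ket_of_ne Sw Re Wk 0 0 b ξ
  have hP' : ∀ n, n 0 ≠ 0 → pointwise Re P n = 0 := fun n hn => by
    simp [pointwise_apply, hP n hn]
  have e : elfCircuit x y h h' = entryGates ++ ([.zeroTest 0 0] ++ coreGates x y h h') := rfl
  simp only [e, circuitFn_append, map_add, map_sub, map_smul, entryGates_input, entryGates_private,
    circuitFn_cons, circuitFn_nil, z1 _ P hP, z1 _ _ hP', z2 _ A hA, z2 _ B hB, z2 _ W hW,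
    update_pat_zero, pat_zero, Bool.not_true]
  module

end CircuitAction

/-! ### Time slices in the counters and their norms -/

section JointFamilies

variable {F : Type*} [NormedAddCommGroup F] [InnerProductSpace ℂ F]

/-- The family with entry `g j k` where the counters are `j + k` and `k`. -/
def spread : (ℕ → ℕ → F) →ₗ[ℂ] ((Fin 2 → ℤ) → F) where
  toFun g n := if 0 ≤ n 1 ∧ n 1 ≤ n 0 then g (n 0 - n 1).toNat (n 1).toNat else 0
  map_add' g g' := by ext n; by_cases h : 0 ≤ n 1 ∧ n 1 ≤ n 0 <;> simp [h]
  map_smul' a g := by ext n; by_cases h : 0 ≤ n 1 ∧ n 1 ≤ n 0 <;> simp [h]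

theorem spread_apply (g : ℕ → ℕ → F) (n : Fin 2 → ℤ) :
    spread g n = if 0 ≤ n 1 ∧ n 1 ≤ n 0 then g (n 0 - n 1).toNat (n 1).toNat else 0 := rfl

theorem pointwise_spread (L : F ≃ₗᵢ[ℂ] F) (g : ℕ → ℕ → F) :
    pointwise L (spread g) = spread fun j k => L (g j k) := by
  ext n
  by_cases h : 0 ≤ n 1 ∧ n 1 ≤ n 0 <;> simp [pointwise_apply, spread_apply, h]

theorem shift_spread (g : ℕ → ℕ → F) :
    shift 0 1 (spread g) = spread fun j k => if j = 0 then 0 else g (j - 1) k := by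
  ext n
  simp only [shift_apply, spread_apply, Function.update_self,
    Function.update_of_ne (show (1 : Fin 2) ≠ 0 by decide)]
  by_cases h : 0 ≤ n 1 ∧ n 1 ≤ n 0
  · by_cases h' : n 1 = n 0
    · simp [h']
    · have h1 : 0 ≤ n 1 ∧ n 1 ≤ n 0 - 1 := by omega
      have h2 : (n 0 - n 1).toNat ≠ 0 := by omega
      have h3 : (n 0 - 1 - n 1).toNat = (n 0 - n 1).toNat - 1 := by omega
      simp only [h, h1, h2, h3, and_self, if_true, if_false]
  · have h1 : ¬(0 ≤ n 1 ∧ n 1 ≤ n 0 - 1) := by omega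
    simp only [h, h1, if_false]

/-- The counters hold j + k and k; raising both keeps j and advances k. -/
theorem shift_shift_spread (g : ℕ → ℕ → F) :
    shift 1 1 (shift 0 1 (spread g)) = spread fun j k => if k = 0 then 0 else g j (k - 1) := by
  ext n
  simp only [shift_apply, spread_apply, Function.update_self,
    Function.update_of_ne (show (1 : Fin 2) ≠ 0 by decide),
    Function.update_of_ne (show (0 : Fin 2) ≠ 1 by decide)]
  by_cases h : 0 ≤ n 1 ∧ n 1 ≤ n 0
  · by_cases h' : n 1 = 0
    · simp [h']
    · have h1 : 0 ≤ n 1 - 1 ∧ n 1 - 1 ≤ n 0 - 1 := by omega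
      have h2 : (n 1).toNat ≠ 0 := by omega
      have h3 : (n 0 - 1 - (n 1 - 1)).toNat = (n 0 - n 1).toNat := by omega
      have h4 : (n 1 - 1).toNat = (n 1).toNat - 1 := by omega
      simp only [h, h1, h2, h3, h4, and_self, if_true, if_false]
  · have h1 : ¬(0 ≤ n 1 - 1 ∧ n 1 - 1 ≤ n 0 - 1) := by omega
    simp only [h, h1, if_false]

/-- The counter values that belong to a pair of natural numbers. -/
def counters (p : ℕ × ℕ) : Fin 2 → ℤ := ![(p.1 : ℤ) + p.2, p.2]

theorem counters_injective : Function.Injective counters := by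
  rintro ⟨a, b⟩ ⟨a', b'⟩ h
  have h0 : (a : ℤ) + b = a' + b' := congrFun h 0
  have h1 : (b : ℤ) = b' := congrFun h 1
  ext <;> simp <;> omega

theorem spread_counters (g : ℕ → ℕ → F) (p : ℕ × ℕ) : spread g (counters p) = g p.1 p.2 := by
  simp [spread_apply, counters]

theorem spread_eq_zero (g : ℕ → ℕ → F) (n : Fin 2 → ℤ) (hn : n ∉ Set.range counters) :
    spread g n = 0 := by
  rw [spread_apply, if_neg]
  intro h
  refine hn ⟨((n 0 - n 1).toNat, (n 1).toNat), ?_⟩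
  ext i
  fin_cases i <;> simp [counters] <;> omega

theorem hasSum_norm_ket (b : Fin 6 → Bool) (g : ℕ → ℕ → F) (a : ℝ)
    (hg : HasSum (fun p : ℕ × ℕ => ‖g p.1 p.2‖ ^ 2) a) :
    HasSum (fun m : Mem 5 2 => ‖ket b (spread g) m‖ ^ 2) a := by
  have h1 : HasSum (fun n => ‖spread g n‖ ^ 2) a := by
    rw [← counters_injective.hasSum_iff]
    · simpa only [Function.comp_def, spread_counters] using hg
    · intro n hn
      simp [spread_eq_zero g n hn]
  have hinj : Function.Injective (fun n => (b, n) : (Fin 2 → ℤ) → Mem 5 2) :=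
    fun n n' h => (Prod.mk.inj h).2
  rw [← hinj.hasSum_iff]
  · simpa [Function.comp_def, ket_apply] using h1
  · rintro ⟨b', n⟩ hm
    have : b' ≠ b := by rintro rfl; exact hm ⟨n, rfl⟩
    simp [ket_apply, this]

/-- Slices are products of a phase-one and a phase-two quantity, so the double sum over both times
factorises. -/
theorem exists_joint_eq (b : Fin 6 → Bool) (g : ℕ → ℕ → F) (s t : ℕ → ℝ) (S T : ℝ)
    (hs : HasSum s S) (ht : HasSum t T) (hs0 : ∀ j, 0 ≤ s j) (ht0 : ∀ k, 0 ≤ t k)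
    (hg : ∀ j k, ‖g j k‖ ^ 2 = s j * t k) :
    ∃ Ψ : Joint F 5 2, (Ψ : Mem 5 2 → F) = ket b (spread g) ∧ ‖Ψ‖ ^ 2 = S * T := by
  have hp : HasSum (fun p : ℕ × ℕ => ‖g p.1 p.2‖ ^ 2) (S * T) := by
    simp only [hg]
    exact hs.mul ht (hs.summable.mul_of_nonneg ht.summable hs0 ht0)
  have hk := hasSum_norm_ket b g _ hp
  exact ⟨⟨ket b (spread g), (memJoint_iff _).2 hk.summable⟩, rfl,
    (Joint.hasSum_norm_sq _).unique hk⟩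

theorem exists_joint_le (b : Fin 6 → Bool) (g : ℕ → ℕ → F) (s t : ℕ → ℝ) (S T : ℝ)
    (hs : HasSum s S) (ht : HasSum t T) (hs0 : ∀ j, 0 ≤ s j) (ht0 : ∀ k, 0 ≤ t k)
    (hg : ∀ j k, ‖g j k‖ ^ 2 ≤ s j * t k) :
    ∃ Ψ : Joint F 5 2, (Ψ : Mem 5 2 → F) = ket b (spread g) ∧ ‖Ψ‖ ^ 2 ≤ S * T := by
  have hp : HasSum (fun p : ℕ × ℕ => s p.1 * t p.2) (S * T) :=
    hs.mul ht (hs.summable.mul_of_nonneg ht.summable hs0 ht0)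
  have hle : ∀ p : ℕ × ℕ, ‖g p.1 p.2‖ ^ 2 ≤ s p.1 * t p.2 := fun p => hg p.1 p.2
  have h0 : ∀ p : ℕ × ℕ, 0 ≤ ‖g p.1 p.2‖ ^ 2 := fun p => sq_nonneg _
  obtain ⟨a, ha⟩ : Summable (fun p : ℕ × ℕ => ‖g p.1 p.2‖ ^ 2) :=
    Summable.of_nonneg_of_le h0 hle hp.summable
  have hk := hasSum_norm_ket b g a ha
  have hmem : Memℓp (ket b (spread g) : Mem 5 2 → F) 2 := (memJoint_iff _).2 hk.summable
  refine ⟨⟨ket b (spread g), hmem⟩, rfl, ?_⟩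
  have e : ‖(⟨ket b (spread g), hmem⟩ : Joint F 5 2)‖ ^ 2 = a :=
    (Joint.hasSum_norm_sq _).unique hk
  rw [e]
  exact hasSum_le hle ha hp

theorem mem_publicSpace_orthogonal (w : Joint F 5 2)
    (hw : ∀ m : Mem 5 2, m.1 0 = false → w m = 0) : w ∈ (publicSpace F 5 2)ᗮ := by
  rw [Submodule.mem_orthogonal]
  intro u hu
  rw [lp.inner_eq_tsum]
  refine (tsum_congr fun m => ?_).trans tsum_zero
  cases hm : m.1 0
  · rw [hw m hm, inner_zero_right]
  · rw [hu m hm, inner_zero_left]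

theorem coe_tensor_memZero (φ : F) : (tensor φ (memZero 5 2) : Mem 5 2 → F) =
    ket (pat false false false false false false)
      (spread fun j k => if j = 0 ∧ k = 0 then φ else 0) := by
  ext ⟨b, n⟩
  change (memZero 5 2 : Mem 5 2 → ℂ) (b, n) • φ = _
  have hb : pat false false false false false false = fun _ => false := by
    ext i; fin_cases i <;> rfl
  rw [memZero, lp.single_apply, ket_apply, hb, spread_apply]
  by_cases h : b = fun _ => false
  · subst h
    by_cases hn : n = fun _ => 0
    · subst hn; simp
    · have h1 : ¬(((fun _ => false, n) : Mem 5 2) = (fun _ => false, fun _ => 0)) := by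
        simpa using hn
      simp only [Pi.single_apply, h1, if_true, if_false, zero_smul]
      split_ifs with h2 h3
      · exfalso
        apply hn
        ext i
        fin_cases i <;> simp <;> omega
      · rfl
      · rfl
  · have h1 : ¬(((b, n) : Mem 5 2) = (fun _ => false, fun _ => 0)) := by
      simp [h]
    simp [h, h1]

end JointFamilies

/-! ### Invariance of the catalyst -/

section Catalyst

variable {F : Type*} [NormedAddCommGroup F] [InnerProductSpace ℂ F]

theorem walkSum_spread (Sw Wk : F ≃ₗᵢ[ℂ] F) (g : ℕ → ℕ → F) : walkSum Sw Wk (spread g) =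
    spread fun j k => (1 / 2 : ℂ) • (Sw (g j k) + Wk (Sw (g j k))) := by
  ext n
  by_cases h : 0 ≤ n 1 ∧ n 1 ≤ n 0 <;> simp [walkSum_apply, spread_apply, h]

theorem walkDiff_spread (Sw Wk : F ≃ₗᵢ[ℂ] F) (g : ℕ → ℕ → F) : walkDiff Sw Wk (spread g) =
    spread fun j k => (1 / 2 : ℂ) • (Sw (g j k) - Wk (Sw (g j k))) := by
  ext n
  by_cases h : 0 ≤ n 1 ∧ n 1 ≤ n 0 <;> simp [walkDiff_apply, spread_apply, h]

/-- Running phase-two amplitude has three sources: the leak of phase one (`X₂`), its own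
continuation (`X₃`) and the inner catalyst (`X₇`). The output and the inner catalyst have two each.
-/
theorem combine_kets {b₁ b₂ b₃ b₄ b₅ : Fin 6 → Bool}
    {X₁ X₂ X₃ X₄ X₅ X₆ X₇ X₈ X₉ X₁₀ O A B W W' : (Fin 2 → ℤ) → F}
    (h₁ : X₁ = A) (h₂ : X₂ + X₃ + X₇ = B) (h₃ : X₄ + X₈ = O) (h₄ : X₅ + X₉ = W)
    (h₅ : X₆ + X₁₀ = W') :
    (ket b₁ X₁ + ket b₂ X₂) + (ket b₂ X₃ + ket b₃ X₄ + (ket b₄ X₅ + ket b₅ X₆)) +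
      (ket b₂ X₇ + ket b₃ X₈ + (ket b₄ X₉ + ket b₅ X₁₀)) =
    ket (q := 5) b₃ O + (ket b₁ A + ket b₂ B + (ket b₄ W + ket b₅ W')) := by
  subst h₁ h₂ h₃ h₄ h₅
  simp only [map_add]
  abel

/-- The circuit on the catalyst of the two-phase process. -/
theorem elfCircuit_catalyst (Sw Re Wk : F ≃ₗᵢ[ℂ] F) (x y : ℝ) (h : x ^ 2 + y ^ 2 = 1)
    (h' : x ^ 2 + (-y) ^ 2 = 1) (e f : F) (A ψ w : ℕ → F) (γ μ : ℕ → ℂ)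
    (hA : ∀ j, Re (A j) = -A j) (he : Re e = e) (hψ : ψ 0 = e)
    (stay₁ : ∀ j, Sw (-((x : ℂ) ^ 2) • Sw (Wk (Sw (A j))) +
      ((y : ℂ) ^ 2) • Re (Sw (Wk (Sw (A j))))) = A (j + 1))
    (leak₁ : ∀ j, ((x : ℂ) * y) • (Sw (Wk (Sw (A j))) + Re (Sw (Wk (Sw (A j))))) =
      γ (j + 1) • e)
    (stay₂ : ∀ k, ((x : ℂ) ^ 2) • Re (ψ k) +
      ((y : ℂ) ^ 2) • (1 / 2 : ℂ) • (Sw (Re (ψ k)) + Wk (Sw (Re (ψ k)))) +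
      (y : ℂ) • (1 / 2 : ℂ) • (Sw (w k) - Wk (Sw (w k))) = ψ (k + 1))
    (leak₂ : ∀ k, ((x : ℂ) * y) • Sw ((1 / 2 : ℂ) • (Sw (Re (ψ k)) + Wk (Sw (Re (ψ k)))) - Re (ψ k)) +
      (x : ℂ) • Sw ((1 / 2 : ℂ) • (Sw (w k) - Wk (Sw (w k)))) = μ k • f)
    (fix : ∀ k, (y : ℂ) • (1 / 2 : ℂ) • (Sw (Re (ψ k)) - Wk (Sw (Re (ψ k)))) +
      (1 / 2 : ℂ) • (Sw (w k) + Wk (Sw (w k))) = w k) :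
    circuitFn Sw Re Wk (elfCircuit x y h h')
      (ket (pat false false false false false false)
          (spread fun j k => if j = 0 ∧ k = 0 then γ 0 • e + A 0 else 0) +
        (ket (pat true true false false false false)
          (spread fun j k => if k = 0 ∧ j ≠ 0 then A j else 0) +
        ket (pat true false false false false false)
          (spread fun j k => if j = 0 ∧ k = 0 then 0 else γ j • ψ k) +
        (ket (pat true false true false false false)
          ((y : ℂ) • spread fun j k => if k = 0 then 0 else γ j • w (k - 1)) +
        ket (pat true false true true false false)
          ((x : ℂ) • spread fun j k => if k = 0 then 0 else γ j • w (k - 1))))) =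
    ket (pat false true false false false false)
        (spread fun j k => if k = 0 then 0 else γ j • μ (k - 1) • f) +
      (ket (pat true true false false false false)
          (spread fun j k => if k = 0 ∧ j ≠ 0 then A j else 0) +
        ket (pat true false false false false false)
          (spread fun j k => if j = 0 ∧ k = 0 then 0 else γ j • ψ k) +
        (ket (pat true false true false false false)
          ((y : ℂ) • spread fun j k => if k = 0 then 0 else γ j • w (k - 1)) +
        ket (pat true false true true false false)
          ((x : ℂ) • spread fun j k => if k = 0 then 0 else γ j • w (k - 1)))) := by
  -- The private families omit the slice (0, 0), which is reserved for the input.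
  have key : ∀ (g : ℕ → ℕ → F), g 0 0 = 0 → ∀ n : Fin 2 → ℤ, n 0 = 0 → spread g n = 0 := by
    intro g hg n hn
    rw [spread_apply]
    split_ifs with h1
    · have h2 : (n 0 - n 1).toNat = 0 := by omega
      have h3 : (n 1).toNat = 0 := by omega
      rw [h2, h3, hg]
    · rfl
  rw [elfCircuit_apply]
  · have e1 : (1 / 2 : ℂ) • ((spread fun j k => if j = 0 ∧ k = 0 then γ 0 • e + A 0 else 0) -
        pointwise Re (spread fun j k => if j = 0 ∧ k = 0 then γ 0 • e + A 0 else 0)) +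
        (spread fun j k => if k = 0 ∧ j ≠ 0 then A j else 0) =
        spread fun j k => if k = 0 then A j else 0 := by
      simp only [pointwise_spread, ← map_add, ← map_smul, ← map_sub]
      congr 1
      funext j k
      rcases j with _ | j <;> rcases k with _ | k <;> simp [hA, he]
      module
    have e2 : (1 / 2 : ℂ) • ((spread fun j k => if j = 0 ∧ k = 0 then γ 0 • e + A 0 else 0) +
        pointwise Re (spread fun j k => if j = 0 ∧ k = 0 then γ 0 • e + A 0 else 0)) +
        (spread fun j k => if j = 0 ∧ k = 0 then 0 else γ j • ψ k) =
        spread fun j k => γ j • ψ k := by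
      simp only [pointwise_spread, ← map_add, ← map_smul]
      congr 1
      funext j k
      rcases j with _ | j <;> rcases k with _ | k <;> simp [hA, he, hψ]
      module
    rw [e1, e2, coreGates_first, coreGates_second, coreGates_catalyst]
    · simp only [shift_shift_spread]
      simp only [pointwise_spread, shift_spread, walkSum_spread, walkDiff_spread]
      apply combine_kets <;> simp only [← map_add, ← map_smul, ← map_sub, pointwise_spread]
      · congr 1
        funext j k
        rcases j with _ | j <;> rcases k with _ | k <;> simp [hA]
        rw [← stay₁ j]
        simp
      · congr 1
        funext j k
        -- New phase-two slices at k = 0 come from the leak of phase one and start as ψ 0 = e; those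
        -- with k > 0 come from phase two and its inner catalyst.
        rcases k with _ | k
        · rcases j with _ | j
          · simp
          · simp [hA, hψ]
            rw [← leak₁ j]
            module
        · simp
          rw [← stay₂ k]
          simp
          module
      · congr 1
        funext j k
        rcases k with _ | k
        · simp
        · simp
          rw [← leak₂ k]
          simp
          module
      · congr 1
        funext j k
        -- The inner catalyst keeps its counters, whereas ψ k has already been moved to k + 1 when
        -- the two meet; hence slice k + 1 stores w k.
        rcases k with _ | k
        · simp
        · simp
          conv_rhs => rw [← fix k]
          module
      · congr 1
        funext j k
        rcases k with _ | k
        · simp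
        · simp
          conv_rhs => rw [← fix k]
          module
    · intro n hn
      rw [spread_apply, show (n 1).toNat = 0 by omega]
      simp
    · intro n hn
      rw [spread_apply, if_neg]
      omega
    · intro n hn
      by_cases h1 : 0 ≤ n 1 ∧ n 1 ≤ n 0
      · rw [spread_apply, if_pos h1, if_neg (by omega)]
      · rw [spread_apply, if_neg h1]
  · intro n hn
    rw [spread_apply]
    split_ifs with h1 h2
    · omega
    · rfl
    · rfl
  all_goals
    apply key
    simp

end Catalyst

/-! ### From an invariant catalyst to a transduction -/

section Transduction

variable {F : Type*} [NormedAddCommGroup F] [InnerProductSpace ℂ F]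

/-- The circuit transduces the input into the output whenever the two-phase process consumes
all the amplitude. -/
theorem exists_transduces_elfCircuit (Sw Re Wk : F ≃ₗᵢ[ℂ] F) (x y : ℝ) (h : x ^ 2 + y ^ 2 = 1)
    (h' : x ^ 2 + (-y) ^ 2 = 1) (e f : F) (A ψ w : ℕ → F) (γ μ : ℕ → ℂ)
    (hA : ∀ j, Re (A j) = -A j) (he : Re e = e) (hψ : ψ 0 = e)
    (stay₁ : ∀ j, Sw (-((x : ℂ) ^ 2) • Sw (Wk (Sw (A j))) +
      ((y : ℂ) ^ 2) • Re (Sw (Wk (Sw (A j))))) = A (j + 1))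
    (leak₁ : ∀ j, ((x : ℂ) * y) • (Sw (Wk (Sw (A j))) + Re (Sw (Wk (Sw (A j))))) =
      γ (j + 1) • e)
    (stay₂ : ∀ k, ((x : ℂ) ^ 2) • Re (ψ k) +
      ((y : ℂ) ^ 2) • (1 / 2 : ℂ) • (Sw (Re (ψ k)) + Wk (Sw (Re (ψ k)))) +
      (y : ℂ) • (1 / 2 : ℂ) • (Sw (w k) - Wk (Sw (w k))) = ψ (k + 1))
    (leak₂ : ∀ k, ((x : ℂ) * y) • Sw ((1 / 2 : ℂ) • (Sw (Re (ψ k)) + Wk (Sw (Re (ψ k)))) - Re (ψ k)) +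
      (x : ℂ) • Sw ((1 / 2 : ℂ) • (Sw (w k) - Wk (Sw (w k)))) = μ k • f)
    (fix : ∀ k, (y : ℂ) • (1 / 2 : ℂ) • (Sw (Re (ψ k)) - Wk (Sw (Re (ψ k)))) +
      (1 / 2 : ℂ) • (Sw (w k) + Wk (Sw (w k))) = w k)
    (hγ : HasSum (fun j => ‖γ j‖ ^ 2) 1) (hμ : HasSum (fun k => ‖μ k‖ ^ 2) 1)
    {SA Sψ Sw' : ℝ} (hSA : HasSum (fun j => ‖A j‖ ^ 2) SA) (hSψ : HasSum (fun k => ‖ψ k‖ ^ 2) Sψ)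
    (hSw : HasSum (fun k => ‖w k‖ ^ 2) Sw') :
    ∃ (Γ : lp (fun _ : Mem 5 2 => ℂ) 2) (v : Joint F 5 2), ‖Γ‖ = 1 ∧
      Transduces (circuitEval Sw Re Wk (elfCircuit x y h h')) (publicSpace F 5 2)
        (tensor (γ 0 • e + A 0) (memZero 5 2)) (tensor f Γ) v ∧
      ‖v‖ ^ 2 ≤ 4 * (SA + Sψ + 2 * Sw') := by
  have hx1 : x ^ 2 ≤ 1 := by nlinarith [sq_nonneg y]
  have hy1 : y ^ 2 ≤ 1 := by nlinarith [sq_nonneg x]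
  have shifted : ∀ (t : ℕ → ℝ) (T : ℝ), HasSum t T →
      HasSum (fun k => if k = 0 then 0 else t (k - 1)) T := by
    intro t T ht
    have := (hasSum_nat_add_iff (f := fun k => if k = 0 then 0 else t (k - 1)) 1 (g := T)).1
      (by simpa using ht)
    simpa using this
  have nn : ∀ (t : ℕ → ℝ), (∀ k, 0 ≤ t k) → ∀ k, 0 ≤ (if k = 0 then 0 else t (k - 1)) := by
    intro t ht k
    split_ifs
    exacts [le_rfl, ht _]
  -- The garbage records both exit times; it is a product of two unit sequences. The index k - 1
  -- appears because the output of ψ k leaves after its counters were advanced.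
  obtain ⟨Γ, hΓ, hΓn⟩ := exists_joint_eq (F := ℂ) (pat false true false false false false)
    (fun j k => if k = 0 then 0 else γ j * μ (k - 1)) (fun j => ‖γ j‖ ^ 2)
    (fun k => if k = 0 then 0 else ‖μ (k - 1)‖ ^ 2) 1 1 hγ (shifted (fun k => ‖μ k‖ ^ 2) 1 hμ)
    (fun _ => sq_nonneg _) (nn (fun k => ‖μ k‖ ^ 2) fun _ => sq_nonneg _) (by
      intro j k
      split_ifs <;> simp [mul_pow])
  obtain ⟨vA, hvA, hvAn⟩ := exists_joint_le (F := F) (pat true true false false false false)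
    (fun j k => if k = 0 ∧ j ≠ 0 then A j else 0) (fun j => ‖A j‖ ^ 2)
    (fun k => if k = 0 then 1 else 0) SA 1 hSA (hasSum_ite_eq 0 1)
    (fun _ => sq_nonneg _) (fun k => by split_ifs <;> norm_num) (by
      intro j k
      by_cases hk : k = 0 <;> by_cases hj : j = 0 <;> simp [hk, hj])
  obtain ⟨vB, hvB, hvBn⟩ := exists_joint_le (F := F) (pat true false false false false false)
    (fun j k => if j = 0 ∧ k = 0 then 0 else γ j • ψ k) (fun j => ‖γ j‖ ^ 2)
    (fun k => ‖ψ k‖ ^ 2) 1 Sψ hγ hSψ (fun _ => sq_nonneg _) (fun _ => sq_nonneg _) (by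
      intro j k
      split_ifs
      · simp; positivity
      · rw [norm_smul, mul_pow])
  have hW : ∀ (z : ℝ), z ^ 2 ≤ 1 → ∀ j k,
      ‖(z : ℂ) • (if k = 0 then (0 : F) else γ j • w (k - 1))‖ ^ 2 ≤
        ‖γ j‖ ^ 2 * (if k = 0 then 0 else ‖w (k - 1)‖ ^ 2) := by
    intro z hz j k
    split_ifs
    · simp
    · rw [norm_smul, norm_smul, mul_pow, mul_pow, Complex.norm_real, Real.norm_eq_abs, sq_abs]
      exact mul_le_of_le_one_left (by positivity) hz
  obtain ⟨v₀, hv₀, hv₀n⟩ := exists_joint_le (F := F) (pat true false true false false false)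
    (fun j k => (y : ℂ) • (if k = 0 then (0 : F) else γ j • w (k - 1))) 
    (fun j => ‖γ j‖ ^ 2) (fun k => if k = 0 then 0 else ‖w (k - 1)‖ ^ 2) 1 Sw' hγ
    (shifted (fun k => ‖w k‖ ^ 2) Sw' hSw) (fun _ => sq_nonneg _)
    (nn (fun k => ‖w k‖ ^ 2) fun _ => sq_nonneg _) (hW y hy1)
  obtain ⟨v₁, hv₁, hv₁n⟩ := exists_joint_le (F := F) (pat true false true true false false)
    (fun j k => (x : ℂ) • (if k = 0 then (0 : F) else γ j • w (k - 1))) 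
    (fun j => ‖γ j‖ ^ 2) (fun k => if k = 0 then 0 else ‖w (k - 1)‖ ^ 2) 1 Sw' hγ
    (shifted (fun k => ‖w k‖ ^ 2) Sw' hSw) (fun _ => sq_nonneg _)
    (nn (fun k => ‖w k‖ ^ 2) fun _ => sq_nonneg _) (hW x hx1)
  have hv₀' : (v₀ : Mem 5 2 → F) = ket (pat true false true false false false)
      ((y : ℂ) • spread fun j k => if k = 0 then 0 else γ j • w (k - 1)) := by
    rw [hv₀, ← map_smul]; rfl
  have hv₁' : (v₁ : Mem 5 2 → F) = ket (pat true false true true false false)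
      ((x : ℂ) • spread fun j k => if k = 0 then 0 else γ j • w (k - 1)) := by
    rw [hv₁, ← map_smul]; rfl
  have hτ : (tensor f Γ : Mem 5 2 → F) = ket (pat false true false false false false)
      (spread fun j k => if k = 0 then 0 else γ j • μ (k - 1) • f) := by
    ext ⟨b, n⟩
    change (Γ : Mem 5 2 → ℂ) (b, n) • f = _
    rw [hΓ]
    simp only [ket_apply, spread_apply]
    split_ifs <;> simp [smul_smul]
  refine ⟨Γ, vA + vB + (v₀ + v₁), ?_, ⟨?_, ?_, ?_, ?_⟩, ?_⟩
  · have : ‖Γ‖ ^ 2 = 1 := by rw [hΓn]; norm_num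
    exact (pow_eq_one_iff_of_nonneg (norm_nonneg _) two_ne_zero).1 this
  · intro m hm
    rw [coe_tensor_memZero, ket_apply, if_neg]
    intro h0
    rw [h0] at hm
    simp at hm
  · intro m hm
    rw [hτ, ket_apply, if_neg]
    intro h0
    rw [h0] at hm
    simp at hm
  · apply mem_publicSpace_orthogonal
    intro m hm
    have hne : ∀ b₁ b₂ b₃ b₄ b₅, m.1 ≠ pat true b₁ b₂ b₃ b₄ b₅ := by
      intro b₁ b₂ b₃ b₄ b₅ h0
      rw [h0] at hm
      simp at hm
    simp only [lp.coeFn_add, Pi.add_apply, hvA, hvB, hv₀, hv₁, ket_apply, hne, if_false, add_zero]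
  · apply Subtype.ext
    rw [coe_circuitEval]
    simp only [lp.coeFn_add, hvA, hvB, hv₀', hv₁', hτ, coe_tensor_memZero]
    exact elfCircuit_catalyst Sw Re Wk x y h h' e f A ψ w γ μ hA he hψ stay₁ leak₁ stay₂ leak₂ fix
  · have h1 : ‖vA + vB + (v₀ + v₁)‖ ≤ ‖vA‖ + ‖vB‖ + (‖v₀‖ + ‖v₁‖) :=
      (norm_add_le _ _).trans (add_le_add (norm_add_le _ _) (norm_add_le _ _))
    have h2 : ‖vA + vB + (v₀ + v₁)‖ ^ 2 ≤ (‖vA‖ + ‖vB‖ + (‖v₀‖ + ‖v₁‖)) ^ 2 := by gcongr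
    -- Cauchy–Schwarz for the four pieces of the catalyst gives the factor 4.
    nlinarith [sq_nonneg (‖vA‖ - ‖vB‖), sq_nonneg (‖v₀‖ - ‖v₁‖),
      sq_nonneg (‖vA‖ + ‖vB‖ - (‖v₀‖ + ‖v₁‖))]

end Transduction

/-! ## Damped rotations -/

section DampedRotation

open Filter Topology

variable {x y : ℕ → ℝ} {ε S C σ : ℝ}

/-- Without the damping the step would be orthogonal, so the loss is exactly what the damping takes
from x. -/
theorem damped_rotation_norm_sq (hε : 0 < ε) (hSC : C ^ 2 + S ^ 2 = 1)
    (hx : ∀ t, (1 + ε) * x (t + 1) = C * x t - S * y t)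
    (hy : ∀ t, y (t + 1) = S * x t + C * y t) (t : ℕ) :
    (2 * ε + ε ^ 2) * x (t + 1) ^ 2 =
      (x t ^ 2 + y t ^ 2) - (x (t + 1) ^ 2 + y (t + 1) ^ 2) := by
  have h1 : ((1 + ε) * x (t + 1)) ^ 2 + y (t + 1) ^ 2 = x t ^ 2 + y t ^ 2 := by
    rw [hx, hy]
    linear_combination (x t ^ 2 + y t ^ 2) * hSC
  linear_combination h1

/-- The loss of norm bounds ∑ x² by O(1/ε). The undamped coordinate is controlled because the
rotation feeds it into x: S ∑ y² equals S ∑ x² up to a factor, a telescoping cross term and an error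
of order ε, half of S ∑ y² absorbing the last. The condition S ≥ σε then keeps the bound at order
1/ε. -/
theorem damped_rotation_sum_le (hε : 0 < ε) (hε1 : ε ≤ 1) (hSC : C ^ 2 + S ^ 2 = 1)
    (hσ : 0 < σ) (hσ1 : σ ≤ 1) (hS : σ * ε ≤ S)
    (hx : ∀ t, (1 + ε) * x (t + 1) = C * x t - S * y t)
    (hy : ∀ t, y (t + 1) = S * x t + C * y t) (h0 : x 0 ^ 2 + y 0 ^ 2 = 1) (N : ℕ) :
    ∑ t ∈ Finset.range N, (x t ^ 2 + y t ^ 2) ≤ 9 / (σ ^ 2 * ε) := by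
  have hS0 : 0 < S := (mul_pos hσ hε).trans_le hS
  have hC : |C| ≤ 1 := abs_le_one_iff_mul_self_le_one.2 (by nlinarith)
  have hstep := damped_rotation_norm_sq hε hSC hx hy
  have hn : ∀ t, x t ^ 2 + y t ^ 2 ≤ 1 := by
    intro t
    induction t with
    | zero => exact h0.le
    | succ t ih => nlinarith [hstep t, sq_nonneg (x (t + 1))]
  set X := ∑ t ∈ Finset.range N, x (t + 1) ^ 2 with hX
  set Y := ∑ t ∈ Finset.range N, y t ^ 2 with hY
  have hX0 : 0 ≤ X := Finset.sum_nonneg fun t _ => sq_nonneg _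
  have hXle : 2 * ε * X ≤ 1 := by
    have h1 : (2 * ε + ε ^ 2) * X = 1 - (x N ^ 2 + y N ^ 2) := by
      rw [hX, Finset.mul_sum, Finset.sum_congr rfl fun t _ => hstep t, Finset.sum_range_sub', h0]
    nlinarith [sq_nonneg ε, sq_nonneg (x N), sq_nonneg (y N), mul_nonneg (sq_nonneg ε) hX0]
  -- Obtained by expanding S (Cx - Sy)² and the new cross product; the terms C x y telescope when
  -- summed over t.
  have hid : ∀ t, S * y t ^ 2 = S * (1 + ε) ^ 2 * x (t + 1) ^ 2 +
      (C * (x t * y t) - C * (x (t + 1) * y (t + 1))) - C * ε * (x (t + 1) * y (t + 1)) := by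
    intro t
    have h1 : S * (1 + ε) ^ 2 * x (t + 1) ^ 2 = S * (C * x t - S * y t) ^ 2 := by
      rw [← hx]; ring
    have h2 : C * (x (t + 1) * y (t + 1)) + C * ε * (x (t + 1) * y (t + 1)) =
        C * ((C * x t - S * y t) * (S * x t + C * y t)) := by
      rw [← hx, ← hy]; ring
    linear_combination -h1 + h2 + (-(S * y t ^ 2) + C * x t * y t) * hSC
  -- Young's inequality, with weights chosen so that the y-part is S/2 and can be moved to the left
  -- side.
  have hcross : ∀ t, -(C * ε * (x (t + 1) * y (t + 1))) ≤
      ε ^ 2 / (2 * S) * x (t + 1) ^ 2 + S / 2 * y (t + 1) ^ 2 := by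
    intro t
    have h1 : -(C * ε * (x (t + 1) * y (t + 1))) ≤ |C| * (ε * |x (t + 1) * y (t + 1)|) := by
      refine (neg_le_abs _).trans (le_of_eq ?_)
      rw [abs_mul, abs_mul, abs_of_pos hε]; ring
    have h2 : |C| * (ε * |x (t + 1) * y (t + 1)|) ≤ ε * |x (t + 1) * y (t + 1)| :=
      mul_le_of_le_one_left (by positivity) hC
    have h3 : ε * |x (t + 1) * y (t + 1)| ≤
        ε ^ 2 / (2 * S) * x (t + 1) ^ 2 + S / 2 * y (t + 1) ^ 2 := by
      rw [abs_mul, ← sq_abs (x (t + 1)), ← sq_abs (y (t + 1))]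
      have : ε ^ 2 / (2 * S) * |x (t + 1)| ^ 2 + S / 2 * |y (t + 1)| ^ 2 -
          ε * (|x (t + 1)| * |y (t + 1)|) =
          (ε * |x (t + 1)| - S * |y (t + 1)|) ^ 2 / (2 * S) := by
        field_simp
        ring
      have h4 : 0 ≤ (ε * |x (t + 1)| - S * |y (t + 1)|) ^ 2 / (2 * S) := by positivity
      linarith
    linarith
  have hp : ∀ t, |C * (x t * y t)| ≤ 1 / 2 := by
    intro t
    rw [abs_mul]
    have h1 : |x t * y t| ≤ 1 / 2 := by
      rw [abs_le]
      constructor <;> nlinarith [hn t, sq_nonneg (x t + y t), sq_nonneg (x t - y t)]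
    exact (mul_le_of_le_one_left (abs_nonneg _) hC).trans h1
  have hY1 : ∑ t ∈ Finset.range N, y (t + 1) ^ 2 ≤ Y + 1 := by
    have h1 := Finset.sum_range_succ' (fun t => y t ^ 2) N
    have h2 := Finset.sum_range_succ (fun t => y t ^ 2) N
    nlinarith [hn N, sq_nonneg (x N), sq_nonneg (y 0)]
  have hmain : S * Y ≤ S * (1 + ε) ^ 2 * X + 1 + ε ^ 2 / (2 * S) * X + S / 2 * (Y + 1) := by
    have h1 : S * Y ≤ S * (1 + ε) ^ 2 * X + (C * (x 0 * y 0) - C * (x N * y N)) +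
        (ε ^ 2 / (2 * S) * X + S / 2 * ∑ t ∈ Finset.range N, y (t + 1) ^ 2) := by
      rw [hY, hX, Finset.mul_sum, Finset.mul_sum, Finset.mul_sum, Finset.mul_sum,
        ← Finset.sum_range_sub' (fun t => C * (x t * y t)), ← Finset.sum_add_distrib,
        ← Finset.sum_add_distrib, ← Finset.sum_add_distrib]
      refine Finset.sum_le_sum fun t _ => ?_
      linarith [hid t, hcross t]
    have h2 := abs_le.1 (hp 0)
    have h3 := abs_le.1 (hp N)
    have h4 := mul_le_mul_of_nonneg_left hY1 (half_pos hS0).le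
    linarith [h2.2, h3.1]
  have hXε : X ≤ 1 / (2 * ε) := by
    rw [le_div_iff₀ (by positivity)]; linarith
  have hYle : Y ≤ 8 * X + 2 / S + (ε / S) ^ 2 * X + 1 := by
    have h1 : (1 + ε) ^ 2 ≤ 4 := by nlinarith
    have h2 : S * (1 + ε) ^ 2 * X ≤ 4 * S * X := by
      have := mul_le_mul_of_nonneg_left h1 (mul_nonneg hS0.le hX0)
      linarith
    have h3 : S / 2 * Y ≤ S / 2 * (8 * X + 2 / S + (ε / S) ^ 2 * X + 1) := by
      have : S / 2 * (8 * X + 2 / S + (ε / S) ^ 2 * X + 1) =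
          4 * S * X + 1 + ε ^ 2 / (2 * S) * X + S / 2 := by
        field_simp
        ring
      linarith
    exact le_of_mul_le_mul_left h3 (half_pos hS0)
  have hεS : ε / S ≤ 1 / σ := by
    rw [div_le_div_iff₀ hS0 hσ]; linarith
  have h1S : 1 / S ≤ 1 / (σ * ε) := one_div_le_one_div_of_le (mul_pos hσ hε) hS
  have htot : ∑ t ∈ Finset.range N, (x t ^ 2 + y t ^ 2) ≤ 1 + X + Y := by
    rw [Finset.sum_add_distrib]
    have h1 := Finset.sum_range_succ' (fun t => x t ^ 2) N
    have h2 := Finset.sum_range_succ (fun t => x t ^ 2) N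
    nlinarith [hn 0, sq_nonneg (x N), sq_nonneg (y 0)]
  have h5 : (ε / S) ^ 2 * X ≤ (1 / σ) ^ 2 * (1 / (2 * ε)) := by gcongr
  have hfin : 1 + 1 / (2 * ε) + (8 * (1 / (2 * ε)) + 2 * (1 / (σ * ε)) +
      (1 / σ) ^ 2 * (1 / (2 * ε)) + 1) ≤ 9 / (σ ^ 2 * ε) := by
    rw [le_div_iff₀ (by positivity)]
    have : (1 + 1 / (2 * ε) + (8 * (1 / (2 * ε)) + 2 * (1 / (σ * ε)) +
      (1 / σ) ^ 2 * (1 / (2 * ε)) + 1)) * (σ ^ 2 * ε) =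
      2 * (σ ^ 2 * ε) + 9 / 2 * σ ^ 2 + 2 * σ + 1 / 2 := by
      field_simp
      ring
    rw [this]
    nlinarith [mul_le_one₀ (pow_le_one₀ hσ.le hσ1 : σ ^ 2 ≤ 1) hε.le hε1,
      (pow_le_one₀ hσ.le hσ1 : σ ^ 2 ≤ 1)]
  have h2S : 2 / S = 2 * (1 / S) := by ring
  rw [h2S] at hYle
  linarith

/-- A rotation that is damped in one direction loses all of the norm in that direction, and the
total norm before is inversely proportional to the damping. -/
theorem damped_rotation_hasSum (hε : 0 < ε) (hε1 : ε ≤ 1) (hSC : C ^ 2 + S ^ 2 = 1)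
    (hσ : 0 < σ) (hσ1 : σ ≤ 1) (hS : σ * ε ≤ |S|)
    (hx : ∀ t, (1 + ε) * x (t + 1) = C * x t - S * y t)
    (hy : ∀ t, y (t + 1) = S * x t + C * y t) (h0 : x 0 ^ 2 + y 0 ^ 2 = 1) :
    (∃ a ≤ 9 / (σ ^ 2 * ε), HasSum (fun t => x t ^ 2 + y t ^ 2) a) ∧
      HasSum (fun t => (2 * ε + ε ^ 2) * x (t + 1) ^ 2) 1 := by
  have hsum : ∀ N, ∑ t ∈ Finset.range N, (x t ^ 2 + y t ^ 2) ≤ 9 / (σ ^ 2 * ε) := by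
    rcases le_total 0 S with h | h
    · rw [abs_of_nonneg h] at hS
      exact damped_rotation_sum_le hε hε1 hSC hσ hσ1 hS hx hy h0
    -- Changing the sign of y changes the sign of S.
    · rw [abs_of_nonpos h] at hS
      intro N
      have := damped_rotation_sum_le (x := x) (y := fun t => -y t) (S := -S) (C := C) hε hε1
        (by rw [neg_sq]; exact hSC) hσ hσ1 hS (fun t => by rw [hx]; ring)
        (fun t => by rw [hy]; ring) (by rw [neg_sq]; exact h0) N
      simpa only [neg_sq] using this
  have hs : Summable fun t => x t ^ 2 + y t ^ 2 :=
    summable_of_sum_range_le (fun t => by positivity) hsum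
  refine ⟨⟨_, hs.tsum_le_of_sum_range_le hsum, hs.hasSum⟩, ?_⟩
  rw [hasSum_iff_tendsto_nat_of_nonneg (fun t => by positivity)]
  have h1 : ∀ N, ∑ t ∈ Finset.range N, (2 * ε + ε ^ 2) * x (t + 1) ^ 2 =
      1 - (x N ^ 2 + y N ^ 2) := by
    intro N
    rw [Finset.sum_congr rfl fun t _ => damped_rotation_norm_sq hε hSC hx hy t,
      Finset.sum_range_sub', h0]
  simp only [h1]
  -- The norm that remains after N steps is summable in N and so tends to zero: everything leaks.
  simpa using hs.tendsto_atTop_zero.const_sub 1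

end DampedRotation

/-! ## The two-phase process -/

section Phases

variable {F : Type*} [NormedAddCommGroup F] [InnerProductSpace ℂ F]

theorem exists_damped_rotation (x₀ y₀ ε S C : ℝ) : ∃ x y : ℕ → ℝ, x 0 = x₀ ∧ y 0 = y₀ ∧
    (∀ t, x (t + 1) = (1 + ε)⁻¹ * (C * x t - S * y t)) ∧ ∀ t, y (t + 1) = S * x t + C * y t := by
  let p : ℕ → ℝ × ℝ := fun t => Nat.rec (x₀, y₀)
    (fun _ p => ((1 + ε)⁻¹ * (C * p.1 - S * p.2), S * p.1 + C * p.2)) t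
  exact ⟨fun t => (p t).1, fun t => (p t).2, rfl, rfl, fun _ => rfl, fun _ => rfl⟩

theorem norm_sq_smul_add_smul_le (s t A B : ℝ) (v w : F) (hv : ‖v‖ ^ 2 ≤ A) (hw : ‖w‖ ^ 2 ≤ B) :
    ‖(s : ℂ) • v + (t : ℂ) • w‖ ^ 2 ≤ 2 * (s ^ 2 * A + t ^ 2 * B) := by
  have h1 : ‖(s : ℂ) • v + (t : ℂ) • w‖ ≤ ‖(s : ℂ) • v‖ + ‖(t : ℂ) • w‖ := norm_add_le _ _
  have h2 : ‖(s : ℂ) • v + (t : ℂ) • w‖ ^ 2 ≤ (‖(s : ℂ) • v‖ + ‖(t : ℂ) • w‖) ^ 2 := by gcongr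
  have h3 : ‖(s : ℂ) • v‖ ^ 2 = s ^ 2 * ‖v‖ ^ 2 := by
    rw [norm_smul, mul_pow, Complex.norm_real, Real.norm_eq_abs, sq_abs]
  have h4 : ‖(t : ℂ) • w‖ ^ 2 = t ^ 2 * ‖w‖ ^ 2 := by
    rw [norm_smul, mul_pow, Complex.norm_real, Real.norm_eq_abs, sq_abs]
  have h5 := mul_le_mul_of_nonneg_left hv (sq_nonneg s)
  have h6 := mul_le_mul_of_nonneg_left hw (sq_nonneg t)
  nlinarith [sq_nonneg (‖(s : ℂ) • v‖ - ‖(t : ℂ) • w‖)]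

theorem exists_hasSum_le {s t : ℕ → ℝ} {T B : ℝ} (hs : ∀ j, 0 ≤ s j) (hst : ∀ j, s j ≤ t j)
    (ht : HasSum t T) (hT : T ≤ B) : ∃ S ≤ B, HasSum s S :=
  ⟨_, (hasSum_le hst (ht.summable.of_nonneg_of_le hs hst).hasSum ht).trans hT,
    (ht.summable.of_nonneg_of_le hs hst).hasSum⟩

/-- The second phase: from the source star state to the flow state. -/
theorem exists_second_phase (Sw Re Wk : F ≃ₗᵢ[ℂ] F) (p q ε σ α β D : ℝ) (hε : 0 < ε) (hε1 : ε ≤ 1)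
    (hσ : 0 < σ) (hσ1 : σ ≤ 1) (hpq : p ^ 2 + q ^ 2 = 1) (hρ : q ^ 2 - p ^ 2 = (1 + ε)⁻¹)
    (hαβ : α ^ 2 + β ^ 2 = 1) (hβ : β ≠ 0) (hS : σ * ε ≤ |2 * α * β|) (hD : 1 ≤ D)
    {e f a b : F} (he : Re e = e) (hdec : e = (α : ℂ) • f + (β : ℂ) • (a + b))
    (hf : Re f = (2 * α : ℂ) • e - f) (hSf : Sw f = -f) (hWf : Wk (Sw f) = -f)
    (ha : Sw a = a) (hb : Wk (Sw b) = b)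
    (nf : ‖f‖ ^ 2 ≤ 1) (na : ‖a‖ ^ 2 ≤ D) (nb : ‖b‖ ^ 2 ≤ D) :
    ∃ (ψ w : ℕ → F) (μ : ℕ → ℂ), ψ 0 = e ∧
      (∀ k, ((p : ℂ) ^ 2) • Re (ψ k) +
        ((q : ℂ) ^ 2) • (1 / 2 : ℂ) • (Sw (Re (ψ k)) + Wk (Sw (Re (ψ k)))) +
        (q : ℂ) • (1 / 2 : ℂ) • (Sw (w k) - Wk (Sw (w k))) = ψ (k + 1)) ∧
      (∀ k, ((p : ℂ) * q) •
        Sw ((1 / 2 : ℂ) • (Sw (Re (ψ k)) + Wk (Sw (Re (ψ k)))) - Re (ψ k)) +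
        (p : ℂ) • Sw ((1 / 2 : ℂ) • (Sw (w k) - Wk (Sw (w k)))) = μ k • f) ∧
      (∀ k, (q : ℂ) • (1 / 2 : ℂ) • (Sw (Re (ψ k)) - Wk (Sw (Re (ψ k)))) +
        (1 / 2 : ℂ) • (Sw (w k) + Wk (Sw (w k))) = w k) ∧
      HasSum (fun k => ‖μ k‖ ^ 2) 1 ∧
      (∃ S ≤ 72 * D / (σ ^ 2 * ε), HasSum (fun k => ‖ψ k‖ ^ 2) S) ∧
      ∃ S ≤ 36 * D / (σ ^ 2 * ε), HasSum (fun k => ‖w k‖ ^ 2) S := by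
  -- Coordinates along f and a + b, starting at e; the reflection about e composed with f ↦ -f has
  -- cosine 1 - 2α² and sine 2αβ.
  obtain ⟨x, y, hx0, hy0, hx, hy⟩ := exists_damped_rotation α β ε (2 * α * β) (1 - 2 * α ^ 2)
  have h1ε : (1 + ε) ≠ 0 := by positivity
  have hx' : ∀ t, (1 + ε) * x (t + 1) = (1 - 2 * α ^ 2) * x t - 2 * α * β * y t := by
    intro t
    rw [hx, mul_inv_cancel_left₀ h1ε]
  obtain ⟨⟨T, hT, hTs⟩, hleak⟩ := damped_rotation_hasSum hε hε1
    (by linear_combination 4 * α ^ 2 * hαβ) hσ hσ1 hS hx' hy (by rw [hx0, hy0, hαβ])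
  have hq1 : q ^ 2 ≤ 1 := by nlinarith [sq_nonneg p]
  have hαβ' : (α : ℂ) ^ 2 + (β : ℂ) ^ 2 = 1 := by exact_mod_cast hαβ
  have hβ' : (β : ℂ) ≠ 0 := by exact_mod_cast hβ
  have hpq' : (p : ℂ) ^ 2 + (q : ℂ) ^ 2 = 1 := by exact_mod_cast hpq
  -- Only the sum a + b is known to stay in the plane under the reflection. Its image follows from
  -- those of e and f because β ≠ 0.
  have hRh : Re (a + b) = (2 * α * β : ℂ) • f + (1 - 2 * α ^ 2 : ℂ) • (a + b) := by
    have h1 : (β : ℂ) • Re (a + b) = e - (α : ℂ) • Re f := by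
      have := he
      rw [hdec, map_add, map_smul, map_smul, ← hdec] at this
      rw [← this]
      module
    apply smul_right_injective F hβ'
    change (β : ℂ) • Re (a + b) = (β : ℂ) • _
    rw [h1, hf, hdec]
    match_scalars
    · linear_combination (-2 * (α : ℂ)) * hαβ'
    all_goals ring
  have hRψ : ∀ k, Re ((x k : ℂ) • f + (y k : ℂ) • (a + b)) =
      ((-((1 + ε) * x (k + 1)) : ℝ) : ℂ) • f + (y (k + 1) : ℂ) • (a + b) := by
    intro k
    rw [map_add, map_smul, map_smul, hRh, hf, hdec, hx', hy]
    push_cast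
    match_scalars <;> ring
  have hxρ : ∀ k, ((q : ℂ) ^ 2 - (p : ℂ) ^ 2) * ((1 + ε) * x (k + 1)) = x (k + 1) := by
    intro k
    have : (q ^ 2 - p ^ 2) * ((1 + ε) * x (k + 1)) = x (k + 1) := by
      rw [hρ, inv_mul_cancel_left₀ h1ε]
    exact_mod_cast this
  -- The inner catalyst belongs to the a + b component after the reflection about e, hence y (k +
  -- 1), and to the branch with coin set, hence the factor q. The leak 2pq is the coin amplitude
  -- produced by the sign -1 on f; the final swap contributes another sign.
  refine ⟨fun k => (x k : ℂ) • f + (y k : ℂ) • (a + b),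
    fun k => ((q * y (k + 1) : ℝ) : ℂ) • (a - b),
    fun k => ((-2 * p * q * ((1 + ε) * x (k + 1)) : ℝ) : ℂ), ?_, ?_, ?_, ?_, ?_, ?_, ?_⟩
  · change (x 0 : ℂ) • f + (y 0 : ℂ) • (a + b) = e
    rw [hx0, hy0, hdec]
  · intro k
    simp only [hRψ, map_add, map_sub, map_smul, hSf, ha, hb]
    have hfW : Wk f = f := by rw [← neg_inj, ← map_neg, ← hSf, hWf, hSf]
    simp only [map_neg, hfW]
    push_cast
    match_scalars
    · linear_combination hxρ k
    · linear_combination (y (k + 1) : ℂ) * hpq'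
    · linear_combination (y (k + 1) : ℂ) * hpq'
    all_goals ring
  · intro k
    have hfW : Wk f = f := by rw [← neg_inj, ← map_neg, ← hSf, hWf, hSf]
    have hin : (q : ℂ) • ((1 / 2 : ℂ) • (Sw (Re ((x k : ℂ) • f + (y k : ℂ) • (a + b))) +
        Wk (Sw (Re ((x k : ℂ) • f + (y k : ℂ) • (a + b))))) -
        Re ((x k : ℂ) • f + (y k : ℂ) • (a + b))) +
        (1 / 2 : ℂ) • (Sw (((q * y (k + 1) : ℝ) : ℂ) • (a - b)) -
          Wk (Sw (((q * y (k + 1) : ℝ) : ℂ) • (a - b)))) =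
        (2 * q * ((1 + ε) * x (k + 1)) : ℂ) • f := by
      simp only [hRψ, map_add, map_sub, map_smul, hSf, ha, hb, map_neg, hfW]
      push_cast
      match_scalars <;> ring
    trans (p : ℂ) • Sw ((2 * q * ((1 + ε) * x (k + 1)) : ℂ) • f)
    · rw [← hin]
      simp only [map_add, map_sub, map_smul]
      module
    · rw [map_smul, hSf]
      push_cast
      module
  · intro k
    have hfW : Wk f = f := by rw [← neg_inj, ← map_neg, ← hSf, hWf, hSf]
    simp only [hRψ, map_add, map_sub, map_smul, hSf, ha, hb, map_neg, hfW]
    push_cast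
    match_scalars <;> ring
  · convert hleak using 2 with k
    rw [Complex.norm_real, Real.norm_eq_abs, sq_abs]
    -- From (q² - p²)² + 4p²q² = 1: the leak accounts exactly for the norm lost by the damping.
    have h4 : 4 * p ^ 2 * q ^ 2 * (1 + ε) ^ 2 = 2 * ε + ε ^ 2 := by
      have e1 : 4 * p ^ 2 * q ^ 2 = 1 - ((1 + ε)⁻¹) ^ 2 := by
        rw [← hρ]
        linear_combination (p ^ 2 + q ^ 2 + 1) * hpq
      rw [e1]
      field_simp
      ring
    linear_combination x (k + 1) ^ 2 * h4
  · have nh : ‖a + b‖ ^ 2 ≤ 4 * D := by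
      have := norm_sq_smul_add_smul_le 1 1 D D a b na nb
      simp only [Complex.ofReal_one, one_smul] at this
      linarith
    refine exists_hasSum_le (fun k => sq_nonneg _) (fun k => ?_) (hTs.mul_left (8 * D)) ?_
    · refine (norm_sq_smul_add_smul_le _ _ 1 (4 * D) f (a + b) nf nh).trans ?_
      nlinarith [sq_nonneg (x k), sq_nonneg (y k)]
    · have h1 := mul_le_mul_of_nonneg_left hT (show 0 ≤ 8 * D by linarith)
      have h2 : 8 * D * (9 / (σ ^ 2 * ε)) = 72 * D / (σ ^ 2 * ε) := by ring
      linarith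
  · have nh : ‖a - b‖ ^ 2 ≤ 4 * D := by
      have := norm_sq_smul_add_smul_le 1 (-1) D D a b na nb
      simp only [Complex.ofReal_one, one_smul, Complex.ofReal_neg, neg_smul, ← sub_eq_add_neg] at this
      linarith
    have hT1 : HasSum (fun k => x (k + 1) ^ 2 + y (k + 1) ^ 2) (T - 1) := by
      have := (hasSum_nat_add_iff' (f := fun t => x t ^ 2 + y t ^ 2) 1).2 hTs
      simpa [hx0, hy0, hαβ] using this
    refine exists_hasSum_le (fun k => sq_nonneg _) (fun k => ?_) (hT1.mul_left (4 * D)) ?_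
    · rw [norm_smul, mul_pow, Complex.norm_real, Real.norm_eq_abs, sq_abs, mul_pow]
      have h1 : q ^ 2 * y (k + 1) ^ 2 ≤ x (k + 1) ^ 2 + y (k + 1) ^ 2 := by
        nlinarith [sq_nonneg (x (k + 1)), mul_le_of_le_one_left (sq_nonneg (y (k + 1))) hq1]
      have := mul_le_mul h1 nh (sq_nonneg _) (by positivity)
      linarith
    · have h1 := mul_le_mul_of_nonneg_left hT (show 0 ≤ 4 * D by linarith)
      have h2 : 4 * D * (9 / (σ ^ 2 * ε)) = 36 * D / (σ ^ 2 * ε) := by ring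
      nlinarith

/-- The first phase: from the star state of the original source to that of the new source. -/
theorem exists_first_phase (Sw Re Wk : F ≃ₗᵢ[ℂ] F) (p q ε σ c s : ℝ) (hε : 0 < ε) (hε1 : ε ≤ 1)
    (hσ : 0 < σ) (hσ1 : σ ≤ 1) (hpq : p ^ 2 + q ^ 2 = 1) (hρ : q ^ 2 - p ^ 2 = (1 + ε)⁻¹)
    (hcs : c ^ 2 + s ^ 2 = 1) (hS : σ * ε ≤ |s|) {e z φ : F} (he : Re e = e) (hSe : Sw e = z)
    (hSz : Sw z = e) (hRz : Re z = -z) (hRφ : Re φ = -φ) (hSφ : Sw (Sw φ) = φ)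
    (hRSφ : Re (Sw φ) = -Sw φ)
    (hWz : Wk (Sw z) = (c : ℂ) • z + (s : ℂ) • φ) (hWφ : Wk (Sw φ) = (s : ℂ) • z - (c : ℂ) • φ)
    (nz : ‖z‖ ^ 2 ≤ 1) (nφ : ‖φ‖ ^ 2 ≤ 1) :
    ∃ (A : ℕ → F) (γ : ℕ → ℂ), A 0 = φ ∧ γ 0 = 0 ∧ (∀ j, Re (A j) = -A j) ∧
      (∀ j, Sw (-((p : ℂ) ^ 2) • Sw (Wk (Sw (A j))) +
        ((q : ℂ) ^ 2) • Re (Sw (Wk (Sw (A j))))) = A (j + 1)) ∧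
      (∀ j, ((p : ℂ) * q) • (Sw (Wk (Sw (A j))) + Re (Sw (Wk (Sw (A j))))) = γ (j + 1) • e) ∧
      HasSum (fun j => ‖γ j‖ ^ 2) 1 ∧
      ∃ S ≤ 18 / (σ ^ 2 * ε), HasSum (fun j => ‖A j‖ ^ 2) S := by
  -- Coordinates along z and φ, starting at φ. The reflection with sine s becomes a rotation with
  -- sine -s after the sign changes.
  obtain ⟨x, y, hx0, hy0, hx, hy⟩ := exists_damped_rotation 0 1 ε (-s) c
  have h1ε : (1 + ε) ≠ 0 := by positivity
  have hx' : ∀ t, (1 + ε) * x (t + 1) = c * x t - -s * y t := by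
    intro t
    rw [hx, mul_inv_cancel_left₀ h1ε]
  obtain ⟨⟨T, hT, hTs⟩, hleak⟩ := damped_rotation_hasSum hε hε1
    (by rw [neg_sq, hcs]) hσ hσ1 (by rwa [abs_neg]) hx' hy (by rw [hx0, hy0]; norm_num)
  have hpq' : (p : ℂ) ^ 2 + (q : ℂ) ^ 2 = 1 := by exact_mod_cast hpq
  have hxρ : ∀ k, ((q : ℂ) ^ 2 - (p : ℂ) ^ 2) * ((1 + ε) * x (k + 1)) = x (k + 1) := by
    intro k
    have : (q ^ 2 - p ^ 2) * ((1 + ε) * x (k + 1)) = x (k + 1) := by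
      rw [hρ, inv_mul_cancel_left₀ h1ε]
    exact_mod_cast this
  have hχ : ∀ j, Sw (Wk (Sw ((x j : ℂ) • z + (y j : ℂ) • φ))) =
      ((1 + ε) * x (j + 1) : ℂ) • e - (y (j + 1) : ℂ) • Sw φ := by
    intro j
    have h1 : ((1 + ε) * x (j + 1) : ℂ) = c * x j + s * y j := by
      have := hx' j
      rw [show c * x j - -s * y j = c * x j + s * y j by ring] at this
      exact_mod_cast this
    have hWe : Wk e = (c : ℂ) • z + (s : ℂ) • φ := by rw [← hSz, hWz]
    rw [h1, hy]
    simp only [map_add, map_smul, hWe, hWφ, map_sub, hSz]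
    push_cast
    match_scalars <;> ring
  -- γ (j + 1) is the leak of step j, and nothing has leaked before, so γ 0 = 0.
  refine ⟨fun j => (x j : ℂ) • z + (y j : ℂ) • φ,
    fun j => if j = 0 then 0 else ((2 * p * q * ((1 + ε) * x j) : ℝ) : ℂ), ?_, rfl, ?_, ?_, ?_, ?_, ?_⟩
  · simp [hx0, hy0]
  · intro j
    simp only [map_add, map_smul, hRz, hRφ]
    module
  · intro j
    simp only [hχ]
    simp only [map_add, map_sub, map_smul, he, hRSφ, map_neg, hSφ, hSe]
    match_scalars
    · linear_combination hxρ j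
    · linear_combination (y (j + 1) : ℂ) * hpq'
  · intro j
    simp only [hχ]
    simp only [map_sub, map_smul, he, hRSφ, Nat.add_eq_zero_iff, one_ne_zero, and_false, if_false]
    push_cast
    match_scalars <;> ring
  · have h4 : 4 * p ^ 2 * q ^ 2 * (1 + ε) ^ 2 = 2 * ε + ε ^ 2 := by
      have e1 : 4 * p ^ 2 * q ^ 2 = 1 - ((1 + ε)⁻¹) ^ 2 := by
        rw [← hρ]
        linear_combination (p ^ 2 + q ^ 2 + 1) * hpq
      rw [e1]
      field_simp
      ring
    have h5 : HasSum (fun j => ‖(if j + 1 = 0 then 0 else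
        ((2 * p * q * ((1 + ε) * x (j + 1)) : ℝ) : ℂ))‖ ^ 2) 1 := by
      convert hleak using 2 with k
      rw [if_neg (Nat.succ_ne_zero k), Complex.norm_real, Real.norm_eq_abs, sq_abs]
      linear_combination x (k + 1) ^ 2 * h4
    simpa using (hasSum_nat_add_iff (f := fun j => ‖(if j = 0 then 0 else
        ((2 * p * q * ((1 + ε) * x j) : ℝ) : ℂ))‖ ^ 2) 1).1 h5
  · refine exists_hasSum_le (fun k => sq_nonneg _) (fun k => ?_) (hTs.mul_left 2) ?_
    · refine (norm_sq_smul_add_smul_le _ _ 1 1 z φ nz nφ).trans ?_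
      linarith
    · have h2 : 2 * (9 / (σ ^ 2 * ε)) = 18 / (σ ^ 2 * ε) := by ring
      linarith

end Phases

/-! ### Both phases combined -/

section Geometry

variable {F : Type*} [NormedAddCommGroup F] [InnerProductSpace ℂ F]

/-- The circuit transduces both star states into the flow state, for operators that act on the
relevant vectors as the walk operators do. -/
theorem exists_transduces_of_geometry (Sw Re Wk : F ≃ₗᵢ[ℂ] F) (p q ε σ α β D c s : ℝ)
    (hε : 0 < ε) (hε1 : ε ≤ 1)
    (hσ : 0 < σ) (hσ1 : σ ≤ 1) (hpq : p ^ 2 + q ^ 2 = 1) (hpq' : p ^ 2 + (-q) ^ 2 = 1)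
    (hρ : q ^ 2 - p ^ 2 = (1 + ε)⁻¹)
    (hαβ : α ^ 2 + β ^ 2 = 1) (hβ : β ≠ 0) (hS : σ * ε ≤ |2 * α * β|) (hD : 1 ≤ D)
    (hcs : c ^ 2 + s ^ 2 = 1) (hs : σ * ε ≤ |s|)
    {e f a b z φ : F} (he : Re e = e) (hdec : e = (α : ℂ) • f + (β : ℂ) • (a + b))
    (hf : Re f = (2 * α : ℂ) • e - f) (hSf : Sw f = -f) (hWf : Wk (Sw f) = -f)
    (ha : Sw a = a) (hb : Wk (Sw b) = b)
    (nf : ‖f‖ ^ 2 ≤ 1) (na : ‖a‖ ^ 2 ≤ D) (nb : ‖b‖ ^ 2 ≤ D)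
    (hSe : Sw e = z) (hSz : Sw z = e) (hRz : Re z = -z) (hRφ : Re φ = -φ)
    (hSφ : Sw (Sw φ) = φ) (hRSφ : Re (Sw φ) = -Sw φ)
    (hWz : Wk (Sw z) = (c : ℂ) • z + (s : ℂ) • φ) (hWφ : Wk (Sw φ) = (s : ℂ) • z - (c : ℂ) • φ)
    (nz : ‖z‖ ^ 2 ≤ 1) (nφ : ‖φ‖ ^ 2 ≤ 1) (P : F) (hP : P = φ ∨ P = e) :
    ∃ (Γ : lp (fun _ : Mem 5 2 => ℂ) 2) (v : Joint F 5 2), ‖Γ‖ = 1 ∧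
      Transduces (circuitEval Sw Re Wk (elfCircuit p q hpq hpq')) (publicSpace F 5 2)
        (tensor P (memZero 5 2)) (tensor f Γ) v ∧
      ‖v‖ ^ 2 ≤ 648 * D / (σ ^ 2 * ε) := by
  obtain ⟨ψ, w, μ, hψ, stay₂, leak₂, fix, hμ, ⟨Sψ, hSψ, hψs⟩, S', hS', hws⟩ :=
    exists_second_phase Sw Re Wk p q ε σ α β D hε hε1 hσ hσ1 hpq hρ hαβ hβ hS hD he hdec hf hSf
      hWf ha hb nf na nb
  -- For 4 (18 + 72 D + 2 · 36 D) ≤ 648 D one needs 1 ≤ D.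
  have h0 : 0 ≤ 18 * (D - 1) / (σ ^ 2 * ε) := by
    apply div_nonneg
    · linarith
    · positivity
  have h1 : 4 * (18 / (σ ^ 2 * ε) + 72 * D / (σ ^ 2 * ε) + 2 * (36 * D / (σ ^ 2 * ε))) +
      4 * (18 * (D - 1) / (σ ^ 2 * ε)) = 648 * D / (σ ^ 2 * ε) := by ring
  rcases hP with rfl | rfl
  · obtain ⟨A, γ, hA0, hγ0, hA, stay₁, leak₁, hγ, SA, hSA, hAs⟩ :=
      exists_first_phase Sw Re Wk p q ε σ c s hε hε1 hσ hσ1 hpq hρ hcs hs he hSe hSz hRz hRφ hSφ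
        hRSφ hWz hWφ nz nφ
    obtain ⟨Γ, v, hΓ, ht, hv⟩ := exists_transduces_elfCircuit Sw Re Wk p q hpq hpq' e f A ψ w γ μ
      hA he hψ stay₁ leak₁ stay₂ leak₂ fix hγ hμ hAs hψs hws
    rw [hA0, hγ0, zero_smul, zero_add] at ht
    exact ⟨Γ, v, hΓ, ht, by linarith⟩
  -- The input e skips phase one: A = 0, and γ is concentrated at time 0.
  · obtain ⟨Γ, v, hΓ, ht, hv⟩ := exists_transduces_elfCircuit Sw Re Wk p q hpq hpq' P f
      (fun _ => 0) ψ w (fun j => if j = 0 then 1 else 0) μ (by simp) he hψ (by simp) (by simp)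
      stay₂ leak₂ fix (SA := 0) (by
        have := hasSum_ite_eq (0 : ℕ) (1 : ℝ)
        convert this using 2 with j
        split_ifs <;> simp) hμ (by simpa using hasSum_zero) hψs hws
    simp only [if_true, one_smul, add_zero] at ht
    have h2 : 0 ≤ 18 / (σ ^ 2 * ε) := by positivity
    exact ⟨Γ, v, hΓ, ht, by linarith⟩

end Geometry

/-! ## Hitting probabilities and the escape time -/

namespace Network

open Filter Topology

variable {V : Type u} [Fintype V]

/-- The transition probability of the random walk. -/
def trans (N : Network V) (x y : V) : ℝ := N.w x y / N.deg x

theorem deg_nonneg (N : Network V) (x : V) : 0 ≤ N.deg x :=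
  Finset.sum_nonneg fun y _ => N.nonneg x y

theorem w_le_deg (N : Network V) (x y : V) : N.w x y ≤ N.deg x :=
  Finset.single_le_sum (f := fun y => N.w x y) (fun y _ => N.nonneg x y) (Finset.mem_univ y)

theorem trans_nonneg (N : Network V) (x y : V) : 0 ≤ N.trans x y :=
  div_nonneg (N.nonneg x y) (N.deg_nonneg x)

theorem deg_mul_trans (N : Network V) (x y : V) : N.deg x * N.trans x y = N.w x y := by
  rcases (N.deg_nonneg x).eq_or_lt with h | h
  · have := N.w_le_deg x y
    rw [← h] at this ⊢
    rw [zero_mul, le_antisymm this (N.nonneg x y)]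
  · rw [trans, mul_div_cancel₀ _ h.ne']

theorem sum_trans (N : Network V) {x : V} (h : 0 < N.deg x) : ∑ y, N.trans x y = 1 := by
  simp only [trans]
  rw [← Finset.sum_div]
  exact div_self h.ne'

theorem sum_trans_le_one (N : Network V) (x : V) : ∑ y, N.trans x y ≤ 1 := by
  rcases (N.deg_nonneg x).eq_or_lt with h | h
  · simp [trans, ← h]
  · exact (N.sum_trans h).le

theorem trans_pos (N : Network V) {x y : V} (h : 0 < N.w x y) : 0 < N.trans x y :=
  div_pos h (h.trans_le (N.w_le_deg x y))

variable [DecidableEq V]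

/-- The probability to visit `s` within `n` steps, before `M`. -/
def hitProb (N : Network V) (s : V) (M : Finset V) : ℕ → V → ℝ
  | 0, x => if x = s then 1 else 0
  | n + 1, x => if x = s then 1 else if x ∈ M then 0 else ∑ y, N.trans x y * hitProb N s M n y

/-- The expected value of one plus the last time up to `n` at which the walk visits `s`
before `M`. -/
def exitTime (N : Network V) (s : V) (M : Finset V) : ℕ → V → ℝ
  | 0, x => if x = s then 1 else 0
  | n + 1, x => if x ∈ M then 0 else
      N.hitProb s M (n + 1) x + ∑ y, N.trans x y * exitTime N s M n y

section Hitting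

variable (N : Network V) {s : V} {M : Finset V}

theorem hitProb_source (n : ℕ) : N.hitProb s M n s = 1 := by
  cases n <;> simp [hitProb]

theorem hitProb_of_mem (hs : s ∉ M) {x : V} (hx : x ∈ M) (n : ℕ) : N.hitProb s M n x = 0 := by
  have : x ≠ s := fun h => hs (h ▸ hx)
  cases n <;> simp [hitProb, this, hx]

theorem hitProb_nonneg (n : ℕ) (x : V) : 0 ≤ N.hitProb s M n x := by
  induction n generalizing x with
  | zero => simp only [hitProb]; split_ifs <;> norm_num
  | succ n ih =>
    simp only [hitProb]
    split_ifs
    · norm_num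
    · exact le_rfl
    · exact Finset.sum_nonneg fun y _ => mul_nonneg (N.trans_nonneg x y) (ih y)

theorem hitProb_le_one (n : ℕ) (x : V) : N.hitProb s M n x ≤ 1 := by
  induction n generalizing x with
  | zero => simp only [hitProb]; split_ifs <;> norm_num
  | succ n ih =>
    simp only [hitProb]
    split_ifs
    · exact le_rfl
    · norm_num
    · exact (Finset.sum_le_sum fun y _ => mul_le_of_le_one_right (N.trans_nonneg x y) (ih y)).trans
        (N.sum_trans_le_one x)

theorem hitProb_mono (x : V) : Monotone fun n => N.hitProb s M n x := by
  refine monotone_nat_of_le_succ fun n => ?_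
  induction n generalizing x with
  | zero =>
    have := N.hitProb_nonneg (s := s) (M := M) 1 x
    by_cases h : x = s
    · simp [hitProb, h]
    · simpa [hitProb, h] using this
  | succ n ih =>
    simp only [hitProb]
    split_ifs
    · exact le_rfl
    · exact le_rfl
    · refine Finset.sum_le_sum fun y _ => mul_le_mul_of_nonneg_left ?_ (N.trans_nonneg x y)
      exact ih y

theorem exitTime_nonneg (n : ℕ) (x : V) : 0 ≤ N.exitTime s M n x := by
  induction n generalizing x with
  | zero => simp only [exitTime]; split_ifs <;> norm_num
  | succ n ih =>
    simp only [exitTime]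
    split_ifs
    · exact le_rfl
    · exact add_nonneg (N.hitProb_nonneg _ _)
        (Finset.sum_nonneg fun y _ => mul_nonneg (N.trans_nonneg x y) (ih y))

theorem exitTime_of_mem (hs : s ∉ M) {x : V} (hx : x ∈ M) (n : ℕ) : N.exitTime s M n x = 0 := by
  have : x ≠ s := fun h => hs (h ▸ hx)
  cases n <;> simp [exitTime, this, hx]

/-- The exit times are bounded at every vertex that can reach `s`, once they are at `s`. -/
theorem exitTime_bounded (hs : s ∉ M) {B : ℝ} (hB : ∀ n, N.exitTime s M n s ≤ B) (m : ℕ) (x : V)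
    (hx : 0 < N.hitProb s M m x) : ∃ K, ∀ n, N.exitTime s M n x ≤ K := by
  induction m generalizing x with
  | zero =>
    by_cases h : x = s
    · exact ⟨B, h ▸ hB⟩
    · simp [hitProb, h] at hx
  | succ m ih =>
    by_cases h : x = s
    · exact ⟨B, h ▸ hB⟩
    by_cases hxM : x ∈ M
    · rw [N.hitProb_of_mem hs hxM] at hx
      exact absurd hx (lt_irrefl _)
    simp only [hitProb, h, hxM, if_false] at hx
    obtain ⟨y, -, hy⟩ := Finset.exists_lt_of_sum_lt
      (show ∑ y : V, (0 : ℝ) < ∑ y, N.trans x y * N.hitProb s M m y by simpa using hx)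
    have hy1 : 0 < N.hitProb s M m y := by
      refine lt_of_le_of_ne (N.hitProb_nonneg m y) fun h0 => ?_
      rw [← h0, mul_zero] at hy
      exact lt_irrefl _ hy
    have hw : 0 < N.w x y := by
      refine lt_of_le_of_ne (N.nonneg x y) fun h0 => ?_
      rw [trans, ← h0, zero_div, zero_mul] at hy
      exact lt_irrefl _ hy
    -- The walk to s goes from x to y, but the exit time at x is bounded through a step from y to x;
    -- this works because edges are undirected.
    rw [N.symm] at hw
    have hyM : y ∉ M := fun h => by
      rw [N.hitProb_of_mem hs h] at hy1
      exact lt_irrefl _ hy1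
    obtain ⟨K, hK⟩ := ih y hy1
    refine ⟨K / N.trans y x, fun n => ?_⟩
    rw [le_div_iff₀ (N.trans_pos hw), mul_comm]
    refine le_trans ?_ (hK (n + 1))
    simp only [exitTime, hyM, if_false]
    have h1 := Finset.single_le_sum (f := fun z => N.trans y z * N.exitTime s M n z)
      (fun z _ => mul_nonneg (N.trans_nonneg y z) (N.exitTime_nonneg n z)) (Finset.mem_univ x)
    have h2 := N.hitProb_nonneg (s := s) (M := M) (n + 1) y
    linarith

end Hitting

/-- The potential of the unit electric flow from `s` to `M`. -/
structure IsPotential (N : Network V) (s : V) (M : Finset V) (v : V → ℝ) : Prop where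
  source : ∑ y, N.w s y * (v s - v y) = 1
  harmonic : ∀ x, x ≠ s → x ∉ M → ∑ y, N.w x y * (v x - v y) = 0
  sink : ∀ x ∈ M, v x = 0

theorem sum_w_sub_eq (N : Network V) (v : V → ℝ) (x : V) :
    ∑ y, N.w x y * (v x - v y) = N.deg x * v x - ∑ y, N.w x y * v y := by
  simp only [mul_sub, Finset.sum_sub_distrib, deg, Finset.sum_mul]

/-- The probability h to hit s before M is harmonic off s and M, as a limit of truncated
probabilities; dividing it by its outflow c at s yields a unit flow. -/
theorem exists_isPotential (N : Network V) {s : V} {M : Finset V} (hs : s ∉ M)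
    (hr : N.Reaches s M) : ∃ (v : V → ℝ), N.IsPotential s M v ∧ (∀ x, 0 ≤ v x) ∧ 0 < v s ∧
      ∀ x, Tendsto (fun n => v s * N.hitProb s M n x) atTop (𝓝 (v x)) := by
  set h : V → ℝ := fun x => ⨆ n, N.hitProb s M n x with hh
  have hbdd : ∀ x, BddAbove (Set.range fun n => N.hitProb s M n x) := fun x =>
    ⟨1, by rintro _ ⟨n, rfl⟩; exact N.hitProb_le_one n x⟩
  have ht : ∀ x, Tendsto (fun n => N.hitProb s M n x) atTop (𝓝 (h x)) := fun x =>
    tendsto_atTop_ciSup (N.hitProb_mono x) (hbdd x)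
  have h0 : ∀ x, 0 ≤ h x := fun x => ge_of_tendsto' (ht x) fun n => N.hitProb_nonneg n x
  have h1 : ∀ x, h x ≤ 1 := fun x => le_of_tendsto' (ht x) fun n => N.hitProb_le_one n x
  have hsrc : h s = 1 := by simp [hh, hitProb_source]
  have hM : ∀ x ∈ M, h x = 0 := fun x hx => by simp [hh, N.hitProb_of_mem hs hx]
  have hharm : ∀ x, x ≠ s → x ∉ M → h x = ∑ y, N.trans x y * h y := by
    intro x hxs hxM
    refine tendsto_nhds_unique ((tendsto_add_atTop_iff_nat 1).2 (ht x)) ?_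
    simp only [hitProb, hxs, hxM, if_false]
    exact tendsto_finsetSum _ fun y _ => (ht y).const_mul _
  have hdiv : ∀ x, x ≠ s → x ∉ M → ∑ y, N.w x y * (h x - h y) = 0 := by
    intro x hxs hxM
    rw [sum_w_sub_eq, hharm x hxs hxM, Finset.mul_sum]
    simp only [← mul_assoc, deg_mul_trans, sub_self]
  have hc0 : ∀ x, h x = 1 → ∀ y, 0 ≤ N.w x y * (h x - h y) := fun x hx y =>
    mul_nonneg (N.nonneg x y) (by rw [hx]; linarith [h1 y])
  have hc : 0 < ∑ y, N.w s y * (h s - h y) := by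
    -- Maximum principle: without outflow the maximum h = 1 would propagate along the path from s
    -- into M, where h = 0.
    refine lt_of_le_of_ne (Finset.sum_nonneg fun y _ => hc0 s hsrc y) fun hz => ?_
    obtain ⟨m, hm, hsm⟩ := hr
    have : h m = 1 := by
      clear hm
      induction hsm with
      | refl => exact hsrc
      | @tail x y _ hxy ih =>
        have hzero : ∑ y, N.w x y * (h x - h y) = 0 := by
          by_cases hxs : x = s
          · rw [hxs]; exact hz.symm
          · refine hdiv x hxs fun hxM => ?_
            rw [hM x hxM] at ih
            exact zero_ne_one ih
        have := (Finset.sum_eq_zero_iff_of_nonneg fun y _ => hc0 x ih y).1 hzero y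
          (Finset.mem_univ y)
        rcases mul_eq_zero.1 this with h2 | h2
        · exact absurd h2 hxy.ne'
        · linarith
    rw [hM m hm] at this
    exact zero_ne_one this
  set c := ∑ y, N.w s y * (h s - h y) with hcdef
  have hscale : ∀ x, ∑ y, N.w x y * (c⁻¹ * h x - c⁻¹ * h y) =
      c⁻¹ * ∑ y, N.w x y * (h x - h y) := by
    intro x
    rw [Finset.mul_sum]
    exact Finset.sum_congr rfl fun y _ => by ring
  refine ⟨fun x => c⁻¹ * h x, ⟨?_, ?_, ?_⟩, fun x => mul_nonneg (inv_nonneg.2 hc.le) (h0 x), ?_, ?_⟩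
  · rw [hscale]
    exact inv_mul_cancel₀ hc.ne'
  · intro x hxs hxM
    rw [hscale, hdiv x hxs hxM, mul_zero]
  · intro x hx
    simp only [hM x hx, mul_zero]
  · simp only [hsrc, mul_one]
    exact inv_pos.2 hc
  · intro x
    simp only [hsrc, mul_one]
    exact (ht x).const_mul _

/-- Weight the recursion of the exit times by d_x v_x and sum. Reversibility moves the transition
step onto v, which is harmonic except for a unit source at s. -/
theorem IsPotential.sum_hitProb (N : Network V) {s : V} {M : Finset V} {v : V → ℝ}
    (hv : N.IsPotential s M v) (hs : s ∉ M) (m : ℕ) :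
    ∑ x, N.deg x * v x * N.hitProb s M (m + 1) x =
      (∑ x, N.deg x * v x * N.exitTime s M (m + 1) x - ∑ x, N.deg x * v x * N.exitTime s M m x) +
        N.exitTime s M m s := by
  have e1 : ∀ x, N.deg x * v x * N.hitProb s M (m + 1) x =
      N.deg x * v x * N.exitTime s M (m + 1) x -
        ∑ y, N.w x y * v x * N.exitTime s M m y := by
    intro x
    by_cases hx : x ∈ M
    · simp [hv.sink x hx]
    · have : N.exitTime s M (m + 1) x = N.hitProb s M (m + 1) x +
          ∑ y, N.trans x y * N.exitTime s M m y := by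
        simp only [exitTime, hx, if_false]
      rw [this, mul_add, Finset.mul_sum, add_sub_assoc, left_eq_add, sub_eq_zero]
      refine Finset.sum_congr rfl fun y _ => ?_
      rw [← N.deg_mul_trans x y]
      ring
  have e2 : ∑ x, ∑ y, N.w x y * v x * N.exitTime s M m y =
      ∑ y, N.deg y * v y * N.exitTime s M m y - N.exitTime s M m s := by
    rw [Finset.sum_comm, eq_sub_iff_add_eq]
    have e3 : ∀ y, ∑ x, N.w x y * v x * N.exitTime s M m y =
        N.deg y * v y * N.exitTime s M m y - (if y = s then N.exitTime s M m s else 0) := by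
      intro y
      have e4 : ∑ x, N.w x y * v x * N.exitTime s M m y =
          (N.deg y * v y - ∑ x, N.w y x * (v y - v x)) * N.exitTime s M m y := by
        rw [sum_w_sub_eq, sub_sub_cancel, Finset.sum_mul]
        exact Finset.sum_congr rfl fun x _ => by rw [N.symm]
      rw [e4]
      by_cases hy : y = s
      · subst hy
        rw [hv.source, if_pos rfl]
        ring
      · by_cases hyM : y ∈ M
        · rw [N.exitTime_of_mem hs hyM]
          simp [hy]
        · rw [hv.harmonic y hy hyM, if_neg hy]
          ring
    rw [Finset.sum_congr rfl fun y _ => e3 y, Finset.sum_sub_distrib]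
    simp
  rw [Finset.sum_congr rfl fun x _ => e1 x, Finset.sum_sub_distrib, e2]
  ring

/-- If the exit times from `s` are bounded by `B`, so is the mean square of the potential. -/
theorem exists_isPotential_sum_le (N : Network V) {s : V} {M : Finset V} (hs : s ∉ M)
    (hr : N.Reaches s M) {B : ℝ} (hB : ∀ n, N.exitTime s M n s ≤ B) :
    ∃ v : V → ℝ, N.IsPotential s M v ∧ 0 < v s ∧
      ∑ x, N.deg x * v x ^ 2 ≤ v s * B ∧ 1 ≤ v s * N.deg s := by
  obtain ⟨v, hv, hv0, hvs, hlim⟩ := N.exists_isPotential hs hr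
  refine ⟨v, hv, hvs, ?_, ?_⟩
  · have hK : ∀ x, ∃ K, ∀ n, N.deg x * v x * N.exitTime s M n x ≤ K := by
      intro x
      by_cases hx : ∃ m, 0 < N.hitProb s M m x
      · obtain ⟨m, hm⟩ := hx
        obtain ⟨K, hK⟩ := N.exitTime_bounded hs hB m x hm
        exact ⟨N.deg x * v x * K, fun n =>
          mul_le_mul_of_nonneg_left (hK n) (mul_nonneg (N.deg_nonneg x) (hv0 x))⟩
      · push Not at hx
        have : v x = 0 := by
          refine tendsto_nhds_unique (hlim x) ?_
          have : ∀ n, N.hitProb s M n x = 0 := fun n => le_antisymm (hx n) (N.hitProb_nonneg n x)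
          simp [this]
        exact ⟨0, fun n => by simp [this]⟩
    choose K hK using hK
    have hG : ∀ n, ∑ x, N.deg x * v x * N.exitTime s M n x ≤ ∑ x, K x := fun n =>
      Finset.sum_le_sum fun x _ => hK x n
    have hG0 : ∀ n, 0 ≤ ∑ x, N.deg x * v x * N.exitTime s M n x := fun n =>
      Finset.sum_nonneg fun x _ => mul_nonneg (mul_nonneg (N.deg_nonneg x) (hv0 x))
        (N.exitTime_nonneg n x)
    -- If the sum exceeded B for one j, it would do so for all later ones by monotonicity. The
    -- identity would then make the weighted exit times grow linearly, but they are bounded vertex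
    -- by vertex.
    have hj : ∀ j, ∑ x, N.deg x * v x * N.hitProb s M j x ≤ B := by
      intro j
      by_contra! hlt
      set H := ∑ x, N.deg x * v x * N.hitProb s M j x with hH
      have hstep : ∀ n : ℕ, n * H ≤ (∑ x, N.deg x * v x * N.exitTime s M (j + n) x -
          ∑ x, N.deg x * v x * N.exitTime s M j x) + n * B := by
        intro n
        induction n with
        | zero => simp
        | succ n ih =>
          have h1 := hv.sum_hitProb N hs (j + n)
          have h2 : H ≤ ∑ x, N.deg x * v x * N.hitProb s M (j + n + 1) x :=
            Finset.sum_le_sum fun x _ => mul_le_mul_of_nonneg_left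
              (N.hitProb_mono x (by omega)) (mul_nonneg (N.deg_nonneg x) (hv0 x))
          have h3 := hB (j + n)
          push_cast
          rw [← add_assoc]
          linarith
      obtain ⟨n, hn⟩ := exists_nat_gt ((∑ x, K x) / (H - B))
      rw [div_lt_iff₀ (by linarith)] at hn
      have := hstep n
      linarith [hG (j + n), hG0 j]
    have hlim2 : Tendsto (fun n => v s * ∑ x, N.deg x * v x * N.hitProb s M n x) atTop
        (𝓝 (∑ x, N.deg x * v x ^ 2)) := by
      have h1 : ∀ n, v s * ∑ x, N.deg x * v x * N.hitProb s M n x =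
          ∑ x, N.deg x * v x * (v s * N.hitProb s M n x) := by
        intro n
        rw [Finset.mul_sum]
        exact Finset.sum_congr rfl fun x _ => by ring
      have h2 : ∑ x, N.deg x * v x ^ 2 = ∑ x, N.deg x * v x * v x :=
        Finset.sum_congr rfl fun x _ => by ring
      simp only [h1]
      rw [h2]
      exact tendsto_finsetSum _ fun x _ => (hlim x).const_mul _
    exact le_of_tendsto' hlim2 fun n => mul_le_mul_of_nonneg_left (hj n) hvs.le
  · have h1 := hv.source
    rw [sum_w_sub_eq] at h1
    have h2 : 0 ≤ ∑ y, N.w s y * v y :=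
      Finset.sum_nonneg fun y _ => mul_nonneg (N.nonneg s y) (hv0 y)
    linarith

end Network

/-! ## The escape time of the random walk -/

section LastVisit

variable {V : Type u} [DecidableEq V]

/-- One plus the last time `t ≤ n` at which the trajectory `x`, started at time `k`, visits `s`
before `M`. -/
def lastVisit (s : V) (M : Finset V) (x : ℕ → V) : ℕ → ℕ → ℕ
  | 0, k => if x k = s then 1 else 0
  | n + 1, k => if x k ∈ M then 0 else if lastVisit s M x n (k + 1) = 0 then
      if x k = s then 1 else 0 else lastVisit s M x n (k + 1) + 1

theorem lastVisit_spec {s : V} {M : Finset V} (hs : s ∉ M) (x : ℕ → V) (n : ℕ) :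
    ∀ k m, lastVisit s M x n k = m + 1 → x (k + m) = s ∧ ∀ i ≤ m, x (k + i) ∉ M := by
  have h0 : ∀ k m, x k = s → 1 = m + 1 → x (k + m) = s ∧ ∀ i ≤ m, x (k + i) ∉ M := by
    intro k m hx h
    obtain rfl : m = 0 := by omega
    refine ⟨hx, fun i hi => ?_⟩
    obtain rfl : i = 0 := by omega
    rw [add_zero, hx]
    exact hs
  induction n with
  | zero =>
    intro k m h
    rw [lastVisit] at h
    split_ifs at h with hx
    exact h0 k m hx h
  | succ n ih =>
    intro k m h
    rw [lastVisit] at h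
    split_ifs at h with hM hz hx
    · exact h0 k m hx h
    · obtain ⟨m, rfl⟩ : ∃ m', m = m' + 1 := ⟨m - 1, by omega⟩
      obtain ⟨h1, h2⟩ := ih (k + 1) m (by omega)
      refine ⟨by rw [← h1]; congr 1; omega, fun i hi => ?_⟩
      rcases i with _ | i
      · exact hM
      · have := h2 i (by omega)
        rwa [add_assoc, add_comm 1 i] at this

theorem lastVisit_le_lastExit {s : V} {M : Finset V} (hs : s ∉ M) (x : ℕ → V) (n : ℕ) :
    (lastVisit s M x n 0 : ℝ≥0∞) ≤ lastExit s M x := by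
  rcases h : lastVisit s M x n 0 with _ | m
  · simp
  · obtain ⟨h1, h2⟩ := lastVisit_spec hs x n 0 m h
    simp only [zero_add] at h1 h2
    rw [lastExit]
    refine le_trans (by simp) (le_iSup₂ (f := fun (t : ℕ) (_ : x t = s ∧ ∀ i ≤ t, x i ∉ M) =>
      (t : ℝ≥0∞) + 1) m ⟨h1, h2⟩)

end LastVisit

namespace Network

open MeasureTheory

variable {V : Type u} [Fintype V] [DecidableEq V] {N : Network V} {s : V} {Ω : Type v}
  [MeasurableSpace Ω] {P : Measure Ω} {X : ℕ → Ω → V}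

/-- The event that the trajectory starts with `p 0, …, p k`. -/
def cylinder (X : ℕ → Ω → V) (p : ℕ → V) (k : ℕ) : Set Ω := {ω | ∀ i ≤ k, X i ω = p i}

theorem IsRandomWalk.measurableSet_cylinder (hX : N.IsRandomWalk s P X) (p : ℕ → V) (k : ℕ) :
    MeasurableSet (cylinder X p k) := by
  have : cylinder X p k = ⋂ i, ⋂ (_ : i ≤ k), {ω | X i ω = p i} := by
    ext ω
    simp [cylinder]
  rw [this]
  exact MeasurableSet.iInter fun i => MeasurableSet.iInter fun _ => hX.measurable i (p i)

theorem cylinder_succ (X : ℕ → Ω → V) (p : ℕ → V) (k : ℕ) (y : V) :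
    cylinder X (Function.update p (k + 1) y) (k + 1) = {ω ∈ cylinder X p k | X (k + 1) ω = y} := by
  ext ω
  constructor
  · intro h
    refine ⟨fun i hi => ?_, ?_⟩
    · rw [h i (by omega), Function.update_of_ne (by omega)]
    · rw [h (k + 1) le_rfl, Function.update_self]
  · rintro ⟨h1, h2⟩ i hi
    rcases eq_or_ne i (k + 1) with rfl | hne
    · rw [h2, Function.update_self]
    · rw [h1 i (by omega), Function.update_of_ne hne]

theorem IsRandomWalk.measure_cylinder_succ (hX : N.IsRandomWalk s P X) (p : ℕ → V) (k : ℕ)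
    (y : V) : P (cylinder X (Function.update p (k + 1) y) (k + 1)) =
      P (cylinder X p k) * ENNReal.ofReal (N.trans (p k) y) := by
  rw [cylinder, cylinder, hX.law, hX.law, Function.update_of_ne (by omega)]
  split_ifs
  · have h : ∀ i ∈ Finset.range k, N.w (Function.update p (k + 1) y i)
        (Function.update p (k + 1) y (i + 1)) / N.deg (Function.update p (k + 1) y i) =
        N.w (p i) (p (i + 1)) / N.deg (p i) := by
      intro i hi
      rw [Finset.mem_range] at hi
      rw [Function.update_of_ne (by omega), Function.update_of_ne (by omega)]
    rw [Finset.prod_range_succ, Finset.prod_congr rfl h, Function.update_self,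
      Function.update_of_ne (by omega), ENNReal.ofReal_mul]
    · rfl
    · exact Finset.prod_nonneg fun i _ => N.trans_nonneg (p i) (p (i + 1))
  · rw [zero_mul]

theorem IsRandomWalk.setLIntegral_cylinder (hX : N.IsRandomWalk s P X) (p : ℕ → V) (k : ℕ)
    (g : Ω → ℝ≥0∞) : ∫⁻ ω in cylinder X p k, g ω ∂P =
      ∑ y, ∫⁻ ω in cylinder X (Function.update p (k + 1) y) (k + 1), g ω ∂P := by
  have h : cylinder X p k = ⋃ y, cylinder X (Function.update p (k + 1) y) (k + 1) := by
    ext ω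
    simp [cylinder_succ]
  conv_lhs => rw [h]
  rw [lintegral_iUnion (fun y => hX.measurableSet_cylinder _ _), tsum_fintype]
  intro y z hyz
  rw [Function.onFun, Set.disjoint_left]
  intro ω h1 h2
  rw [cylinder_succ] at h1 h2
  exact hyz (h1.2.symm.trans h2.2)

/-- The Markov property as an inequality: the cylinder is split according to the next vertex. -/
theorem IsRandomWalk.step_le (hX : N.IsRandomWalk s P X) {a : V → ℝ} (ha : ∀ y, 0 ≤ a y)
    (p : ℕ → V) (k : ℕ) (g : Ω → ℝ≥0∞)
    (h : ∀ q : ℕ → V, P (cylinder X q (k + 1)) * ENNReal.ofReal (a (q (k + 1))) ≤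
      ∫⁻ ω in cylinder X q (k + 1), g ω ∂P) :
    P (cylinder X p k) * ENNReal.ofReal (∑ y, N.trans (p k) y * a y) ≤
      ∫⁻ ω in cylinder X p k, g ω ∂P := by
  rw [hX.setLIntegral_cylinder, ENNReal.ofReal_sum_of_nonneg
    (fun y _ => mul_nonneg (N.trans_nonneg _ _) (ha y)), Finset.mul_sum]
  refine Finset.sum_le_sum fun y _ => ?_
  refine le_trans (le_of_eq ?_) (h _)
  rw [hX.measure_cylinder_succ, Function.update_self, ENNReal.ofReal_mul (N.trans_nonneg _ _),
    mul_assoc]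

variable {M : Finset V}

/-- Only lower bounds on integrals are needed. These follow from monotonicity and superadditivity of
the lower integral, so measurability of the last visit is never required. -/
theorem IsRandomWalk.hitProb_le (hX : N.IsRandomWalk s P X) (hs : s ∉ M) (n : ℕ) :
    ∀ (k : ℕ) (p : ℕ → V), P (cylinder X p k) * ENNReal.ofReal (N.hitProb s M n (p k)) ≤
      ∫⁻ ω in cylinder X p k, (if lastVisit s M (fun i => X i ω) n k = 0 then 0 else 1) ∂P := by
  have hone : ∀ n k p, p k = s → P (cylinder X p k) * ENNReal.ofReal (N.hitProb s M n (p k)) ≤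
      ∫⁻ ω in cylinder X p k, (if lastVisit s M (fun i => X i ω) n k = 0 then 0 else 1) ∂P := by
    intro n k p hp
    rw [hp, hitProb_source, ENNReal.ofReal_one, mul_one, ← setLIntegral_one]
    refine setLIntegral_mono' (hX.measurableSet_cylinder p k) fun ω hω => ?_
    have hk : X k ω = s := (hω k le_rfl).trans hp
    rw [if_neg]
    cases n with
    | zero => simp [lastVisit, hk]
    | succ n =>
      rw [lastVisit, hk, if_neg hs, if_pos rfl]
      split_ifs <;> simp
  induction n with
  | zero =>
    intro k p
    by_cases hp : p k = s
    · exact hone 0 k p hp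
    · simp [hitProb, hp]
  | succ n ih =>
    intro k p
    by_cases hp : p k = s
    · exact hone (n + 1) k p hp
    by_cases hM : p k ∈ M
    · simp [hitProb, hp, hM]
    simp only [hitProb, hp, hM, if_false]
    refine (hX.step_le (fun y => N.hitProb_nonneg n y) p k _ fun q => ih (k + 1) q).trans ?_
    refine setLIntegral_mono' (hX.measurableSet_cylinder p k) fun ω hω => ?_
    have hk : X k ω = p k := hω k le_rfl
    simp only [lastVisit, hk, hp, hM, if_false]
    split_ifs <;> simp_all

theorem IsRandomWalk.exitTime_le (hX : N.IsRandomWalk s P X) (hs : s ∉ M) (n : ℕ) :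
    ∀ (k : ℕ) (p : ℕ → V), P (cylinder X p k) * ENNReal.ofReal (N.exitTime s M n (p k)) ≤
      ∫⁻ ω in cylinder X p k, (lastVisit s M (fun i => X i ω) n k : ℝ≥0∞) ∂P := by
  induction n with
  | zero =>
    intro k p
    have h := hX.hitProb_le hs 0 k p
    refine h.trans (setLIntegral_mono' (hX.measurableSet_cylinder p k) fun ω hω => ?_)
    simp only [lastVisit]
    split_ifs <;> simp_all
  | succ n ih =>
    intro k p
    by_cases hM : p k ∈ M
    · simp [exitTime, hM]
    have h1 := hX.hitProb_le hs (n + 1) k p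
    have h2 := hX.step_le (fun y => N.exitTime_nonneg n y) p k _ fun q => ih (k + 1) q
    have e : N.exitTime s M (n + 1) (p k) = N.hitProb s M (n + 1) (p k) +
        ∑ y, N.trans (p k) y * N.exitTime s M n y := by
      simp only [exitTime, hM, if_false]
    rw [e, ENNReal.ofReal_add (N.hitProb_nonneg _ _) (Finset.sum_nonneg fun y _ =>
      mul_nonneg (N.trans_nonneg _ _) (N.exitTime_nonneg n y)), mul_add]
    refine ((add_le_add h1 h2).trans (le_lintegral_add _ _)).trans ?_
    refine setLIntegral_mono' (hX.measurableSet_cylinder p k) fun ω hω => ?_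
    have hk : X k ω = p k := hω k le_rfl
    simp only [lastVisit, hk, hM, if_false]
    rcases lastVisit s M (fun i => X i ω) n (k + 1) with _ | m
    · split_ifs <;> simp_all
    · simp [add_comm]

/-- The truncated escape times are bounded by the escape time. -/
theorem IsRandomWalk.exitTime_le_escapeTime (hX : N.IsRandomWalk s P X) (hs : s ∉ M) (n : ℕ) :
    ENNReal.ofReal (N.exitTime s M n s) ≤ escapeTime s M P X := by
  have h := hX.exitTime_le hs n 0 (fun _ => s)
  have h1 : P (cylinder X (fun _ => s) 0) = 1 := by
    rw [cylinder, hX.law]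
    simp
  rw [h1, one_mul] at h
  refine h.trans ((setLIntegral_le_lintegral _ _).trans (lintegral_mono fun ω => ?_))
  exact lastVisit_le_lastExit hs _ n

end Network

/-! ## The electric flow of a potential -/

namespace Network

variable {V : Type u} [Fintype V] {N : Network V} {s : V} {M : Finset V} {v : V → ℝ}

/-- The flow of the potential `v`. -/
def potentialFlow (N : Network V) (v : V → ℝ) (x y : V) : ℝ := N.w x y * (v x - v y)

theorem potentialFlow_neg (N : Network V) (v : V → ℝ) (x y : V) :
    N.potentialFlow v x y = -N.potentialFlow v y x := by
  rw [potentialFlow, potentialFlow, N.symm x y]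
  ring

theorem sum_antisymm_mul_sub {g : V → V → ℝ} (hg : ∀ x y, g x y = -g y x) (v : V → ℝ) :
    ∑ x, ∑ y, g x y * (v x - v y) = 2 * ∑ x, v x * ∑ y, g x y := by
  have h : ∑ x, ∑ y, g x y * v y = -∑ x, ∑ y, g x y * v x := by
    rw [Finset.sum_comm, ← Finset.sum_neg_distrib]
    refine Finset.sum_congr rfl fun x _ => ?_
    rw [← Finset.sum_neg_distrib]
    exact Finset.sum_congr rfl fun y _ => by rw [hg y x, neg_mul]
  simp only [mul_sub, Finset.sum_sub_distrib, h, Finset.mul_sum, mul_comm (v _)]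
  rw [sub_neg_eq_add, ← two_mul, Finset.mul_sum]
  exact Finset.sum_congr rfl fun x _ => by rw [← Finset.sum_mul]

variable [DecidableEq V]

theorem IsPotential.sum_eq (hv : N.IsPotential s M v) (hs : s ∉ M) {c : V → ℝ}
    (h : ∀ x, x ≠ s → x ∉ M → c x = 0) : ∑ x, v x * c x = v s * c s := by
  rw [Finset.sum_eq_single_of_mem s (Finset.mem_univ s)]
  intro x _ hx
  by_cases hM : x ∈ M
  · rw [hv.sink x hM, zero_mul]
  · rw [h x hx hM, mul_zero]

theorem IsPotential.isUnitFlow (hv : N.IsPotential s M v) (hs : s ∉ M) :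
    N.IsUnitFlow s M (N.potentialFlow v) where
  support x y h := by rw [potentialFlow, h, zero_mul]
  antisymm := N.potentialFlow_neg v
  source := hv.source
  conserve := hv.harmonic
  sink := by
    have h0 : ∑ x, ∑ y, N.potentialFlow v x y = 0 := by
      have h : ∑ x, ∑ y, N.potentialFlow v x y = -∑ x, ∑ y, N.potentialFlow v x y := by
        conv_lhs => rw [Finset.sum_comm]
        rw [← Finset.sum_neg_distrib]
        refine Finset.sum_congr rfl fun x _ => ?_
        rw [← Finset.sum_neg_distrib]
        exact Finset.sum_congr rfl fun y _ => N.potentialFlow_neg v y x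
      linarith
    have h1 : ∑ x, ∑ y, N.potentialFlow v x y =
        ∑ x ∈ insert s M, ∑ y, N.potentialFlow v x y := by
      symm
      refine Finset.sum_subset (Finset.subset_univ _) fun x _ hx => ?_
      rw [Finset.mem_insert, not_or] at hx
      exact hv.harmonic x hx.1 hx.2
    rw [Finset.sum_insert hs, h0] at h1
    have h2 : ∑ y, N.potentialFlow v s y = 1 := hv.source
    have h3 : ∑ m ∈ M, ∑ y, N.potentialFlow v y m = -∑ m ∈ M, ∑ y, N.potentialFlow v m y := by
      rw [← Finset.sum_neg_distrib]
      refine Finset.sum_congr rfl fun x _ => ?_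
      rw [← Finset.sum_neg_distrib]
      exact Finset.sum_congr rfl fun y _ => N.potentialFlow_neg v y x
    linarith

/-- Summation by parts: pairing with the potential differences does not distinguish between unit
flows. This yields both the energy of the potential flow and its minimality. -/
theorem IsPotential.sum_unitFlow (hv : N.IsPotential s M v) (hs : s ∉ M) {g : V → V → ℝ}
    (hg : N.IsUnitFlow s M g) : ∑ x, ∑ y, g x y * (v x - v y) = 2 * v s := by
  rw [sum_antisymm_mul_sub hg.antisymm, hv.sum_eq hs hg.conserve, hg.source, mul_one]

theorem IsPotential.energy_potentialFlow (hv : N.IsPotential s M v) (hs : s ∉ M) :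
    N.energy (N.potentialFlow v) = v s := by
  have h : ∀ x y, N.potentialFlow v x y ^ 2 / N.w x y = N.potentialFlow v x y * (v x - v y) := by
    intro x y
    rcases (N.nonneg x y).eq_or_lt with h | h
    · simp [potentialFlow, ← h]
    · rw [potentialFlow]
      field_simp
  simp only [energy, h, hv.sum_unitFlow hs (hv.isUnitFlow hs)]
  ring

/-- Thomson's principle: expand the nonnegative square of g minus the potential flow; the cross term
is the same for every unit flow g. -/
theorem IsPotential.isElectricFlow (hv : N.IsPotential s M v) (hs : s ∉ M) :
    N.IsElectricFlow s M (N.potentialFlow v) := by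
  refine ⟨hv.isUnitFlow hs, fun g hg => ?_⟩
  rw [hv.energy_potentialFlow hs]
  have h : ∀ x y, 2 * (g x y * (v x - v y)) - N.potentialFlow v x y * (v x - v y) ≤
      g x y ^ 2 / N.w x y := by
    intro x y
    rcases (N.nonneg x y).eq_or_lt with h | h
    · simp [potentialFlow, ← h, hg.support x y h.symm]
    · rw [le_div_iff₀ h, potentialFlow]
      nlinarith [sq_nonneg (g x y - N.w x y * (v x - v y))]
  have h1 : ∑ x, ∑ y, (2 * (g x y * (v x - v y)) - N.potentialFlow v x y * (v x - v y)) ≤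
      ∑ x, ∑ y, g x y ^ 2 / N.w x y :=
    Finset.sum_le_sum fun x _ => Finset.sum_le_sum fun y _ => h x y
  simp only [Finset.sum_sub_distrib, ← Finset.mul_sum, hv.sum_unitFlow hs hg,
    hv.sum_unitFlow hs (hv.isUnitFlow hs)] at h1
  rw [energy]
  linarith

theorem IsPotential.effRes_eq (hv : N.IsPotential s M v) (hs : s ∉ M) : N.effRes s M = v s := by
  rw [← hv.energy_potentialFlow hs]
  refine IsLeast.csInf_eq ⟨⟨_, (hv.isElectricFlow hs).1, rfl⟩, ?_⟩
  rintro _ ⟨g, hg, rfl⟩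
  exact (hv.isElectricFlow hs).2 g hg

/-! ### The modified graph -/

variable {η : ℝ} (hη : 0 ≤ η)

theorem deg_modified_none : (N.modified s η hη).deg none = η * N.deg s := by
  simp [deg, modified, Fintype.sum_option]

theorem deg_modified_some (x : V) :
    (N.modified s η hη).deg (some x) = N.deg x + if x = s then η * N.deg s else 0 := by
  simp [deg, modified, Fintype.sum_option, add_comm]

/-- The potential on the modified graph. -/
def modifiedPotential (N : Network V) (s : V) (η : ℝ) (v : V → ℝ) : Option V → ℝ
  | none => v s + 1 / (η * N.deg s)
  | some x => v x

/-- The new edge has conductance η d_s, so a unit current drops the potential by 1/(η d_s) along it;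
its arrival at s cancels the old source. -/
theorem IsPotential.modified (hv : N.IsPotential s M v) (hd : 0 < η * N.deg s) :
    (N.modified s η hη).IsPotential none (M.map Function.Embedding.some)
      (N.modifiedPotential s η v) where
  source := by
    simp [modifiedPotential, Fintype.sum_option, Network.modified]
    rw [← mul_inv_rev]
    exact mul_inv_cancel₀ hd.ne'
  harmonic := by
    rintro (_ | x) hx hM
    · exact absurd rfl hx
    · have hM' : x ∉ M := fun h => hM (Finset.mem_map_of_mem _ h)
      simp only [modifiedPotential, Fintype.sum_option, Network.modified]
      by_cases h : x = s
      · subst h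
        rw [hv.source, if_pos rfl, sub_add_cancel_left, mul_neg, mul_one_div_cancel hd.ne',
          neg_add_cancel]
      · rw [hv.harmonic x h hM', if_neg h, zero_mul, zero_add]
  sink := by
    intro x hx
    rw [Finset.mem_map] at hx
    obtain ⟨y, hy, rfl⟩ := hx
    exact hv.sink y hy

end Network

/-! ## The geometry of the edge space -/

namespace Network

variable {V : Type u} [Fintype V] [DecidableEq V] (N : Network V)

/-- The edge state with amplitude `√w_xy * u x y` at the edge `xy`. -/
def edgeState (u : V → V → ℝ) : N.EdgeSpace :=
  WithLp.toLp 2 fun e => ((Real.sqrt (N.w e.1.1 e.1.2) * u e.1.1 e.1.2 : ℝ) : ℂ)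

theorem edgeState_apply (u : V → V → ℝ) (e : N.Edge) :
    N.edgeState u e = ((Real.sqrt (N.w e.1.1 e.1.2) * u e.1.1 e.1.2 : ℝ) : ℂ) := rfl

theorem edgeState_add (u u' : V → V → ℝ) :
    N.edgeState u + N.edgeState u' = N.edgeState fun x y => u x y + u' x y := by
  ext e
  simp only [PiLp.add_apply, edgeState_apply]
  push_cast
  ring

theorem smul_edgeState (c : ℝ) (u : V → V → ℝ) :
    (c : ℂ) • N.edgeState u = N.edgeState fun x y => c * u x y := by
  ext e
  simp only [PiLp.smul_apply, edgeState_apply, smul_eq_mul]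
  push_cast
  ring

theorem edgeState_congr {u u' : V → V → ℝ} (h : ∀ x y, 0 < N.w x y → u x y = u' x y) :
    N.edgeState u = N.edgeState u' := by
  ext e
  simp only [edgeState_apply, h _ _ e.2]

theorem swapOp_apply (ψ : N.EdgeSpace) (e : N.Edge) : N.swapOp ψ e = ψ (N.edgeRev e) := rfl

theorem swapOp_swapOp (ψ : N.EdgeSpace) : N.swapOp (N.swapOp ψ) = ψ := rfl

theorem swapOp_edgeState (u : V → V → ℝ) :
    N.swapOp (N.edgeState u) = N.edgeState fun x y => u y x := by
  ext e
  rw [swapOp_apply, edgeState_apply, edgeState_apply]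
  simp only [edgeRev, Equiv.coe_fn_mk, N.symm e.1.2 e.1.1]

theorem inner_edgeState (u u' : V → V → ℝ) :
    inner ℂ (N.edgeState u) (N.edgeState u') = ((∑ x, ∑ y, N.w x y * (u x y * u' x y) : ℝ) : ℂ) := by
  classical
  rw [PiLp.inner_apply, ← Fintype.sum_prod_type' fun x y => N.w x y * (u x y * u' x y),
    ← Finset.sum_subset (Finset.subset_univ (Finset.univ.filter fun e : V × V => 0 < N.w e.1 e.2)),
    Finset.sum_subtype (p := fun e : V × V => 0 < N.w e.1 e.2) _ (by simp)]
  · rw [Complex.ofReal_sum]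
    refine Finset.sum_congr rfl fun e _ => ?_
    rw [edgeState_apply, edgeState_apply, RCLike.inner_apply, Complex.conj_ofReal,
      ← Complex.ofReal_mul]
    congr 1
    have := Real.mul_self_sqrt e.2.le
    linear_combination (u e.1.1 e.1.2 * u' e.1.1 e.1.2) * this
  · intro e _ he
    have : N.w e.1 e.2 = 0 := le_antisymm (by simpa using he) (N.nonneg _ _)
    rw [this, zero_mul]

theorem norm_sq_edgeState (u : V → V → ℝ) :
    ‖N.edgeState u‖ ^ 2 = ∑ x, ∑ y, N.w x y * u x y ^ 2 := by
  have h := inner_self_eq_norm_sq_to_K (𝕜 := ℂ) (N.edgeState u)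
  rw [inner_edgeState] at h
  simp only [← sq] at h
  exact Complex.ofReal_injective (by rw [h]; simp)

theorem starState_eq (x : V) : N.starState x =
    N.edgeState fun a _ => if a = x then 1 / Real.sqrt (N.deg x) else 0 := by
  ext e
  rw [edgeState_apply]
  simp only [starState]
  split_ifs <;> simp [div_eq_mul_inv]

theorem flowState_potentialFlow {s : V} {M : Finset V} (v : V → ℝ) :
    N.flowState s M (N.potentialFlow v) =
      N.edgeState fun x y => (v x - v y) / Real.sqrt (2 * N.effRes s M) := by
  ext e
  rw [edgeState_apply]
  simp only [flowState, potentialFlow]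
  congr 1
  rw [mul_div_right_comm, Real.div_sqrt]
  ring

theorem inner_starState_edgeState (x : V) (u : V → V → ℝ) :
    inner ℂ (N.starState x) (N.edgeState u) =
      ((1 / Real.sqrt (N.deg x) * ∑ y, N.w x y * u x y : ℝ) : ℂ) := by
  rw [starState_eq, inner_edgeState, Finset.sum_eq_single x]
  · simp only [if_true, Finset.mul_sum]
    congr 1
    exact Finset.sum_congr rfl fun y _ => by ring
  · intro y _ hy
    simp [hy]
  · simp

theorem norm_starState {x : V} (h : 0 < N.deg x) : ‖N.starState x‖ = 1 := by
  have h1 : ‖N.starState x‖ ^ 2 = 1 := by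
    rw [starState_eq, norm_sq_edgeState, Finset.sum_eq_single x]
    · simp only [if_true, div_pow, Real.sq_sqrt h.le, one_pow]
      rw [← Finset.sum_mul]
      exact mul_one_div_cancel h.ne'
    · intro y _ hy
      simp [hy]
    · simp
  exact (pow_eq_one_iff_of_nonneg (norm_nonneg _) two_ne_zero).1 h1

variable {s : V} {M : Finset V}

theorem sourceRefl_apply (h : 0 < N.deg s) (ψ : N.EdgeSpace) :
    N.sourceRefl s ψ = (2 * inner ℂ (N.starState s) ψ) • N.starState s - ψ := by
  rw [sourceRefl, Submodule.reflection_singleton_apply, N.norm_starState h]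
  simp [two_smul, two_mul, add_smul]

theorem sourceRefl_edgeState_eq_neg (h : 0 < N.deg s) {u : V → V → ℝ}
    (hu : ∑ y, N.w s y * u s y = 0) : N.sourceRefl s (N.edgeState u) = -N.edgeState u := by
  rw [N.sourceRefl_apply h, inner_starState_edgeState, hu]
  simp

theorem walkOp_swapOp (ψ : N.EdgeSpace) :
    N.walkOp s M (N.swapOp ψ) = (N.starSpace s M).reflection ψ := rfl

/-- A coefficient that depends only on the tail x is a combination of star states, with weight g x
√d_x at x. -/
theorem edgeState_mem_starSpace {g : V → ℝ} (hg : g s = 0) (hM : ∀ x ∈ M, g x = 0) :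
    N.edgeState (fun x _ => g x) ∈ N.starSpace s M := by
  have h : N.edgeState (fun x _ => g x) =
      ∑ x, ((g x * Real.sqrt (N.deg x) : ℝ) : ℂ) • N.starState x := by
    ext e
    rw [WithLp.ofLp_sum, Finset.sum_apply, Finset.sum_eq_single e.1.1]
    · have hd : 0 < Real.sqrt (N.deg e.1.1) := Real.sqrt_pos.2 (e.2.trans_le (N.w_le_deg _ _))
      rw [PiLp.smul_apply, starState_eq, edgeState_apply, edgeState_apply, smul_eq_mul,
        ← Complex.ofReal_mul, if_pos rfl]
      congr 1
      field_simp
    · intro x _ hx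
      rw [PiLp.smul_apply, starState_eq, edgeState_apply, if_neg hx.symm]
      simp
    · simp
  rw [h]
  refine Submodule.sum_mem _ fun x _ => ?_
  by_cases hx : x ≠ s ∧ x ∉ M
  · exact Submodule.smul_mem _ _ (Submodule.subset_span ⟨x, hx, rfl⟩)
  · have : g x = 0 := by
      by_cases hxs : x = s
      · rw [hxs, hg]
      · exact hM x (by tauto)
    rw [this]
    simp

/-- Orthogonality to a star state is Kirchhoff's law at that vertex. -/
theorem edgeState_mem_starSpace_orthogonal {u : V → V → ℝ}
    (hu : ∀ x, x ≠ s → x ∉ M → ∑ y, N.w x y * u x y = 0) :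
    N.edgeState u ∈ (N.starSpace s M)ᗮ := by
  rw [starSpace, Submodule.mem_orthogonal]
  intro ψ hψ
  induction hψ using Submodule.span_induction with
  | mem ψ h =>
    obtain ⟨x, hx, rfl⟩ := h
    rw [inner_starState_edgeState, hu x hx.1 hx.2]
    simp
  | zero => exact inner_zero_left _
  | add a b _ _ ha hb => rw [inner_add_left, ha, hb, add_zero]
  | smul c a _ ha => rw [inner_smul_left, ha, mul_zero]

variable {N} {v : V → ℝ}

theorem IsPotential.norm_flowState (hv : N.IsPotential s M v) (hs : s ∉ M) (h0 : 0 < v s) :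
    ‖N.flowState s M (N.potentialFlow v)‖ ^ 2 = 1 := by
  have h := hv.sum_unitFlow hs (hv.isUnitFlow hs)
  rw [flowState_potentialFlow, norm_sq_edgeState, hv.effRes_eq hs]
  have e : ∀ x y, N.w x y * ((v x - v y) / Real.sqrt (2 * v s)) ^ 2 =
      N.potentialFlow v x y * (v x - v y) / (2 * v s) := by
    intro x y
    rw [div_pow, Real.sq_sqrt (by positivity), potentialFlow]
    ring
  simp only [e, ← Finset.sum_div, h]
  exact div_self (by positivity)

/-- A unit flow leaves s, so the overlap of the star state with the flow state is 1/√(2 R_s d_s). -/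
theorem IsPotential.sourceRefl_flowState (hv : N.IsPotential s M v) (hs : s ∉ M)
    (hd : 0 < N.deg s) : N.sourceRefl s (N.flowState s M (N.potentialFlow v)) =
      (2 * (1 / Real.sqrt (2 * v s * N.deg s) : ℝ) : ℂ) • N.starState s -
        N.flowState s M (N.potentialFlow v) := by
  rw [N.sourceRefl_apply hd, flowState_potentialFlow, inner_starState_edgeState, hv.effRes_eq hs]
  have h : ∑ y, N.w s y * ((v s - v y) / Real.sqrt (2 * v s)) = 1 / Real.sqrt (2 * v s) := by
    rw [← hv.source, Finset.sum_div]
    exact Finset.sum_congr rfl fun y _ => by ring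
  rw [h, Real.sqrt_mul' _ hd.le, mul_comm (Real.sqrt (2 * v s)), one_div_mul_one_div_rev,
    mul_comm (Real.sqrt (2 * v s))]

theorem swapOp_flowState (N : Network V) (v : V → ℝ) :
    N.swapOp (N.flowState s M (N.potentialFlow v)) = -N.flowState s M (N.potentialFlow v) := by
  rw [flowState_potentialFlow, swapOp_edgeState]
  ext e
  simp only [PiLp.neg_apply, edgeState_apply]
  push_cast
  ring

theorem IsPotential.reflection_flowState (hv : N.IsPotential s M v) :
    N.walkOp s M (N.swapOp (N.flowState s M (N.potentialFlow v))) =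
      -N.flowState s M (N.potentialFlow v) := by
  rw [walkOp_swapOp, flowState_potentialFlow]
  refine Submodule.reflection_mem_subspace_orthogonalComplement_eq_neg
    (N.edgeState_mem_starSpace_orthogonal fun x hx hM => ?_)
  simp only [← mul_div_assoc, ← Finset.sum_div, hv.harmonic x hx hM, zero_div]

/-- The source star state, decomposed along the flow state and the invariant spaces of the two
reflections of the walk. -/
theorem IsPotential.exists_decomposition (hv : N.IsPotential s M v) (hs : s ∉ M) (h0 : 0 < v s)
    (hd : 0 < N.deg s) : ∃ a b : N.EdgeSpace,
      N.starState s = ((1 / Real.sqrt (2 * v s * N.deg s) : ℝ) : ℂ) •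
        N.flowState s M (N.potentialFlow v) + (a + b) ∧
      N.swapOp a = a ∧ N.walkOp s M (N.swapOp b) = b ∧
      ‖a‖ ^ 2 ≤ (∑ x, N.deg x * v x ^ 2) / (v s ^ 2 * N.deg s) ∧
      ‖b‖ ^ 2 ≤ (∑ x, N.deg x * v x ^ 2) / (v s ^ 2 * N.deg s) := by
  have hsq : Real.sqrt (N.deg s) ^ 2 = N.deg s := Real.sq_sqrt hd.le
  have hpos : 0 < Real.sqrt (N.deg s) := Real.sqrt_pos.2 hd
  have hdeg : ∑ x, N.deg x * v x ^ 2 = ∑ x, ∑ y, N.w x y * v x ^ 2 := by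
    simp only [deg, Finset.sum_mul]
  -- Split v x into (v x - v y)/2, which is the flow, and (v x + v y)/2, which is symmetric.
  -- Removing the stars at x ≠ s from v x / (v s √d_s) leaves the star state at s.
  refine ⟨N.edgeState fun x y => (v x + v y) / (2 * v s * Real.sqrt (N.deg s)),
    N.edgeState fun x _ => if x = s then 0 else -v x / (v s * Real.sqrt (N.deg s)),
    ?_, ?_, ?_, ?_, ?_⟩
  · rw [flowState_potentialFlow, hv.effRes_eq hs, smul_edgeState, edgeState_add, edgeState_add,
      starState_eq]
    congr 1
    funext x y
    have h2 : Real.sqrt (2 * v s * N.deg s) = Real.sqrt (2 * v s) * Real.sqrt (N.deg s) :=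
      Real.sqrt_mul' _ hd.le
    have h3 : 1 / Real.sqrt (2 * v s * N.deg s) * ((v x - v y) / Real.sqrt (2 * v s)) =
        (v x - v y) / (2 * v s * Real.sqrt (N.deg s)) := by
      rw [h2, div_mul_div_comm, one_mul]
      congr 1
      have := Real.mul_self_sqrt (show 0 ≤ 2 * v s by positivity)
      linear_combination Real.sqrt (N.deg s) * this
    rw [h3]
    by_cases hx : x = s
    · subst hx
      rw [if_pos rfl, if_pos rfl]
      field_simp
      ring
    · rw [if_neg hx, if_neg hx]
      field_simp
      ring
  · rw [swapOp_edgeState]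
    simp only [add_comm]
  · rw [walkOp_swapOp]
    refine Submodule.reflection_mem_subspace_eq_self (N.edgeState_mem_starSpace ?_ ?_)
    · rw [if_pos rfl]
    · intro x hx
      rw [hv.sink x hx]
      simp
  · rw [norm_sq_edgeState, le_div_iff₀ (by positivity)]
    have e : ∀ x y, N.w x y * ((v x + v y) / (2 * v s * Real.sqrt (N.deg s))) ^ 2 *
        (v s ^ 2 * N.deg s) = N.w x y * (v x + v y) ^ 2 / 4 := by
      intro x y
      rw [div_pow, mul_pow, hsq]
      field_simp
      ring
    simp only [Finset.sum_mul, e]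
    have h1 : ∑ x, ∑ y, N.w x y * (v x + v y) ^ 2 / 4 ≤
        ∑ x, ∑ y, (N.w x y * v x ^ 2 / 2 + N.w x y * v y ^ 2 / 2) :=
      Finset.sum_le_sum fun x _ => Finset.sum_le_sum fun y _ => by
        nlinarith [mul_nonneg (N.nonneg x y) (sq_nonneg (v x - v y))]
    have h2 : ∑ x, ∑ y, N.w x y * v y ^ 2 = ∑ x, N.deg x * v x ^ 2 := by
      rw [Finset.sum_comm, hdeg]
      exact Finset.sum_congr rfl fun x _ => Finset.sum_congr rfl fun y _ => by rw [N.symm]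
    simp only [Finset.sum_add_distrib, ← Finset.sum_div, h2, ← hdeg] at h1 ⊢
    linarith
  · rw [norm_sq_edgeState, le_div_iff₀ (by positivity), hdeg]
    simp only [Finset.sum_mul]
    refine Finset.sum_le_sum fun x _ => Finset.sum_le_sum fun y _ => ?_
    by_cases hx : x = s
    · rw [if_pos hx]
      simpa using mul_nonneg (N.nonneg x y) (sq_nonneg (v x))
    · rw [if_neg hx, div_pow, mul_pow, hsq]
      refine le_of_eq ?_
      field_simp

end Network

/-! ## The source of the modified graph -/

/-- The vectors (t, 1) and (1, -t) are eigenvectors with eigenvalues 1 and -1, which determines the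
reflection on the plane. -/
theorem reflection_of_mem {F : Type*} [NormedAddCommGroup F] [InnerProductSpace ℂ F]
    {K : Submodule ℂ F} [K.HasOrthogonalProjection] {z φ : F} (t : ℝ) (h1 : (t : ℂ) • z + φ ∈ K)
    (h2 : z - (t : ℂ) • φ ∈ Kᗮ) :
    K.reflection z = (((t ^ 2 - 1) / (t ^ 2 + 1) : ℝ) : ℂ) • z +
        ((2 * t / (t ^ 2 + 1) : ℝ) : ℂ) • φ ∧
      K.reflection φ = ((2 * t / (t ^ 2 + 1) : ℝ) : ℂ) • z -
        (((t ^ 2 - 1) / (t ^ 2 + 1) : ℝ) : ℂ) • φ := by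
  have e1 := Submodule.reflection_mem_subspace_eq_self h1
  have e2 := Submodule.reflection_mem_subspace_orthogonalComplement_eq_neg h2
  have h0 : (t : ℂ) ^ 2 + 1 ≠ 0 := by
    exact_mod_cast (by positivity : t ^ 2 + 1 ≠ 0)
  have hz : z = (1 / ((t : ℂ) ^ 2 + 1)) • ((t : ℂ) • ((t : ℂ) • z + φ) + (z - (t : ℂ) • φ)) := by
    match_scalars
    · field_simp
    · field_simp
      ring
  have hφ : φ = (1 / ((t : ℂ) ^ 2 + 1)) • (((t : ℂ) • z + φ) - (t : ℂ) • (z - (t : ℂ) • φ)) := by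
    match_scalars
    · field_simp
      ring
    · field_simp
      ring
  constructor
  · conv_lhs => rw [hz]
    rw [map_smul, map_add, map_smul, e1, e2]
    push_cast
    match_scalars
    · field_simp
      ring
    · field_simp
      ring
  · conv_lhs => rw [hφ]
    rw [map_smul, map_sub, map_smul, e1, e2]
    push_cast
    match_scalars
    · field_simp
      ring
    · field_simp
      ring

namespace Network

variable {V : Type u} [Fintype V] [DecidableEq V] (N : Network V) {s : V} {M : Finset V} {η : ℝ}
  (hη : 0 ≤ η)

theorem liftState_starState : N.liftState s η hη (N.starState s) =
    (N.modified s η hη).edgeState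
      fun x y => if x = some s ∧ y ≠ none then 1 / Real.sqrt (N.deg s) else 0 := by
  ext ⟨⟨x, y⟩, h⟩
  rw [edgeState_apply]
  rcases x with _ | x <;> rcases y with _ | y
  · simp [liftState]
  · simp [liftState]
  · simp [liftState]
  · by_cases hx : x = s <;> simp [liftState, starState, hx, modified, div_eq_mul_inv]

theorem swapOp_starState_none : (N.modified s η hη).swapOp ((N.modified s η hη).starState none) =
    (N.modified s η hη).edgeState
      fun _ y => if y = none then 1 / Real.sqrt (η * N.deg s) else 0 := by
  rw [starState_eq, swapOp_edgeState, deg_modified_none]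

theorem sourceRefl_swapOp_starState (hd : 0 < η * N.deg s) :
    (N.modified s η hη).sourceRefl none
      ((N.modified s η hη).swapOp ((N.modified s η hη).starState none)) =
      -(N.modified s η hη).swapOp ((N.modified s η hη).starState none) := by
  rw [swapOp_starState_none]
  refine sourceRefl_edgeState_eq_neg _ (by rwa [deg_modified_none]) ?_
  simp [modified]

theorem sourceRefl_liftState (hd : 0 < η * N.deg s) :
    (N.modified s η hη).sourceRefl none (N.liftState s η hη (N.starState s)) =
      -N.liftState s η hη (N.starState s) := by
  rw [liftState_starState]
  refine sourceRefl_edgeState_eq_neg _ (by rwa [deg_modified_none]) ?_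
  simp

theorem sourceRefl_swapOp_liftState (hd : 0 < η * N.deg s) :
    (N.modified s η hη).sourceRefl none
      ((N.modified s η hη).swapOp (N.liftState s η hη (N.starState s))) =
      -(N.modified s η hη).swapOp (N.liftState s η hη (N.starState s)) := by
  rw [liftState_starState, swapOp_edgeState]
  refine sourceRefl_edgeState_eq_neg _ (by rwa [deg_modified_none]) ?_
  simp

theorem norm_liftState_starState (hd : 0 < N.deg s) :
    ‖N.liftState s η hη (N.starState s)‖ ^ 2 = 1 := by
  have h : ∑ x, ∑ y, N.w x y * (if x = s then 1 / Real.sqrt (N.deg s) else 0) ^ 2 = 1 := by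
    rw [← norm_sq_edgeState, ← starState_eq, N.norm_starState hd, one_pow]
  rw [liftState_starState, norm_sq_edgeState]
  refine Eq.trans ?_ h
  simp [Fintype.sum_option, modified]

/-- This vector is √(1+η) times the star state of s in the modified graph. -/
theorem sqrt_smul_add_mem_starSpace (hs : s ∉ M) (hd : 0 < N.deg s) (h0 : 0 < η) :
    (Real.sqrt η : ℂ) • (N.modified s η hη).swapOp ((N.modified s η hη).starState none) +
      N.liftState s η hη (N.starState s) ∈
      (N.modified s η hη).starSpace none (M.map Function.Embedding.some) := by
  have h : (Real.sqrt η : ℂ) • (N.modified s η hη).swapOp ((N.modified s η hη).starState none) +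
      N.liftState s η hη (N.starState s) = (N.modified s η hη).edgeState
        fun x _ => if x = some s then 1 / Real.sqrt (N.deg s) else 0 := by
    rw [swapOp_starState_none, liftState_starState, smul_edgeState, edgeState_add]
    refine edgeState_congr _ fun x y hxy => ?_
    have e1 : Real.sqrt η * (1 / Real.sqrt (η * N.deg s)) = 1 / Real.sqrt (N.deg s) := by
      have := Real.sqrt_pos.2 h0
      rw [Real.sqrt_mul' _ hd.le]
      field_simp
    rcases x with _ | x <;> rcases y with _ | y
    · simp [modified] at hxy
    · simp
    · have hx : x = s := by
        by_contra hx
        simp [modified, hx] at hxy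
      simpa [hx] using e1
    · simp
  rw [h]
  refine edgeState_mem_starSpace _ ?_ ?_
  · simp
  · intro x hx
    rw [if_neg]
    rintro rfl
    rw [Finset.mem_map] at hx
    obtain ⟨y, hy, hys⟩ := hx
    exact hs (Option.some.inj hys ▸ hy)

/-- At s the divergence is √(η d_s) from the new edge minus √η √d_s from the old ones; the vector
vanishes at the tails other than s. -/
theorem sub_sqrt_smul_mem_starSpace_orthogonal (h0 : 0 < η) :
    (N.modified s η hη).swapOp ((N.modified s η hη).starState none) -
      (Real.sqrt η : ℂ) • N.liftState s η hη (N.starState s) ∈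
      ((N.modified s η hη).starSpace none (M.map Function.Embedding.some))ᗮ := by
  rw [sub_eq_add_neg, ← neg_smul, ← Complex.ofReal_neg, swapOp_starState_none, liftState_starState,
    smul_edgeState, edgeState_add]
  refine edgeState_mem_starSpace_orthogonal _ fun x hx _ => ?_
  rcases x with _ | x
  · exact absurd rfl hx
  by_cases h : x = s
  · subst h
    simp only [Fintype.sum_option, modified, if_true, ne_eq, not_true_eq_false, and_false, if_false,
      mul_zero, add_zero, reduceCtorEq, not_false_eq_true, and_true, zero_add, mul_one_div,
      Real.div_sqrt, ← Finset.sum_mul]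
    rw [show ∑ y, N.w x y = N.deg x from rfl, Real.sqrt_mul h0.le]
    have : N.deg x * (-Real.sqrt η / Real.sqrt (N.deg x)) =
        -Real.sqrt η * (N.deg x / Real.sqrt (N.deg x)) := by ring
    rw [this, Real.div_sqrt]
    ring
  · simp [modified, h]

/-- The two-dimensional space spanned by the reversed source star state of the modified graph and
the source star state of the graph is invariant under the reflection about the star space. -/
theorem walkOp_source (hs : s ∉ M) (hd : 0 < N.deg s) (h0 : 0 < η) :
    let Nhat := N.modified s η hη
    let W := Nhat.walkOp none (M.map Function.Embedding.some)
    let z := Nhat.swapOp (Nhat.starState none)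
    let φ := N.liftState s η hη (N.starState s)
    W (Nhat.swapOp z) = (((η - 1) / (η + 1) : ℝ) : ℂ) • z +
        ((2 * Real.sqrt η / (η + 1) : ℝ) : ℂ) • φ ∧
      W (Nhat.swapOp φ) = ((2 * Real.sqrt η / (η + 1) : ℝ) : ℂ) • z -
        (((η - 1) / (η + 1) : ℝ) : ℂ) • φ := by
  intro Nhat W z φ
  have h := reflection_of_mem (K := Nhat.starSpace none (M.map Function.Embedding.some))
    (z := z) (φ := φ) (Real.sqrt η) (N.sqrt_smul_add_mem_starSpace hη hs hd h0)
    (N.sub_sqrt_smul_mem_starSpace_orthogonal hη h0)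
  rw [Real.sq_sqrt hη] at h
  exact h

end Network

/-! ### Angles and norms on the modified graph -/

namespace Network

variable {V : Type u} [Fintype V] [DecidableEq V] {N : Network V} {s : V} {M : Finset V}
  {v : V → ℝ}

/-- Relative to the denominator, σ contributes 1, the additional degree at s at most 1 since the
resistance only grows, and the old graph at most κ: v_s B = v_s η r ≤ κ v_s² η d_s. -/
theorem IsPotential.modified_sum_le (hv0 : 0 < v s) {κ B r η : ℝ}
    (hB : 0 < B) (hr : 0 < r) (hsum : ∑ x, N.deg x * v x ^ 2 ≤ v s * B) (hd : 0 < N.deg s)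
    (hr' : r ≤ κ * (v s * N.deg s)) (hη : 0 ≤ η) (hηr : η * r = B) :
    (∑ x, (N.modified s η hη).deg x * N.modifiedPotential s η v x ^ 2) /
      (N.modifiedPotential s η v none ^ 2 * (N.modified s η hη).deg none) ≤ 2 + κ := by
  have hη0 : 0 < η := pos_of_mul_pos_left (hηr ▸ hB) hr.le
  have hηd : 0 < η * N.deg s := by positivity
  set R' := N.modifiedPotential s η v none with hR'
  have hR : v s ≤ R' := by
    have : 0 < 1 / (η * N.deg s) := by positivity
    simp only [hR', modifiedPotential]
    linarith
  have hR0 : 0 < R' := hv0.trans_le hR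
  have hRR : v s ^ 2 ≤ R' ^ 2 := pow_le_pow_left₀ hv0.le hR 2
  rw [div_le_iff₀ (by rw [deg_modified_none]; positivity), Fintype.sum_option, deg_modified_none,
    ← hR']
  have e : ∑ x, (N.modified s η hη).deg (some x) *
      N.modifiedPotential s η v (some x) ^ 2 =
      ∑ x, N.deg x * v x ^ 2 + η * N.deg s * v s ^ 2 := by
    simp [deg_modified_some, modifiedPotential, add_mul, Finset.sum_add_distrib]
  rw [e]
  have h1 : v s * B ≤ κ * (v s ^ 2 * (η * N.deg s)) := by
    have : κ * (v s ^ 2 * (η * N.deg s)) = v s * B * (κ * (v s * N.deg s) / r) := by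
      rw [← hηr]
      field_simp
    rw [this]
    exact le_mul_of_one_le_right (by positivity) ((one_le_div hr).2 hr')
  have h2 : v s ^ 2 * (η * N.deg s) ≤ R' ^ 2 * (η * N.deg s) :=
    mul_le_mul_of_nonneg_right hRR hηd.le
  have hκ : 0 < κ := by
    by_contra h
    have : κ * (v s * N.deg s) ≤ 0 := mul_nonpos_of_nonpos_of_nonneg (not_lt.1 h) (by positivity)
    linarith
  have h3 := mul_le_mul_of_nonneg_left h2 hκ.le
  linarith

theorem IsPotential.exists_transduces (hv : N.IsPotential s M v) (hs : s ∉ M) (hv0 : 0 < v s)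
    {κ B r η p q : ℝ} (hκ : 1 ≤ κ) (hB : 0 < B) (hr : 0 < r)
    (hsum : ∑ x, N.deg x * v x ^ 2 ≤ v s * B) (hd1 : 1 ≤ v s * N.deg s)
    (hr1 : v s * N.deg s / κ ≤ r) (hr2 : r ≤ κ * (v s * N.deg s)) (hpq : p ^ 2 + q ^ 2 = 1)
    (hpq' : p ^ 2 + (-q) ^ 2 = 1) (hρ : q ^ 2 - p ^ 2 = (1 + 1 / Real.sqrt (1 + B))⁻¹)
    (hη : 0 ≤ η) (hηr : η * r = B) :
    ∀ ψ : (N.modified s η hη).EdgeSpace, ψ = N.liftState s η hη (N.starState s) ∨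
      ψ = (N.modified s η hη).starState none →
    ∃ (Γ : lp (fun _ : Mem 5 2 => ℂ) 2) (w : Joint (N.modified s η hη).EdgeSpace 5 2),
      ‖Γ‖ = 1 ∧
      Transduces (circuitEval (N.modified s η hη).swapOp
          ((N.modified s η hη).sourceRefl none)
          ((N.modified s η hη).walkOp none (M.map Function.Embedding.some))
          (elfCircuit p q hpq hpq'))
        (publicSpace _ 5 2) (tensor ψ (memZero 5 2))
        (tensor ((N.modified s η hη).flowState none (M.map Function.Embedding.some)
          ((N.modified s η hη).potentialFlow (N.modifiedPotential s η v))) Γ) w ∧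
      ‖w‖ ^ 2 ≤ 2592 * (2 + κ) * κ * Real.sqrt B := by
  have hd : 0 < N.deg s := by
    by_contra h
    have : v s * N.deg s ≤ 0 := mul_nonpos_of_nonneg_of_nonpos hv0.le (not_lt.1 h)
    linarith
  have hκ0 : 0 < κ := by linarith
  -- The term at s of the sum alone; with `hd1` it gives 1 ≤ B.
  have hB1 : v s * N.deg s ≤ B := by
    have h1 := Finset.single_le_sum (f := fun x => N.deg x * v x ^ 2)
      (fun x _ => mul_nonneg (N.deg_nonneg x) (sq_nonneg _)) (Finset.mem_univ s)
    have h2 := h1.trans hsum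
    refine le_of_mul_le_mul_left ?_ hv0
    calc v s * (v s * N.deg s) = N.deg s * v s ^ 2 := by ring
      _ ≤ v s * B := h2
  have hη0 : 0 < η := pos_of_mul_pos_left (hηr ▸ hB) hr.le
  have hηd : 0 < η * N.deg s := by positivity
  have hη1 : 1 ≤ κ * η := by
    refine le_of_mul_le_mul_right (a := v s * N.deg s) ?_ (by linarith)
    have := mul_le_mul_of_nonneg_left hr2 hη
    linarith
  have hη3 : η * (v s * N.deg s) ≤ κ * B := by
    rw [div_le_iff₀ hκ0] at hr1
    have := mul_le_mul_of_nonneg_left hr1 hη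
    rwa [← mul_assoc η r, hηr, mul_comm B] at this
  have hη2 : η ≤ κ * B := (le_mul_of_one_le_right hη hd1).trans hη3
  set Nhat := N.modified s η hη
  set Mhat := M.map Function.Embedding.some
  set V' := N.modifiedPotential s η v with hV'
  have hhat : Nhat.IsPotential none Mhat V' := hv.modified hη hηd
  have hshat : none ∉ Mhat := by simp [Mhat]
  have hV0 : 0 < V' none := by
    simp only [hV', modifiedPotential]
    positivity
  have hdhat : Nhat.deg none = η * N.deg s := deg_modified_none hη
  have hdhat0 : 0 < Nhat.deg none := by rwa [hdhat]
  have hVd : 2 * V' none * Nhat.deg none = 2 * (1 + η * (v s * N.deg s)) := by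
    rw [hdhat]
    simp only [hV', modifiedPotential]
    field_simp
    ring
  obtain ⟨a, b, hdec, ha, hb, na, nb⟩ := hhat.exists_decomposition hshat hV0 hdhat0
  have hK := IsPotential.modified_sum_le hv0 hB hr hsum hd hr2 hη hηr
  replace na := na.trans hK
  replace nb := nb.trans hK
  set α := 1 / Real.sqrt (2 * V' none * Nhat.deg none) with hα
  have hα2 : α ^ 2 * (2 * (1 + η * (v s * N.deg s))) = 1 := by
    rw [hα, div_pow, Real.sq_sqrt (by positivity), hVd]
    field_simp
  have hαle : α ^ 2 ≤ 1 / 2 := by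
    nlinarith [sq_nonneg α, mul_nonneg (sq_nonneg α) (by positivity : 0 ≤ η * (v s * N.deg s))]
  set β := Real.sqrt (1 - α ^ 2) with hβdef
  have hβ2 : β ^ 2 = 1 - α ^ 2 := Real.sq_sqrt (by linarith)
  have hβ0 : 0 < β := Real.sqrt_pos.2 (by linarith)
  -- Normalising by β costs at most a factor 2, as β² ≥ 1/2.
  have hscale : ∀ x : Nhat.EdgeSpace, ‖x‖ ^ 2 ≤ 2 + κ →
      ‖((1 / β : ℝ) : ℂ) • x‖ ^ 2 ≤ 2 * (2 + κ) := by
    intro x hx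
    rw [norm_smul, mul_pow, Complex.norm_real, Real.norm_eq_abs, sq_abs, div_pow, hβ2, one_pow,
      one_div_mul_eq_div, div_le_iff₀ (by linarith)]
    nlinarith
  set ε := 1 / Real.sqrt (1 + B) with hε
  have hεsq : ε ^ 2 = 1 / (1 + B) := by rw [hε, div_pow, Real.sq_sqrt (by linarith), one_pow]
  have hε0 : 0 < ε := by positivity
  set σ := 1 / Real.sqrt κ with hσ
  have hσsq : σ ^ 2 = 1 / κ := by rw [hσ, div_pow, Real.sq_sqrt (by linarith), one_pow]
  have hσ0 : 0 < σ := by positivity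
  have hσε : (σ * ε) ^ 2 = 1 / (κ * (1 + B)) := by
    rw [mul_pow, hσsq, hεsq]
    field_simp
  have hw := N.walkOp_source hη hs hd hη0
  intro ψ hψ
  obtain ⟨Γ, w, hΓ, ht, hle⟩ := exists_transduces_of_geometry Nhat.swapOp (Nhat.sourceRefl none)
    (Nhat.walkOp none Mhat) p q ε σ α β (2 * (2 + κ)) ((η - 1) / (η + 1))
    (2 * Real.sqrt η / (η + 1)) hε0
    (by
      rw [hε, div_le_one (by positivity)]
      exact Real.one_le_sqrt.2 (by linarith))
    hσ0
    (by
      rw [hσ, div_le_one (by positivity)]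
      exact Real.one_le_sqrt.2 hκ)
    hpq hpq' hρ (by rw [hβ2]; ring) hβ0.ne'
    (by
      -- 4α²β² ≥ 2α² = 1/(1 + η R_s d_s), and η R_s d_s ≤ κB.
      refine (le_abs_self _).trans (sq_le_sq.1 ?_)
      have h1 : α ^ 2 * (1 + η * (v s * N.deg s)) ≤ α ^ 2 * (κ * (1 + B)) :=
        mul_le_mul_of_nonneg_left (by linarith) (sq_nonneg α)
      have h2 : α ^ 2 * (κ * (1 + B)) * (1 / 2) ≤ α ^ 2 * (κ * (1 + B)) * β ^ 2 :=
        mul_le_mul_of_nonneg_left (by linarith) (by positivity)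
      rw [hσε, mul_pow, mul_pow, div_le_iff₀ (by positivity)]
      linarith)
    (by linarith)
    (by
      rw [div_pow, div_pow, mul_pow, Real.sq_sqrt hη]
      field_simp
      ring)
    (by
      -- (η + 1)² ≤ 4ηκ(1 + B), because η ≤ κB and 1 ≤ κη.
      refine (le_abs_self _).trans (sq_le_sq.1 ?_)
      have h1 : η * η ≤ η * (κ * B) := mul_le_mul_of_nonneg_left hη2 hη
      have h2 : η ≤ η * κ := le_mul_of_one_le_right hη hκ
      have h3 : 0 ≤ η * (κ * B) := by positivity
      rw [hσε, div_pow, mul_pow, Real.sq_sqrt hη, div_le_div_iff₀ (by positivity) (by positivity)]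
      linarith)
    (e := Nhat.starState none) (a := ((1 / β : ℝ) : ℂ) • a) (b := ((1 / β : ℝ) : ℂ) • b)
    (z := Nhat.swapOp (Nhat.starState none)) (φ := N.liftState s η hη (N.starState s))
    (f := Nhat.flowState none Mhat (Nhat.potentialFlow V'))
    (Submodule.reflection_mem_subspace_eq_self (Submodule.mem_span_singleton_self _))
    (by
      rw [hdec, ← smul_add, smul_smul, ← Complex.ofReal_mul, mul_one_div_cancel hβ0.ne',
        Complex.ofReal_one, one_smul])
    (hhat.sourceRefl_flowState hshat hdhat0)
    (Nhat.swapOp_flowState V') hhat.reflection_flowState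
    (by rw [map_smul, ha]) (by rw [map_smul, map_smul, hb])
    (hhat.norm_flowState hshat hV0).le (hscale a na) (hscale b nb) rfl (Nhat.swapOp_swapOp _)
    (N.sourceRefl_swapOp_starState hη hηd) (N.sourceRefl_liftState hη hηd)
    (Nhat.swapOp_swapOp _) (N.sourceRefl_swapOp_liftState hη hηd) hw.1 hw.2
    (by rw [LinearIsometryEquiv.norm_map, Nhat.norm_starState hdhat0, one_pow])
    (N.norm_liftState_starState hη hd).le ψ hψ
  refine ⟨Γ, w, hΓ, ht, hle.trans ?_⟩
  -- Since 1 ≤ B, the shift by one, which keeps ε ≤ 1, is harmless.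
  have hB4 : Real.sqrt (1 + B) ≤ 2 * Real.sqrt B := by
    rw [show (2 : ℝ) * Real.sqrt B = Real.sqrt (2 ^ 2 * B) by
      rw [Real.sqrt_mul (by norm_num), Real.sqrt_sq (by norm_num)]]
    exact Real.sqrt_le_sqrt (by linarith)
  have h := mul_le_mul_of_nonneg_left hB4 (by positivity : 0 ≤ 1296 * (2 + κ) * κ)
  have e : 648 * (2 * (2 + κ)) / (σ ^ 2 * ε) = 1296 * (2 + κ) * κ * Real.sqrt (1 + B) := by
    rw [hσsq, hε]
    field_simp
    ring
  rw [e]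
  linarith

end Network

end

/-! ### Choice of the parameters -/

theorem mainTheorem9 (κ : ℝ) (hκ : 1 ≤ κ) :
    ∃ (C : ℝ) (k : ℕ), ∀ (ETbar r : ℝ) (hET : 0 < ETbar) (hr : 0 < r),
      ∃ (q c : ℕ) (circ : List (Gate q c)),
        circ.countP (fun g => g.isWalk) = 1 ∧
        (circ.countP (fun g => !g.isWalk) : ℝ) ≤ C * (1 + Real.log (1 + ETbar)) ^ k ∧
        ∀ (V : Type u) [Fintype V] [DecidableEq V] (N : Network V) (s : V) (M : Finset V),
          s ∉ M → N.Reaches s M →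
          ∀ (Ω : Type v) [MeasurableSpace Ω] (P : MeasureTheory.Measure Ω)
            [MeasureTheory.IsProbabilityMeasure P] (X : ℕ → Ω → V),
            N.IsRandomWalk s P X →
            escapeTime s M P X ≤ ENNReal.ofReal ETbar →
            N.effRes s M * N.deg s / κ ≤ r → r ≤ κ * (N.effRes s M * N.deg s) →
            let hη : 0 ≤ ETbar / r := (div_pos hET hr).le
            let Nhat : Network (Option V) := N.modified s (ETbar / r) hη
            let Mhat : Finset (Option V) := M.map Function.Embedding.some
            let S : Joint Nhat.EdgeSpace q c ≃ₗᵢ[ℂ] Joint Nhat.EdgeSpace q c :=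
              circuitEval Nhat.swapOp (Nhat.sourceRefl none) (Nhat.walkOp none Mhat) circ
            ∃ fhat : Option V → Option V → ℝ, Nhat.IsElectricFlow none Mhat fhat ∧
              ∀ ψ : Nhat.EdgeSpace,
                ψ = N.liftState s (ETbar / r) hη (N.starState s) ∨ ψ = Nhat.starState none →
                ∃ (Γ : lp (fun _ : Mem q c => ℂ) 2) (w : Joint Nhat.EdgeSpace q c),
                  ‖Γ‖ = 1 ∧
                  Transduces S (publicSpace Nhat.EdgeSpace q c)
                    (tensor ψ (memZero q c))
                    (tensor (Nhat.flowState none Mhat fhat) Γ) w ∧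
                  ‖w‖ ^ 2 ≤ C * Real.sqrt ETbar := by
  have hC : 44 ≤ 2592 * (2 + κ) * κ := by nlinarith
  -- The exponent is 0: the circuit has 44 elementary gates whatever the bound, which enters only
  -- through the angle of the coin rotation.
  refine ⟨2592 * (2 + κ) * κ, 0, fun B r hB hr => ?_⟩
  set ε := 1 / Real.sqrt (1 + B) with hε
  have hε0 : 0 < ε := by positivity
  have hinv1 : (1 + ε)⁻¹ ≤ 1 := inv_le_one_of_one_le₀ (by linarith)
  have hinv0 : 0 < (1 + ε)⁻¹ := by positivity
  -- Cosine and sine of the coin are the solution of p² + q² = 1 and q² - p² = 1/(1+ε).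
  have hp : Real.sqrt ((1 - (1 + ε)⁻¹) / 2) ^ 2 = (1 - (1 + ε)⁻¹) / 2 :=
    Real.sq_sqrt (by linarith)
  have hq : Real.sqrt ((1 + (1 + ε)⁻¹) / 2) ^ 2 = (1 + (1 + ε)⁻¹) / 2 :=
    Real.sq_sqrt (by linarith)
  refine ⟨5, 2, elfCircuit (Real.sqrt ((1 - (1 + ε)⁻¹) / 2)) (Real.sqrt ((1 + (1 + ε)⁻¹) / 2))
    (by rw [hp, hq]; ring) (by rw [neg_sq, hp, hq]; ring), countP_walk_elfCircuit _ _ _ _, ?_, ?_⟩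
  · rw [countP_not_walk_elfCircuit, pow_zero, mul_one]
    exact_mod_cast hC
  intro V _ _ N s M hs hreach Ω _ P _ X hX hET hr1 hr2 hη Nhat Mhat S
  have hexit : ∀ n, N.exitTime s M n s ≤ B := fun n =>
    (ENNReal.ofReal_le_ofReal_iff hB.le).1 ((hX.exitTime_le_escapeTime hs n).trans hET)
  obtain ⟨v, hv, hv0, hsum, hd1⟩ := N.exists_isPotential_sum_le hs hreach hexit
  rw [hv.effRes_eq hs] at hr1 hr2
  have hd : 0 < N.deg s := pos_of_mul_pos_right (by linarith) hv0.le
  have hηd : 0 < B / r * N.deg s := by positivity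
  refine ⟨Nhat.potentialFlow (N.modifiedPotential s (B / r) v),
    (hv.modified hη hηd).isElectricFlow (by simp), ?_⟩
  exact hv.exists_transduces hs hv0 hκ hB hr hsum hd1 hr1 hr2 _ _ (by rw [hp, hq]; ring) hη
    (div_mul_cancel₀ _ hr.ne')
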